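/- Let $0\le d\le p$ be integers and let $\alpha\in[0,1]$ be fixed. Let $\mathbf z_1,\mathbf z_2,\dots$ be independent copies of a random vector $\mathbf z=(z_1,\dots,z_p)^T$ whose components are mutually independent with $E(z_k)=0$ and $E(z_k^2)=1$, where $z_1,\dots,z_d$ (the signals) are non-Gaussian and $z_{d+1},\dots,z_p$ (the noise) are Gaussian. Let $\mathbf x_i=\boldsymbol\mu+\mathbf z_i$ with $\boldsymbol\mu\in\mathbb R^p$ (the independent component model $\mathbf x=\boldsymbol\mu+\boldsymbol\Omega\mathbf z$ with $\boldsymbol\Omega=\mathbf I_p$). For a real random variable $y$ put $y_{st}=(y-E y)/\sqrt{\mathrm{Var}(y)}$, $\gamma(y)=E(y_{st}^3)$ and $\kappa(y)=E(y_{st}^4)-3$. For a distribution $F$ on $\mathbb R^p$ with non-singular covariance matrix $\boldsymbol\Sigma$, let $\mathbf x\sim F$, let $\boldsymbol\Sigma^{-1/2}$ be the symmetric positive definite inverse square root of $\boldsymbol\Sigma$, let $\mathbf x_{st}=\boldsymbol\Sigma^{-1/2}(\mathbf x-E\mathbf x)$ and $G_\alpha(\mathbf u)=\alpha\,\gamma(\mathbf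 u^T\mathbf x_{st})^2+(1-\alpha)\,\kappa(\mathbf u^T\mathbf x_{st})^2$. A value of the symmetric projection pursuit functional at $F$ is any matrix $\mathbf W=\mathbf U\boldsymbol\Sigma^{-1/2}\in\mathbb R^{d\times p}$ such that $\mathbf U=(\mathbf u_1,\dots,\mathbf u_d)^T$ maximizes $\sum_{k=1}^d G_\alpha(\mathbf u_k)$ over all $d\times p$ matrices with $\mathbf U\mathbf U^T=\mathbf I_d$. A sequence of solutions is a sequence $\hat{\mathbf W}=\hat{\mathbf W}_n$ of measurable functions of $\mathbf x_1,\dots,\mathbf x_n$ such that $\hat{\mathbf W}_n$ is a value of this functional at the empirical distribution of $\mathbf x_1,\dots,\mathbf x_n$ whenever the sample covariance matrix is non-singular. Write $\gamma_k=E(z_k^3)$, $\beta_k=E(z_k^4)$, $\kappa_k=\beta_k-3$, $\nu_k=\beta_k-1$, $\omega_k=E(z_k^6)-\gamma_k^2$, $\eta_k=E(z_k^5)-\gamma_k$, $\alpha_1=3\alpha$, $\alpha_2=4(1-\alpha)$, $\zeta^{(3)}_k=\gamma_k^2(\nu_k-\gamma_k^2)$, $\zeta^{(4)}_k=\kappa_k^2(\omega_k-\beta_k^2)$,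 $\zeta^{(34)}_k=\gamma_k\kappa_k(\eta_k-\gamma_k\beta_k)$, and $$A_k=\frac{\alpha_1^2\zeta^{(3)}_k+2\alpha_1\alpha_2\zeta^{(34)}_k+\alpha_2^2\zeta^{(4)}_k}{(\alpha_1\gamma_k^2+\alpha_2\kappa_k^2)^2},\qquad D_k=\frac{\kappa_k+2}{4},$$ $$B_{kl}=\frac{\alpha_1^2(\zeta^{(3)}_k+\zeta^{(3)}_l+\gamma_l^4)+2\alpha_1\alpha_2(\zeta^{(34)}_k+\zeta^{(34)}_l+\gamma_l^2\kappa_l^2)+\alpha_2^2(\zeta^{(4)}_k+\zeta^{(4)}_l+\kappa_l^4)}{(\alpha_1(\gamma_k^2+\gamma_l^2)+\alpha_2(\kappa_k^2+\kappa_l^2))^2}.$$ Assume that the eighth moments of the components of $\mathbf z$ exist and that $\alpha\gamma_j^2+(1-\alpha)\kappa_j^2>0$ for all $1\le j\le d$. Then there exists a sequence of solutions $\hat{\mathbf W}$ such that $\hat{\mathbf W}\to_P(\mathbf I_d,\mathbf 0)$ and $\sqrt n\,\mathrm{vec}(\hat{\mathbf W}-(\mathbf I_d,\mathbf 0))$ converges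 in distribution to a (possibly degenerate) multivariate normal distribution with mean $\mathbf 0$ whose variances are, for $1\le k\le d$ and $1\le l\le p$, $$ASV(\hat w_{kl})=B_{kl}\ (l\le d,\ l\ne k),\qquad ASV(\hat w_{kk})=D_k,\qquad ASV(\hat w_{kl})=A_k\ (l>d).$$ -/

import Mathlib

open MeasureTheory ProbabilityTheory Filter Topology Matrix

namespace ProjPursuit

noncomputable section

/-! ## Univariate moments -/

section Univariate

variable {Ω : Type*} [MeasurableSpace Ω]

/-- The standardized version `(X - E X) / √(Var X)` of a real random variable. -/
def standardized (X : Ω → ℝ) (P : Measure Ω) : Ω → ℝ :=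
  fun ω => (X ω - ∫ ω', X ω' ∂P) / √(variance X P)

/-- Classical skewness: third moment of the standardized variable. -/
def skewness (X : Ω → ℝ) (P : Measure Ω) : ℝ := ∫ ω, (standardized X P ω) ^ 3 ∂P

/-- Excess kurtosis: fourth moment of the standardized variable, minus three. -/
def excessKurtosis (X : Ω → ℝ) (P : Measure Ω) : ℝ := ∫ ω, (standardized X P ω) ^ 4 ∂P - 3

/-! Shorthands for the moments of one component of `z` (which has mean 0 and variance 1). -/

/-- `γ = E Z³`. -/
def gam (Z : Ω → ℝ) (P : Measure Ω) : ℝ := ∫ ω, Z ω ^ 3 ∂P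
/-- `β = E Z⁴`. -/
def bet (Z : Ω → ℝ) (P : Measure Ω) : ℝ := ∫ ω, Z ω ^ 4 ∂P
/-- `κ = E Z⁴ - 3`. -/
def kap (Z : Ω → ℝ) (P : Measure Ω) : ℝ := ∫ ω, Z ω ^ 4 ∂P - 3
/-- `ν = E Z⁴ - 1`. -/
def nuc (Z : Ω → ℝ) (P : Measure Ω) : ℝ := ∫ ω, Z ω ^ 4 ∂P - 1
/-- `ω = E Z⁶ - (E Z³)²`. -/
def omg (Z : Ω → ℝ) (P : Measure Ω) : ℝ := ∫ ω, Z ω ^ 6 ∂P - (∫ ω, Z ω ^ 3 ∂P) ^ 2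
/-- `η = E Z⁵ - E Z³`. -/
def eta (Z : Ω → ℝ) (P : Measure Ω) : ℝ := ∫ ω, Z ω ^ 5 ∂P - ∫ ω, Z ω ^ 3 ∂P

/-- `ζ⁽³⁾ = γ² (ν - γ²)`. -/
def zeta3 (Z : Ω → ℝ) (P : Measure Ω) : ℝ := gam Z P ^ 2 * (nuc Z P - gam Z P ^ 2)
/-- `ζ⁽⁴⁾ = κ² (ω - β²)`. -/
def zeta4 (Z : Ω → ℝ) (P : Measure Ω) : ℝ := kap Z P ^ 2 * (omg Z P - bet Z P ^ 2)
/-- `ζ⁽³⁴⁾ = γ κ (η - γ β)`. -/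
def zeta34 (Z : Ω → ℝ) (P : Measure Ω) : ℝ :=
  gam Z P * kap Z P * (eta Z P - gam Z P * bet Z P)

/-- `α₁ = 3 α`. -/
def alpha1 (α : ℝ) : ℝ := 3 * α
/-- `α₂ = 4 (1 - α)`. -/
def alpha2 (α : ℝ) : ℝ := 4 * (1 - α)

/-- The quantity `A_k`, for `Z = z_k`. -/
def asvA (α : ℝ) (Z : Ω → ℝ) (P : Measure Ω) : ℝ :=
  (alpha1 α ^ 2 * zeta3 Z P + 2 * alpha1 α * alpha2 α * zeta34 Z P + alpha2 α ^ 2 * zeta4 Z P)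
    / (alpha1 α * gam Z P ^ 2 + alpha2 α * kap Z P ^ 2) ^ 2

/-- The quantity `B_{kl}`, for `Z = z_k` and `Y = z_l`. -/
def asvB (α : ℝ) (Z Y : Ω → ℝ) (P : Measure Ω) : ℝ :=
  (alpha1 α ^ 2 * (zeta3 Z P + zeta3 Y P + gam Y P ^ 4)
      + 2 * alpha1 α * alpha2 α * (zeta34 Z P + zeta34 Y P + gam Y P ^ 2 * kap Y P ^ 2)
      + alpha2 α ^ 2 * (zeta4 Z P + zeta4 Y P + kap Y P ^ 4))
    / (alpha1 α * (gam Z P ^ 2 + gam Y P ^ 2) + alpha2 α * (kap Z P ^ 2 + kap Y P ^ 2)) ^ 2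

/-- The quantity `D_k`, for `Z = z_k`. -/
def asvD (Z : Ω → ℝ) (P : Measure Ω) : ℝ := (kap Z P + 2) / 4

end Univariate

/-! ## The model -/

section Model

variable {Ω : Type*} [MeasurableSpace Ω] {p : ℕ}

/-- `z` has mutually independent standardized components, of which the first `d` (the signals)
are non-Gaussian and the remaining ones (the noise) are Gaussian. -/
structure IsSourceVector (d : ℕ) (z : Ω → EuclideanSpace ℝ (Fin p)) (P : Measure Ω) : Prop where
  measurable : Measurable z
  indep : iIndepFun (fun (k : Fin p) ω => z ω k) P
  mean_zero : ∀ k, ∫ ω, z ω k ∂P = 0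
  second_moment_one : ∀ k, ∫ ω, z ω k ^ 2 ∂P = 1
  signal : ∀ k : Fin p, (k : ℕ) < d → ¬ HasGaussianLaw (fun ω => z ω k) P
  noise : ∀ k : Fin p, d ≤ (k : ℕ) → HasGaussianLaw (fun ω => z ω k) P

/-- `x 0, x 1, …` is an i.i.d. sequence from the model `x = μ + A z`, with latent vectors `z i`
and a non-singular mixing matrix `A`. -/
structure IsModelSample (d : ℕ) (μ : EuclideanSpace ℝ (Fin p)) (A : Matrix (Fin p) (Fin p) ℝ)
    (z x : ℕ → Ω → EuclideanSpace ℝ (Fin p)) (P : Measure Ω) : Prop where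
  mixing_nonsingular : IsUnit A
  source : ∀ i, IsSourceVector d (z i) P
  indep : iIndepFun z P
  identDistrib : ∀ i, IdentDistrib (z i) (z 0) P P
  observed : ∀ i ω, x i ω = μ + WithLp.toLp 2 (A *ᵥ (z i ω).ofLp)

end Model

/-! ## The symmetric projection pursuit functional -/

section Functional

variable {p : ℕ}

/-- The covariance matrix of a distribution `F` on `ℝᵖ`. -/
def covMatrix (F : Measure (EuclideanSpace ℝ (Fin p))) : Matrix (Fin p) (Fin p) ℝ :=
  Matrix.of fun k l => cov[fun x => x k, fun x => x l; F]

open scoped MatrixOrder in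
/-- The symmetric inverse square root `S^{-1/2}` of a positive definite matrix. -/
def invSqrt (S : Matrix (Fin p) (Fin p) ℝ) : Matrix (Fin p) (Fin p) ℝ := (CFC.sqrt S)⁻¹

/-- `x_st = Σ^{-1/2} (x - E x)`, where `x` has distribution `F` with covariance matrix `Σ`. -/
def standardizedVec (F : Measure (EuclideanSpace ℝ (Fin p))) (x : EuclideanSpace ℝ (Fin p)) :
    Fin p → ℝ :=
  invSqrt (covMatrix F) *ᵥ (x - ∫ y, y ∂F).ofLp

/-- The projection index `G_α(u) = α γ²(uᵀ x_st) + (1 - α) κ²(uᵀ x_st)`, for `x` with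
distribution `F`. -/
def projIndex (α : ℝ) (F : Measure (EuclideanSpace ℝ (Fin p))) (u : Fin p → ℝ) : ℝ :=
  α * skewness (fun x => u ⬝ᵥ standardizedVec F x) F ^ 2
    + (1 - α) * excessKurtosis (fun x => u ⬝ᵥ standardizedVec F x) F ^ 2

/-- `W` is a value of the symmetric projection pursuit functional at `F`: `W = U Σ^{-1/2}`, where
`U` maximizes `∑ₖ G_α(uₖ)` among all `d × p` matrices with orthonormal rows. -/
def IsSymmetricSolution {d : ℕ} (α : ℝ) (F : Measure (EuclideanSpace ℝ (Fin p)))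
    (W : Matrix (Fin d) (Fin p) ℝ) : Prop :=
  ∃ U : Matrix (Fin d) (Fin p) ℝ, U * Uᵀ = 1 ∧
    (∀ V : Matrix (Fin d) (Fin p) ℝ, V * Vᵀ = 1 →
      ∑ k, projIndex α F (V k) ≤ ∑ k, projIndex α F (U k)) ∧
    W = U * invSqrt (covMatrix F)

/-- The empirical distribution of `n` points. -/
def empirical {n : ℕ} (x : Fin n → EuclideanSpace ℝ (Fin p)) :
    Measure (EuclideanSpace ℝ (Fin p)) :=
  (n : ENNReal)⁻¹ • ∑ i, Measure.dirac (x i)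

/-- The matrix `(I_d, 0)`. -/
def idZero (d p : ℕ) : Matrix (Fin d) (Fin p) ℝ :=
  Matrix.of fun k l => if (k : ℕ) = (l : ℕ) then 1 else 0

/-- `vec(M)`, as an element of Euclidean space; the entry `M k l` sits at the index `(l, k)`. -/
def vecE {d : ℕ} (M : Matrix (Fin d) (Fin p) ℝ) : EuclideanSpace ℝ (Fin p × Fin d) :=
  WithLp.toLp 2 (Matrix.vec M)

end Functional

end

end ProjPursuit

open ProjPursuit

/-! The estimator is a function of finitely many sample moments, and the theorem is a delta method
for that function. Collect the moments up to order four of `(1, x - μ)` in a tensor `M`. The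
covariance matrix, and the index in a direction of unit variance, depend on the sample only through
`M` (`covMatrix_empirical`, `index_sampleMoments`).

Choice and consistency. Signed permutations of the rows leave the objective unchanged, so maximizers
are not unique and one must be selected measurably. Minimizing continuous functions successively
over compact sets does this (`exists_measurable_selection`), and `exists_selection` puts the largest
trace first. At the population, Cauchy-Schwarz bounds the index of a unit vector `w` by `∑ w_a⁴
g_a`, with `g_a > 0` exactly for signals (`index_le`). Equality forces a signed permutation of
`(I_d, 0)`, and the trace rule leaves `(I_d, 0)` alone (`eq_idFrame`). Compactness gives convergence
of the selection (`tendsto_selection`).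

Differentiability. Rotating a maximizer gives first-order conditions: cross-gradients between rows
are symmetric (`grad_comm`), and every gradient is carried by the span of the rows (`grad_eq_sum`).
Together with orthonormality these equations, linearized at the population, determine the
first-order change of `W` as the linear map `infl` of the change of `M` (`isLittleO_sub_infl`).
Convergence of `W` is already known, so an absorption argument (`isLittleO_of_isLittleO_prod`) takes
the place of an implicit function theorem.

Limit law. Chebyshev's inequality makes the remainder negligible after scaling by `√n`
(`tendstoInMeasure_sqrt_smul`), and the linear term is a normalized i.i.d. sum. Off the diagonal its
summand is `(a(z_k) z_l - b(z_l) z_k) / (curv_k + curv_l)` with cubic `a`, `b`, where `a(z_k)` is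
uncorrelated with `z_k`. The cross term therefore drops out of the variance, which gives `B_kl`, and
`A_k` is the case of Gaussian `z_l`. -/

namespace ProjPursuit

/-! ## Measurable selection of maximizers -/

section Selection

variable {X Y : Type*} [MeasurableSpace X] [TopologicalSpace Y]

/-- A multifunction with nonempty compact values such that the set of points whose value meets a
given closed set is measurable. -/
structure IsMeasurableMultifunction (A : X → Set Y) : Prop where
  isCompact : ∀ x, IsCompact (A x)
  nonempty : ∀ x, (A x).Nonempty
  measurableSet : ∀ C, IsClosed C → MeasurableSet {x | (A x ∩ C).Nonempty}

/-- The points of `A x` at which `φ` is minimal. -/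
def minimizers (A : X → Set Y) (φ : Y → ℝ) (x : X) : Set Y :=
  {y ∈ A x | ∀ y' ∈ A x, φ y ≤ φ y'}

/-- A minimizer over `A x` lies in `C` iff `A x` meets `C` and the minimum over `A x ∩ C` equals
that over `A x`. The equality of minima can be tested on sublevel sets at rational levels, which
leaves a countable intersection. -/
lemma IsMeasurableMultifunction.minimizers [T2Space Y] {A : X → Set Y}
    (hA : IsMeasurableMultifunction A) {φ : Y → ℝ} (hφ : Continuous φ) :
    IsMeasurableMultifunction (minimizers A φ) where
  isCompact x := by
    have : ProjPursuit.minimizers A φ x = A x ∩ ⋂ y' ∈ A x, {y | φ y ≤ φ y'} := by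
      ext y; simp [ProjPursuit.minimizers]
    rw [this]
    exact (hA.isCompact x).inter_right
      (isClosed_biInter fun y' _ => isClosed_le hφ continuous_const)
  nonempty x := by
    obtain ⟨y, hy, hmin⟩ := (hA.isCompact x).exists_isMinOn (hA.nonempty x) hφ.continuousOn
    exact ⟨y, hy, fun y' hy' => hmin hy'⟩
  measurableSet C hC := by
    have key : {x | (ProjPursuit.minimizers A φ x ∩ C).Nonempty} =
        {x | (A x ∩ C).Nonempty} ∩ ⋂ q : ℚ, ({x | (A x ∩ {y | φ y ≤ q}).Nonempty}ᶜ ∪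
          {x | (A x ∩ (C ∩ {y | φ y ≤ q})).Nonempty}) := by
      ext x
      simp only [Set.mem_ofPred_eq, Set.mem_inter_iff, Set.mem_iInter, Set.mem_union,
        Set.mem_compl_iff]
      constructor
      · rintro ⟨y, ⟨hy, hmin⟩, hyC⟩
        refine ⟨⟨y, hy, hyC⟩, fun q => ?_⟩
        by_cases h : (A x ∩ {y | φ y ≤ q}).Nonempty
        · obtain ⟨y', hy', hq⟩ := h
          exact Or.inr ⟨y, hy, hyC, (hmin y' hy').trans hq⟩
        · exact Or.inl h
      · rintro ⟨hne, hq⟩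
        obtain ⟨y, ⟨hy, hyC⟩, hmin⟩ :=
          ((hA.isCompact x).inter_right hC).exists_isMinOn hne hφ.continuousOn
        refine ⟨y, ⟨hy, fun y' hy' => ?_⟩, hyC⟩
        by_contra! hlt
        obtain ⟨q, h1, h2⟩ := exists_rat_btwn hlt
        rcases hq q with h | ⟨y'', hy'', hC'', hle⟩
        · exact h ⟨y', hy', h1.le⟩
        · exact absurd (hmin ⟨hy'', hC''⟩) (not_le.2 (lt_of_le_of_lt hle h2))
    rw [key]
    refine (hA.measurableSet C hC).inter (MeasurableSet.iInter fun q => ?_)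
    exact (hA.measurableSet _ (isClosed_le hφ continuous_const)).compl.union
      (hA.measurableSet _ (hC.inter (isClosed_le hφ continuous_const)))

/-- Lexicographic minimization: minimizing `φ` makes `φ` constant on what remains, and later
minimizations only shrink the set. -/
lemma IsMeasurableMultifunction.exists_constant_on [T2Space Y] {A : X → Set Y}
    (hA : IsMeasurableMultifunction A) (L : List (Y → ℝ)) (hL : ∀ φ ∈ L, Continuous φ) :
    ∃ B : X → Set Y, IsMeasurableMultifunction B ∧ (∀ x, B x ⊆ A x) ∧
      ∀ φ ∈ L, ∀ x, ∀ y ∈ B x, ∀ y' ∈ B x, φ y = φ y' := by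
  induction L generalizing A with
  | nil => exact ⟨A, hA, fun _ => subset_rfl, by simp⟩
  | cons φ L ih =>
    obtain ⟨B, hB, hBA, hBL⟩ := ih (hA.minimizers (hL φ (by simp)))
      (fun ψ hψ => hL ψ (by simp [hψ]))
    refine ⟨B, hB, fun x y hy => (hBA x hy).1, fun ψ hψ x y hy y' hy' => ?_⟩
    rcases List.mem_cons.1 hψ with rfl | hψ
    · exact le_antisymm ((hBA x hy).2 y' (hBA x hy').1) ((hBA x hy').2 y (hBA x hy).1)
    · exact hBL ψ hψ x y hy y' hy'

/-- If finitely many continuous functions separate points, a measurable multifunction has a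
measurable selection. -/
lemma IsMeasurableMultifunction.exists_measurable_selection [T2Space Y] [MeasurableSpace Y]
    [BorelSpace Y] {A : X → Set Y} (hA : IsMeasurableMultifunction A) (L : List (Y → ℝ))
    (hL : ∀ φ ∈ L, Continuous φ) (hsep : ∀ y y', (∀ φ ∈ L, φ y = φ y') → y = y') :
    ∃ f : X → Y, Measurable f ∧ ∀ x, f x ∈ A x := by
  obtain ⟨B, hB, hBA, hBL⟩ := hA.exists_constant_on L hL
  choose f hf using hB.nonempty
  -- Since `L` separates points, `B x` is a singleton, so the preimage of `C` under `f` is the set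
  -- where `B x` meets `C`.
  refine ⟨f, measurable_of_isClosed fun C hC => ?_, fun x => hBA x (hf x)⟩
  convert hB.measurableSet C hC using 1
  ext x
  constructor
  · exact fun h => ⟨f x, hf x, h⟩
  · rintro ⟨y, hy, hyC⟩
    rwa [Set.mem_preimage, hsep (f x) y fun φ hφ => hBL φ hφ x _ (hf x) _ hy]

/-- The set of parameters with a maximizer in `C` is the projection of a closed set along the
compact factor `K ∩ C`, hence closed. -/
lemma isMeasurableMultifunction_maximizers [TopologicalSpace X] [OpensMeasurableSpace X]
    [T2Space Y] {φ : X → Y → ℝ} (hφ : Continuous fun q : X × Y => φ q.1 q.2) {K : Set Y}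
    (hK : IsCompact K) (hKne : K.Nonempty) :
    IsMeasurableMultifunction fun x => {y ∈ K | ∀ y' ∈ K, φ x y' ≤ φ x y} where
  isCompact x := by
    have : {y ∈ K | ∀ y' ∈ K, φ x y' ≤ φ x y} = K ∩ ⋂ y' ∈ K, {y | φ x y' ≤ φ x y} := by
      ext y; simp
    rw [this]
    exact hK.inter_right (isClosed_biInter fun y' _ => isClosed_le continuous_const (by fun_prop))
  nonempty x := by
    obtain ⟨y, hy, hmax⟩ := hK.exists_isMaxOn hKne
      (f := φ x) (Continuous.continuousOn (by fun_prop))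
    exact ⟨y, hy, fun y' hy' => hmax hy'⟩
  measurableSet C hC := by
    have hKC : IsCompact (K ∩ C) := hK.inter_right hC
    have : CompactSpace (K ∩ C : Set Y) := isCompact_iff_compactSpace.1 hKC
    have hcl : IsClosed {q : X × (K ∩ C : Set Y) | ∀ y' ∈ K, φ q.1 y' ≤ φ q.1 q.2} := by
      simp only [Set.ofPred_forall]
      refine isClosed_biInter fun y' _ => isClosed_le ?_ ?_
      · exact hφ.comp (by fun_prop : Continuous fun q : X × (K ∩ C : Set Y) => (q.1, y'))
      · exact hφ.comp
          (by fun_prop : Continuous fun q : X × (K ∩ C : Set Y) => (q.1, (q.2 : Y)))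
    convert (isClosedMap_fst_of_compactSpace _ hcl).measurableSet using 1
    ext x
    constructor
    · rintro ⟨y, ⟨hyK, hmax⟩, hyC⟩
      exact ⟨(x, ⟨y, hyK, hyC⟩), hmax, rfl⟩
    · rintro ⟨⟨x', ⟨y, hyK, hyC⟩⟩, hmax, rfl⟩
      exact ⟨y, ⟨hyK, hmax⟩, hyC⟩

end Selection

/-- Maximizers over a compact set depend continuously on the parameter at a parameter where the
maximizer is unique among the possible limits. -/
lemma tendsto_maximizer {ι X Y : Type*} [TopologicalSpace X] [TopologicalSpace Y] [T2Space Y]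
    {φ : X → Y → ℝ} (hφ : Continuous fun q : X × Y => φ q.1 q.2) {K K' : Set Y}
    (hK : IsCompact K) (hK' : IsClosed K') {x₀ : X} {y₀ : Y} (hy₀ : y₀ ∈ K)
    (huniq : ∀ y ∈ K ∩ K', φ x₀ y₀ ≤ φ x₀ y → y = y₀) {l : Filter ι} {t : ι → X} {u : ι → Y}
    (ht : Tendsto t l (𝓝 x₀)) (hu : ∀ i, u i ∈ K ∩ K')
    (hmax : ∀ i, ∀ y ∈ K, φ (t i) y ≤ φ (t i) (u i)) : Tendsto u l (𝓝 y₀) := by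
  rw [tendsto_nhds]
  intro O hO hyO
  have hc : IsCompact ((K ∩ K') \ O) := (hK.inter_right hK').diff hO
  have hop : IsOpen {q : X × Y | φ q.1 q.2 < φ q.1 y₀} :=
    isOpen_lt hφ (hφ.comp (by fun_prop : Continuous fun q : X × Y => (q.1, y₀)))
  have hsub : ({x₀} : Set X) ×ˢ ((K ∩ K') \ O) ⊆ {q : X × Y | φ q.1 q.2 < φ q.1 y₀} := by
    rintro ⟨x, y⟩ ⟨hx, hy, hyO'⟩
    obtain rfl : x = x₀ := hx
    by_contra hlt
    exact hyO' (huniq y hy (not_lt.1 hlt) ▸ hyO)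
  -- At `x₀` every candidate outside `O` is strictly worse than `y₀`; by compactness this persists
  -- for all parameters in a neighbourhood of `x₀`.
  obtain ⟨V, W, hV, -, hxV, hcW, hVW⟩ := generalized_tube_lemma isCompact_singleton hc hop hsub
  filter_upwards [ht (hV.mem_nhds (hxV rfl))] with i hi
  by_contra hiO
  have := hVW (Set.mk_mem_prod hi (hcW ⟨hu i, hiO⟩))
  exact absurd (hmax i y₀ hy₀) (not_le.2 this)

/-! ## Moment tensors -/

section Tensor

variable {p : ℕ}

/-- Tensors of order four on `ℝ × ℝᵖ`; the index `none` stands for the constant `1`. -/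
abbrev Tens (p : ℕ) : Type :=
  Option (Fin p) → Option (Fin p) → Option (Fin p) → Option (Fin p) → ℝ

/-- The vector `(1, x)`. -/
def aug (x : EuclideanSpace ℝ (Fin p)) : Option (Fin p) → ℝ := fun o => o.elim 1 fun k => x k

/-- The fourth tensor power of `(1, x)`. -/
def tens4 (x : EuclideanSpace ℝ (Fin p)) : Tens p :=
  fun i j k l => aug x i * aug x j * aug x k * aug x l

/-- The moments up to order four of a sample. -/
noncomputable def sampleMoments {n : ℕ} (s : Fin n → EuclideanSpace ℝ (Fin p)) : Tens p :=
  (n : ℝ)⁻¹ • ∑ i, tens4 (s i)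

/-- The value of a tensor at four vectors. -/
def br (M : Tens p) (a b c e : Option (Fin p) → ℝ) : ℝ :=
  ∑ i, ∑ j, ∑ k, ∑ l, a i * b j * c k * e l * M i j k l

/-- The constant affine function `1`. -/
def one : Option (Fin p) → ℝ := Pi.single none 1

/-- The coordinate `k` as an affine function. -/
def coord (k : Fin p) : Option (Fin p) → ℝ := Pi.single (some k) 1

/-- The affine function with linear part `w` and mean zero under `M`. -/
def hat (M : Tens p) (w : Fin p → ℝ) : Option (Fin p) → ℝ :=
  fun o => o.elim (-∑ k, w k * M (some k) none none none) w

/-- The covariance matrix determined by the moments `M`. -/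
def covOf (M : Tens p) : Matrix (Fin p) (Fin p) ℝ :=
  Matrix.of fun k l => br M (hat M (Pi.single k 1)) (hat M (Pi.single l 1)) one one

/-- The third central moment in direction `w`. -/
def third (M : Tens p) (w : Fin p → ℝ) : ℝ := br M (hat M w) (hat M w) (hat M w) one

/-- The fourth central moment in direction `w`. -/
def fourth (M : Tens p) (w : Fin p → ℝ) : ℝ := br M (hat M w) (hat M w) (hat M w) (hat M w)

/-- The projection index as a function of moments, for directions of unit variance. -/
def index (α : ℝ) (M : Tens p) (w : Fin p → ℝ) : ℝ :=
  α * third M w ^ 2 + (1 - α) * (fourth M w - 3) ^ 2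

@[simp] lemma one_dotProduct_aug (x : EuclideanSpace ℝ (Fin p)) : one ⬝ᵥ aug x = 1 := by
  simp [one, aug]

lemma br_tens4 (x : EuclideanSpace ℝ (Fin p)) (a b c e : Option (Fin p) → ℝ) :
    br (tens4 x) a b c e = (a ⬝ᵥ aug x) * (b ⬝ᵥ aug x) * (c ⬝ᵥ aug x) * (e ⬝ᵥ aug x) := by
  simp only [br, tens4, dotProduct]
  rw [Finset.sum_mul_sum, Finset.sum_mul, Finset.sum_mul]
  refine Finset.sum_congr rfl fun i _ => ?_
  rw [Finset.sum_mul, Finset.sum_mul]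
  refine Finset.sum_congr rfl fun j _ => ?_
  rw [mul_assoc, Finset.sum_mul_sum, Finset.mul_sum]
  refine Finset.sum_congr rfl fun k _ => ?_
  rw [Finset.mul_sum]
  exact Finset.sum_congr rfl fun l _ => by ring

lemma br_smul_sum {n : ℕ} (r : ℝ) (T : Fin n → Tens p) (a b c e : Option (Fin p) → ℝ) :
    br (r • ∑ m, T m) a b c e = r * ∑ m, br (T m) a b c e := by
  simp only [br, Pi.smul_apply, Finset.sum_apply, smul_eq_mul]
  symm
  rw [Finset.mul_sum, Finset.sum_congr rfl fun m _ => Finset.mul_sum .., Finset.sum_comm]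
  refine Finset.sum_congr rfl fun i _ => ?_
  rw [Finset.sum_congr rfl fun m _ => Finset.mul_sum .., Finset.sum_comm]
  refine Finset.sum_congr rfl fun j _ => ?_
  rw [Finset.sum_congr rfl fun m _ => Finset.mul_sum .., Finset.sum_comm]
  refine Finset.sum_congr rfl fun k _ => ?_
  rw [Finset.sum_congr rfl fun m _ => Finset.mul_sum .., Finset.sum_comm]
  refine Finset.sum_congr rfl fun l _ => ?_
  rw [Finset.mul_sum, Finset.mul_sum]
  exact Finset.sum_congr rfl fun m _ => by ring

lemma br_sampleMoments {n : ℕ} (s : Fin n → EuclideanSpace ℝ (Fin p))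
    (a b c e : Option (Fin p) → ℝ) :
    br (sampleMoments s) a b c e = (n : ℝ)⁻¹ *
      ∑ i, (a ⬝ᵥ aug (s i)) * (b ⬝ᵥ aug (s i)) * (c ⬝ᵥ aug (s i)) * (e ⬝ᵥ aug (s i)) := by
  simp only [sampleMoments, br_smul_sum, br_tens4]

lemma hat_dotProduct_aug (M : Tens p) (w : Fin p → ℝ) (x : EuclideanSpace ℝ (Fin p)) :
    hat M w ⬝ᵥ aug x = w ⬝ᵥ x.ofLp - ∑ k, w k * M (some k) none none none := by
  simp [hat, aug, dotProduct, Fintype.sum_option]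
  ring

/-- The affine function `hat` of the moments of a shifted sample centers the sample. -/
lemma hat_sampleMoments {n : ℕ} (hn : n ≠ 0) (s : Fin n → EuclideanSpace ℝ (Fin p))
    (μ : EuclideanSpace ℝ (Fin p)) (w : Fin p → ℝ) (x : EuclideanSpace ℝ (Fin p)) :
    hat (sampleMoments fun i => s i - μ) w ⬝ᵥ aug (x - μ) =
      w ⬝ᵥ (x - (n : ℝ)⁻¹ • ∑ i, s i).ofLp := by
  have hn' : (n : ℝ) ≠ 0 := by exact_mod_cast hn
  rw [hat_dotProduct_aug]
  simp only [dotProduct]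
  rw [← Finset.sum_sub_distrib]
  refine Finset.sum_congr rfl fun k _ => ?_
  simp [sampleMoments, tens4, aug, Finset.sum_sub_distrib]
  field_simp
  ring

lemma linearMap_apply_eq_sum (f : (Fin p → ℝ) →ₗ[ℝ] ℝ) (v : Fin p → ℝ) :
    f v = ∑ k, v k * f (Pi.single k 1) := by
  rw [f.pi_apply_eq_sum_univ v]
  refine Finset.sum_congr rfl fun k _ => ?_
  rw [smul_eq_mul]
  congr 2
  ext j
  simp [Pi.single_apply, eq_comm]

/-- `br M` as a linear function of its first argument. -/
def br₁ (M : Tens p) (b c e : Option (Fin p) → ℝ) : (Option (Fin p) → ℝ) →ₗ[ℝ] ℝ where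
  toFun a := br M a b c e
  map_add' a a' := by simp only [br, Pi.add_apply, add_mul, Finset.sum_add_distrib]
  map_smul' r a := by
    simp only [br, Pi.smul_apply, smul_eq_mul, Finset.mul_sum, mul_assoc, RingHom.id_apply]

/-- `br M` as a linear function of its second argument. -/
def br₂ (M : Tens p) (a c e : Option (Fin p) → ℝ) : (Option (Fin p) → ℝ) →ₗ[ℝ] ℝ where
  toFun b := br M a b c e
  map_add' b b' := by
    simp only [br, Pi.add_apply, add_mul, mul_add, Finset.sum_add_distrib]
  map_smul' r b := by
    simp only [br, Pi.smul_apply, smul_eq_mul, Finset.mul_sum, RingHom.id_apply]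
    simp only [mul_left_comm _ r, mul_assoc]

/-- `br M` as a linear function of its third argument. -/
def br₃ (M : Tens p) (a b e : Option (Fin p) → ℝ) : (Option (Fin p) → ℝ) →ₗ[ℝ] ℝ where
  toFun c := br M a b c e
  map_add' c c' := by
    simp only [br, Pi.add_apply, add_mul, mul_add, Finset.sum_add_distrib]
  map_smul' r c := by
    simp only [br, Pi.smul_apply, smul_eq_mul, Finset.mul_sum, RingHom.id_apply]
    simp only [mul_left_comm _ r, mul_assoc]

/-- `br M` as a linear function of its fourth argument. -/
def br₄ (M : Tens p) (a b c : Option (Fin p) → ℝ) : (Option (Fin p) → ℝ) →ₗ[ℝ] ℝ where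
  toFun e := br M a b c e
  map_add' e e' := by
    simp only [br, Pi.add_apply, add_mul, mul_add, Finset.sum_add_distrib]
  map_smul' r e := by
    simp only [br, Pi.smul_apply, smul_eq_mul, Finset.mul_sum, RingHom.id_apply]
    simp only [mul_left_comm _ r, mul_assoc]

lemma hat_add (M : Tens p) (v w : Fin p → ℝ) : hat M (v + w) = hat M v + hat M w := by
  ext o
  cases o <;> simp [hat, add_mul, Finset.sum_add_distrib]
  ring

lemma hat_smul (M : Tens p) (r : ℝ) (w : Fin p → ℝ) : hat M (r • w) = r • hat M w := by
  ext o
  cases o <;> simp [hat, Finset.mul_sum, mul_assoc]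

/-- `hat M` as a linear map. -/
def hatLin (M : Tens p) : (Fin p → ℝ) →ₗ[ℝ] (Option (Fin p) → ℝ) where
  toFun := hat M
  map_add' := hat_add M
  map_smul' := hat_smul M

end Tensor

/-! ## The functional at an empirical distribution -/

section Empirical

variable {p : ℕ} {n : ℕ}

lemma integral_empirical {G : Type*} [NormedAddCommGroup G] [NormedSpace ℝ G] [CompleteSpace G]
    (s : Fin n → EuclideanSpace ℝ (Fin p)) (f : EuclideanSpace ℝ (Fin p) → G) :
    ∫ x, f x ∂(empirical s) = (n : ℝ)⁻¹ • ∑ i, f (s i) := by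
  rw [empirical, integral_smul_measure, integral_finsetSum_measure]
  · simp
  · intro i _
    exact integrable_dirac (by simp)

lemma covMatrix_empirical (hn : n ≠ 0) (s : Fin n → EuclideanSpace ℝ (Fin p))
    (μ : EuclideanSpace ℝ (Fin p)) :
    covMatrix (empirical s) = covOf (sampleMoments fun i => s i - μ) := by
  ext k l
  simp only [covMatrix, covOf, Matrix.of_apply, covariance, integral_empirical,
    br_sampleMoments, hat_sampleMoments hn, one_dotProduct_aug]
  simp

lemma dotProduct_covOf (M : Tens p) (v w : Fin p → ℝ) :
    v ⬝ᵥ covOf M *ᵥ w = br M (hat M v) (hat M w) one one := by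
  have h1 : br M (hat M v) (hat M w) one one =
      ∑ k, v k * br M (hat M (Pi.single k 1)) (hat M w) one one :=
    linearMap_apply_eq_sum ((br₁ M (hat M w) one one).comp (hatLin M)) v
  have h2 : ∀ k, br M (hat M (Pi.single k 1)) (hat M w) one one =
      ∑ l, w l * br M (hat M (Pi.single k 1)) (hat M (Pi.single l 1)) one one := fun k =>
    linearMap_apply_eq_sum ((br₂ M (hat M (Pi.single k 1)) one one).comp (hatLin M)) w
  rw [h1]
  simp only [h2, dotProduct, mulVec, covOf, Matrix.of_apply, mul_comm]

/-- The projected data have mean zero and, by `hu`, variance one, so the standardization inside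
skewness and kurtosis does nothing. The shift by `μ` is harmless because only central moments enter.
-/
lemma index_sampleMoments (α : ℝ) (hn : n ≠ 0) (s : Fin n → EuclideanSpace ℝ (Fin p))
    (μ : EuclideanSpace ℝ (Fin p)) (u : Fin p → ℝ)
    (hu : (u ᵥ* invSqrt (covMatrix (empirical s))) ⬝ᵥ
      (covMatrix (empirical s)) *ᵥ (u ᵥ* invSqrt (covMatrix (empirical s))) = 1) :
    projIndex α (empirical s) u =
      index α (sampleMoments fun i => s i - μ) (u ᵥ* invSqrt (covMatrix (empirical s))) := by
  have hn' : (n : ℝ) ≠ 0 := by exact_mod_cast hn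
  set w := u ᵥ* invSqrt (covMatrix (empirical s)) with hw
  have hX : ∀ x, u ⬝ᵥ standardizedVec (empirical s) x =
      w ⬝ᵥ (x - (n : ℝ)⁻¹ • ∑ i, s i).ofLp := by
    intro x
    rw [standardizedVec, dotProduct_mulVec, integral_empirical]
  have hmean : ∫ x, w ⬝ᵥ (x - (n : ℝ)⁻¹ • ∑ i, s i).ofLp ∂(empirical s) = 0 := by
    rw [integral_empirical, ← dotProduct_sum]
    have : ∑ i, (s i - (n : ℝ)⁻¹ • ∑ j, s j).ofLp = 0 := by
      rw [← WithLp.ofLp_sum, Finset.sum_sub_distrib]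
      simp [← Nat.cast_smul_eq_nsmul ℝ, smul_smul, hn']
    rw [this, dotProduct_zero, smul_zero]
  rw [covMatrix_empirical hn s μ, dotProduct_covOf, br_sampleMoments] at hu
  simp only [one_dotProduct_aug, hat_sampleMoments hn] at hu
  have hvar : variance (fun x => w ⬝ᵥ (x - (n : ℝ)⁻¹ • ∑ i, s i).ofLp) (empirical s) = 1 := by
    rw [variance_eq_integral (by fun_prop), hmean, integral_empirical, ← hu]
    simp [pow_two]
  have hstd : standardized (fun x => u ⬝ᵥ standardizedVec (empirical s) x) (empirical s) =
      fun x => w ⬝ᵥ (x - (n : ℝ)⁻¹ • ∑ i, s i).ofLp := by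
    funext x
    simp only [standardized, hX, hmean, hvar]
    simp
  simp only [projIndex, skewness, excessKurtosis, hstd, index, third, fourth, br_sampleMoments,
    hat_sampleMoments hn, one_dotProduct_aug, integral_empirical]
  simp [pow_succ]

end Empirical

/-! ## The inverse square root of a matrix -/

variable {p : ℕ}

section Sqrt
open scoped MatrixOrder Matrix.Norms.L2Operator

lemma continuousOn_sqrt_matrix :
    ContinuousOn (fun S : Matrix (Fin p) (Fin p) ℝ => CFC.sqrt S) {S | S.PosSemidef} := by
  have := CFC.continuousOn_sqrt (A := Matrix (Fin p) (Fin p) ℝ)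
  have hset : {S : Matrix (Fin p) (Fin p) ℝ | S.PosSemidef} = {S | 0 ≤ S} := by
    ext S
    exact (Matrix.nonneg_iff_posSemidef (A := S)).symm
  rw [hset]
  exact this
end Sqrt
section InvSqrt
open scoped MatrixOrder
lemma invSqrt_transpose {S : Matrix (Fin p) (Fin p) ℝ} : (invSqrt S)ᵀ = invSqrt S := by
  rw [invSqrt, Matrix.transpose_nonsing_inv]
  have : IsSelfAdjoint (CFC.sqrt S) := (CFC.sqrt_nonneg S).isSelfAdjoint
  rw [← Matrix.conjTranspose_eq_transpose_of_trivial]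
  exact congrArg _ this

lemma isUnit_sqrt {S : Matrix (Fin p) (Fin p) ℝ} (hS : S.PosDef) : IsUnit (CFC.sqrt S) := by
  have h : CFC.sqrt S * CFC.sqrt S = S := CFC.sqrt_mul_sqrt_self S hS.posSemidef.nonneg
  have := hS.isUnit
  rw [← h] at this
  exact isUnit_of_mul_isUnit_left this

lemma isUnit_invSqrt {S : Matrix (Fin p) (Fin p) ℝ} (hS : S.PosDef) : IsUnit (invSqrt S) :=
  (Matrix.isUnit_nonsing_inv_iff).2 (isUnit_sqrt hS)

lemma invSqrt_mul_mul {S : Matrix (Fin p) (Fin p) ℝ} (hS : S.PosDef) :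
    invSqrt S * S * (invSqrt S)ᵀ = 1 := by
  have h : CFC.sqrt S * CFC.sqrt S = S := CFC.sqrt_mul_sqrt_self S hS.posSemidef.nonneg
  have hu := (Matrix.isUnit_iff_isUnit_det _).1 (isUnit_sqrt hS)
  rw [invSqrt_transpose]
  rw [invSqrt]
  nth_rewrite 2 [← h]
  rw [← mul_assoc, Matrix.nonsing_inv_mul _ hu, one_mul, Matrix.mul_nonsing_inv _ hu]

lemma invSqrt_one : invSqrt (1 : Matrix (Fin p) (Fin p) ℝ) = 1 := by
  simp [invSqrt]

lemma isClosed_posSemidef : IsClosed {S : Matrix (Fin p) (Fin p) ℝ | S.PosSemidef} := by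
  have : {S : Matrix (Fin p) (Fin p) ℝ | S.PosSemidef} =
      {S | S.IsHermitian} ∩ ⋂ v : Fin p → ℝ, {S | 0 ≤ star v ⬝ᵥ S *ᵥ v} := by
    ext S
    simp [Matrix.posSemidef_iff_dotProduct_mulVec]
  rw [this]
  refine IsClosed.inter ?_ (isClosed_iInter fun v => isClosed_le (by fun_prop) (by fun_prop))
  exact isClosed_eq (by fun_prop) (by fun_prop)

/-- Continuity is claimed only within the positive semidefinite cone: sample covariances lie there,
and `CFC.sqrt` takes a default value outside it. -/
lemma continuousWithinAt_invSqrt_one :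
    ContinuousWithinAt invSqrt {S : Matrix (Fin p) (Fin p) ℝ | S.PosSemidef} 1 := by
  have h1 := continuousOn_sqrt_matrix (p := p) 1 Matrix.PosSemidef.one
  have h2 : ContinuousAt (fun A : Matrix (Fin p) (Fin p) ℝ => A⁻¹) (CFC.sqrt 1) := by
    refine continuousAt_matrix_inv _ ?_
    rw [CFC.sqrt_one, Matrix.det_one]
    exact NormedRing.inverse_continuousAt (1 : ℝˣ)
  exact h2.comp_continuousWithinAt h1

/-- The square root is continuous on the closed positive semidefinite cone and has the default value
`0` off it, so it is piecewise measurable. The inverse is the adjugate times the inverse of the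
determinant. -/
lemma measurable_invSqrt :
    Measurable fun (S : Fin p → Fin p → ℝ) (i j : Fin p) => invSqrt (Matrix.of S) i j := by
  classical
  have h1 : Measurable fun (S : Fin p → Fin p → ℝ) (i j : Fin p) =>
      CFC.sqrt (Matrix.of S) i j := by
    let C : Set (Fin p → Fin p → ℝ) := {S | (Matrix.of S).PosSemidef}
    have hcl' : IsClosed C := isClosed_posSemidef (p := p)
    have hcl : MeasurableSet C := hcl'.measurableSet
    have hcont : ContinuousOn (fun (S : Fin p → Fin p → ℝ) (i j : Fin p) =>
      CFC.sqrt (Matrix.of S) i j) C := continuousOn_sqrt_matrix (p := p)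
    have hz : ∀ S : Fin p → Fin p → ℝ, ¬ (Matrix.of S).PosSemidef →
        CFC.sqrt (Matrix.of S) = 0 := fun S hS => by
      rw [CFC.sqrt, cfcₙ_apply_of_not_predicate]
      change ¬ (Matrix.of S - 0).PosSemidef
      simpa
    have h := hcont.measurable_piecewise
      (continuousOn_const (c := (0 : Fin p → Fin p → ℝ))) hcl
    convert h using 1
    funext S
    by_cases hS : S ∈ C
    · simp only [Set.piecewise, hS, if_true]
    · simp only [Set.piecewise, hS, if_false, hz S hS]
      rfl
  have h2 : Measurable fun (A : Fin p → Fin p → ℝ) (i j : Fin p) => (Matrix.of A)⁻¹ i j := by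
    have hd : Continuous fun A : Fin p → Fin p → ℝ => (Matrix.of A).det :=
      Continuous.matrix_det continuous_id
    have ha : Continuous fun A : Fin p → Fin p → ℝ => (Matrix.of A).adjugate :=
      Continuous.matrix_adjugate continuous_id
    refine measurable_pi_lambda _ fun i => measurable_pi_lambda _ fun j => ?_
    simp only [Matrix.inv_def, Matrix.smul_apply, Ring.inverse_eq_inv', smul_eq_mul]
    exact hd.measurable.inv.mul (ha.matrix_elem i j).measurable
  exact h2.comp h1
end InvSqrt

/-! ## Maximizers and their stationarity conditions -/

section Maximizers

variable {d p : ℕ}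

/-- The `d`-tuples of orthonormal vectors of `ℝᵖ`. -/
def frames (d p : ℕ) : Set (Fin d → Fin p → ℝ) :=
  {U | ∀ k l, U k ⬝ᵥ U l = if k = l then 1 else 0}

lemma mul_transpose_eq_one_iff (U : Matrix (Fin d) (Fin p) ℝ) :
    U * Uᵀ = 1 ↔ (fun k l => U k l) ∈ frames d p := by
  rw [← Matrix.ext_iff]
  simp only [frames, Set.mem_ofPred_eq, Matrix.one_apply]
  rfl

lemma isClosed_frames : IsClosed (frames d p) := by
  simp only [frames, Set.ofPred_forall]
  exact isClosed_iInter fun k => isClosed_iInter fun l =>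
    isClosed_eq (by unfold dotProduct; fun_prop) continuous_const

lemma isCompact_frames : IsCompact (frames d p) := by
  refine Metric.isCompact_of_isClosed_isBounded isClosed_frames
    ((Metric.isBounded_closedBall (x := 0) (r := 1)).subset fun U hU => ?_)
  rw [mem_closedBall_zero_iff]
  refine (pi_norm_le_iff_of_nonneg zero_le_one).2 fun k =>
    (pi_norm_le_iff_of_nonneg zero_le_one).2 fun l => ?_
  have h1 : U k ⬝ᵥ U k = 1 := by simpa using hU k k
  have h2 : U k l * U k l ≤ U k ⬝ᵥ U k :=
    Finset.single_le_sum (f := fun i => U k i * U k i) (fun i _ => mul_self_nonneg _)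
      (Finset.mem_univ l)
  rw [Real.norm_eq_abs, abs_le_one_iff_mul_self_le_one]
  linarith

/-- The frame `(I_d, 0)`. -/
def idFrame (d p : ℕ) : Fin d → Fin p → ℝ := fun k l => if (k : ℕ) = (l : ℕ) then 1 else 0

lemma idFrame_apply (hdp : d ≤ p) (k : Fin d) :
    idFrame d p k = Pi.single (Fin.castLE hdp k) 1 := by
  ext l
  simp [idFrame, Pi.single_apply, Fin.ext_iff, eq_comm]

lemma idFrame_mem (hdp : d ≤ p) : idFrame d p ∈ frames d p := by
  intro k l
  simp [idFrame_apply hdp, Pi.single_apply, Fin.ext_iff, eq_comm]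

/-- The objective function, in terms of moments and a square root of the precision matrix. -/
def objective (α : ℝ) (q : Tens p × (Fin p → Fin p → ℝ)) (U : Fin d → Fin p → ℝ) : ℝ :=
  ∑ k, index α q.1 (U k ᵥ* Matrix.of q.2)

@[fun_prop]
lemma continuous_hat : Continuous fun q : Tens p × (Fin p → ℝ) => hat q.1 q.2 := by
  refine continuous_pi fun o => ?_
  cases o <;> simp only [hat, Option.elim] <;> fun_prop

@[fun_prop]
lemma _root_.Continuous.br {Z : Type*} [TopologicalSpace Z] {M : Z → Tens p}
    {a b c e : Z → Option (Fin p) → ℝ} (hM : Continuous M) (ha : Continuous a)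
    (hb : Continuous b) (hc : Continuous c) (he : Continuous e) :
    Continuous fun z => br (M z) (a z) (b z) (c z) (e z) := by
  unfold ProjPursuit.br; fun_prop

@[fun_prop]
lemma _root_.Continuous.hat {Z : Type*} [TopologicalSpace Z] {M : Z → Tens p}
    {w : Z → Fin p → ℝ} (hM : Continuous M) (hw : Continuous w) :
    Continuous fun z => hat (M z) (w z) :=
  continuous_hat.comp (hM.prodMk hw)

lemma continuous_covOf : Continuous fun M : Tens p => covOf M := by
  refine continuous_matrix fun k l => ?_
  simp only [covOf, Matrix.of_apply]
  fun_prop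

lemma _root_.Continuous.index {Z : Type*} [TopologicalSpace Z] (α : ℝ) {M : Z → Tens p}
    {w : Z → Fin p → ℝ} (hM : Continuous M) (hw : Continuous w) :
    Continuous fun z => index α (M z) (w z) := by
  unfold ProjPursuit.index third fourth
  fun_prop

lemma _root_.Continuous.vecMul_of {Z : Type*} [TopologicalSpace Z] {w : Z → Fin p → ℝ}
    {R : Z → Fin p → Fin p → ℝ} (hw : Continuous w) (hR : Continuous R) :
    Continuous fun z => w z ᵥ* Matrix.of (R z) := by
  unfold Matrix.vecMul dotProduct
  simp only [Matrix.of_apply]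
  fun_prop

/-- The inverse square root is kept as a free parameter here: as a function of the moments it need
not be continuous at a singular covariance matrix. `param` substitutes it afterwards, needing only
measurability. -/
lemma continuous_objective (α : ℝ) :
    Continuous fun q : (Tens p × (Fin p → Fin p → ℝ)) × (Fin d → Fin p → ℝ) =>
      objective α q.1 q.2 := by
  unfold objective
  refine continuous_finsetSum _ fun k _ => Continuous.index α (continuous_fst.comp continuous_fst)
    (Continuous.vecMul_of ((continuous_apply k).comp continuous_snd)
      (continuous_snd.comp continuous_fst))

/-- The parameter of the optimization problem determined by the moments. -/
noncomputable def param (M : Tens p) : Tens p × (Fin p → Fin p → ℝ) :=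
  (M, fun i j => invSqrt (covOf M) i j)

set_option synthInstance.maxHeartbeats 200000 in
set_option synthInstance.maxSize 2000 in
instance (p : ℕ) : BorelSpace (Tens p) := inferInstance

set_option synthInstance.maxHeartbeats 200000 in
lemma measurable_param : Measurable (param (p := p)) := by
  refine measurable_id.prodMk ?_
  have h : Continuous fun (M : Tens p) (i j : Fin p) => covOf M i j :=
    continuous_pi fun i => continuous_pi fun j => continuous_covOf.matrix_elem i j
  exact measurable_invSqrt.comp h.measurable

set_option synthInstance.maxHeartbeats 200000 in
-- Ties between maximizers are broken first by the trace, which singles out the right signs and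
-- order of the rows, and then by the entries one after another.
lemma exists_selection (hdp : d ≤ p) (α : ℝ) :
    ∃ u : Tens p → Fin d → Fin p → ℝ, Measurable u ∧ (∀ M, u M ∈ frames d p) ∧
      (∀ M, ∀ V ∈ frames d p, objective α (param M) V ≤ objective α (param M) (u M)) ∧
      ∀ M, ∀ V ∈ frames d p, objective α (param M) V = objective α (param M) (u M) →
        ∑ k, V k (Fin.castLE hdp k) ≤ ∑ k, u M k (Fin.castLE hdp k) := by
  have hA := (isMeasurableMultifunction_maximizers (continuous_objective (d := d) (p := p) α)
    isCompact_frames ⟨_, idFrame_mem hdp⟩).minimizers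
    (φ := fun U => -∑ k, U k (Fin.castLE hdp k)) (by fun_prop)
  let L : List ((Fin d → Fin p → ℝ) → ℝ) :=
    (Finset.univ : Finset (Fin d × Fin p)).toList.map fun q U => U q.1 q.2
  obtain ⟨f, hf, hfA⟩ := hA.exists_measurable_selection L
    (by
      intro φ hφ
      obtain ⟨q, -, rfl⟩ := List.mem_map.1 hφ
      fun_prop)
    (by
      intro y y' h
      ext k l
      exact h _ (List.mem_map.2 ⟨(k, l), by simp, rfl⟩))
  refine ⟨f ∘ param, hf.comp measurable_param, fun M => (hfA _).1.1, fun M => (hfA _).1.2,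
    fun M V hV hVeq => ?_⟩
  have := (hfA (param M)).2 V ⟨hV, fun y hy => ((hfA (param M)).1.2 y hy).trans hVeq.ge⟩
  simpa using this

end Maximizers

/-! ### Maximizers in terms of moments solve the sample problem -/

section Solutions

variable {d p n : ℕ}

lemma mul_covMatrix_mul {S : Matrix (Fin p) (Fin p) ℝ} (hS : S.PosDef)
    (u v : Fin p → ℝ) : (u ᵥ* invSqrt S) ⬝ᵥ S *ᵥ (v ᵥ* invSqrt S) = u ⬝ᵥ v := by
  rw [← Matrix.dotProduct_mulVec, ← Matrix.mulVec_transpose (invSqrt S) v, Matrix.mulVec_mulVec,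
    Matrix.mulVec_mulVec, invSqrt_mul_mul hS, Matrix.one_mulVec]

/-- A maximizer in terms of moments yields a value of the functional at the sample. -/
lemma isSymmetricSolution_of_maximizer (α : ℝ) (hn : n ≠ 0)
    (s : Fin n → EuclideanSpace ℝ (Fin p)) (μ : EuclideanSpace ℝ (Fin p))
    (hS : (covMatrix (empirical s)).PosDef) {U : Fin d → Fin p → ℝ} (hU : U ∈ frames d p)
    (hmax : ∀ V ∈ frames d p, objective α (param (sampleMoments fun i => s i - μ)) V ≤
      objective α (param (sampleMoments fun i => s i - μ)) U) :
    IsSymmetricSolution α (empirical s)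
      (Matrix.of U * invSqrt (covOf (sampleMoments fun i => s i - μ))) := by
  have key : ∀ V ∈ frames d p, ∑ k, projIndex α (empirical s) (V k) =
      objective α (param (sampleMoments fun i => s i - μ)) V := by
    intro V hV
    refine Finset.sum_congr rfl fun k _ => ?_
    rw [index_sampleMoments α hn s μ, covMatrix_empirical hn s μ]
    · rfl
    · rw [mul_covMatrix_mul hS]
      simpa using hV k k
  refine ⟨Matrix.of U, (mul_transpose_eq_one_iff _).2 hU, fun V hV => ?_, ?_⟩
  · have hV' := (mul_transpose_eq_one_iff V).1 hV
    exact (key _ hV').trans_le ((hmax _ hV').trans_eq (key _ hU).symm)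
  · rw [covMatrix_empirical hn s μ]

lemma isSymmetricSolution_of_isEmpty (α : ℝ) (F : Measure (EuclideanSpace ℝ (Fin p)))
    (hd : d = 0) (W : Matrix (Fin d) (Fin p) ℝ) : IsSymmetricSolution α F W := by
  subst hd
  exact ⟨0, Subsingleton.elim _ _, fun V _ => by simp, Subsingleton.elim _ _⟩

/-- For an empty sample the empirical measure is zero, and so is its covariance matrix; this is
positive definite only in dimension zero. It disposes of `n = 0` in the theorem. -/
lemma eq_zero_of_posDef_covMatrix_empirical (s : Fin 0 → EuclideanSpace ℝ (Fin p))
    (h : (covMatrix (empirical s)).PosDef) : p = 0 := by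
  by_contra hp
  have h0 : covMatrix (empirical s) = 0 := by
    ext k l
    simp [covMatrix, covariance, integral_empirical]
  have hu := h.isUnit
  rw [h0] at hu
  have : Nonempty (Fin p) := ⟨⟨0, Nat.pos_of_ne_zero hp⟩⟩
  exact not_isUnit_zero hu

end Solutions

/-! ### First-order conditions at a constrained maximizer -/

section Stationarity

variable {d p : ℕ}

/-- The moment tensors of nonempty samples. -/
def momentSet (p : ℕ) : Set (Tens p) :=
  {M | ∃ (n : ℕ) (s : Fin n → EuclideanSpace ℝ (Fin p)), n ≠ 0 ∧ M = sampleMoments s}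

/-- Half the derivative of the index at `w` in direction `v`. -/
def grad (α : ℝ) (M : Tens p) (w v : Fin p → ℝ) : ℝ :=
  alpha1 α * third M w * br M (hat M w) (hat M w) (hat M v) one
    + alpha2 α * (fourth M w - 3) * br M (hat M w) (hat M w) (hat M w) (hat M v)

/-- `grad` as a linear function of the direction. -/
def gradLin (α : ℝ) (M : Tens p) (w : Fin p → ℝ) : (Fin p → ℝ) →ₗ[ℝ] ℝ :=
  (alpha1 α * third M w) • (br₃ M (hat M w) (hat M w) one).comp (hatLin M)
    + (alpha2 α * (fourth M w - 3)) • (br₄ M (hat M w) (hat M w) (hat M w)).comp (hatLin M)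

lemma gradLin_apply (α : ℝ) (M : Tens p) (w v : Fin p → ℝ) :
    gradLin α M w v = grad α M w v := rfl

lemma covOf_isSymm {M : Tens p} (hM : M ∈ momentSet p) : (covOf M)ᵀ = covOf M := by
  obtain ⟨n, s, -, rfl⟩ := hM
  ext k l
  simp only [Matrix.transpose_apply, covOf, Matrix.of_apply, br_sampleMoments]
  congr 1
  exact Finset.sum_congr rfl fun i _ => by ring

lemma covOf_posSemidef {M : Tens p} (hM : M ∈ momentSet p) : (covOf M).PosSemidef := by
  refine Matrix.PosSemidef.of_dotProduct_mulVec_nonneg ?_ fun v => ?_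
  · rw [Matrix.IsHermitian, Matrix.conjTranspose_eq_transpose_of_trivial, covOf_isSymm hM]
  · rw [star_trivial, dotProduct_covOf]
    obtain ⟨n, s, -, rfl⟩ := hM
    rw [br_sampleMoments]
    refine mul_nonneg (by positivity) (Finset.sum_nonneg fun i _ => ?_)
    simp only [one_dotProduct_aug, mul_one]
    exact mul_self_nonneg _

/-- For the moments of a sample, `br` is an average of products, so the third and fourth moments
along the curve are averages of powers of `cos t * a i + sin t * b i`. -/
lemma hasDerivAt_index {M : Tens p} (hM : M ∈ momentSet p) (α : ℝ) (w v : Fin p → ℝ) :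
    HasDerivAt (fun t : ℝ => index α M (Real.cos t • w + Real.sin t • v)) (2 * grad α M w v) 0 := by
  obtain ⟨n, s, -, hMs⟩ := hM
  set a : Fin n → ℝ := fun i => hat M w ⬝ᵥ aug (s i) with ha
  set b : Fin n → ℝ := fun i => hat M v ⬝ᵥ aug (s i) with hb
  have hy : ∀ t i, hat M (Real.cos t • w + Real.sin t • v) ⬝ᵥ aug (s i) =
      Real.cos t * a i + Real.sin t * b i := fun t i => by
    rw [hat_add, hat_smul, hat_smul, add_dotProduct, smul_dotProduct, smul_dotProduct]
    rfl
  have hbr : ∀ x y z u, br M x y z u = (n : ℝ)⁻¹ *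
      ∑ i, (x ⬝ᵥ aug (s i)) * (y ⬝ᵥ aug (s i)) * (z ⬝ᵥ aug (s i)) * (u ⬝ᵥ aug (s i)) :=
    fun x y z u => by rw [hMs, br_sampleMoments]
  have hlin : ∀ i, HasDerivAt (fun t => Real.cos t * a i + Real.sin t * b i) (b i) 0 := fun i => by
    have := ((Real.hasDerivAt_cos 0).mul_const (a i)).fun_add
      ((Real.hasDerivAt_sin 0).mul_const (b i))
    simpa using this
  have h3 : HasDerivAt (fun t : ℝ => third M (Real.cos t • w + Real.sin t • v))
      (3 * br M (hat M w) (hat M w) (hat M v) one) 0 := by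
    simp only [third, hbr, hy, one_dotProduct_aug]
    refine ((HasDerivAt.fun_sum fun i _ => (((hlin i).fun_mul (hlin i)).fun_mul (hlin i)).mul_const
      1).const_mul (n : ℝ)⁻¹).congr_deriv ?_
    rw [mul_left_comm]
    congr 1
    rw [Finset.mul_sum]
    exact Finset.sum_congr rfl fun i _ => by
      simp only [Real.cos_zero, Real.sin_zero, ha, hb]
      ring
  have h4 : HasDerivAt (fun t : ℝ => fourth M (Real.cos t • w + Real.sin t • v))
      (4 * br M (hat M w) (hat M w) (hat M w) (hat M v)) 0 := by
    simp only [fourth, hbr, hy]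
    refine ((HasDerivAt.fun_sum fun i _ => (((hlin i).fun_mul (hlin i)).fun_mul (hlin i)).fun_mul
      (hlin i)).const_mul (n : ℝ)⁻¹).congr_deriv ?_
    rw [mul_left_comm]
    congr 1
    rw [Finset.mul_sum]
    exact Finset.sum_congr rfl fun i _ => by
      simp only [Real.cos_zero, Real.sin_zero, ha, hb]
      ring
  have h0 : Real.cos 0 • w + Real.sin 0 • v = w := by simp
  refine (((h3.fun_pow 2).const_mul α).add
    (((h4.sub_const 3).fun_pow 2).const_mul (1 - α))).congr_deriv ?_
  -- The chain rule produces `2 * 3 * α` and `2 * 4 * (1 - α)`; this is the origin of `α₁ = 3α` and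
  -- `α₂ = 4(1 - α)`.
  simp only [h0, grad, alpha1, alpha2]
  ring

/-- `W` has orthonormal rows with respect to the covariance matrix and maximizes the sum of the
indices under this constraint. -/
structure IsConstrainedMax (α : ℝ) (M : Tens p) (W : Fin d → Fin p → ℝ) : Prop where
  mem : M ∈ momentSet p
  posDef : (covOf M).PosDef
  orthonormal : ∀ k l, W k ⬝ᵥ covOf M *ᵥ W l = if k = l then 1 else 0
  le : ∀ V : Fin d → Fin p → ℝ, (∀ k l, V k ⬝ᵥ covOf M *ᵥ V l = if k = l then 1 else 0) →
    ∑ k, index α M (V k) ≤ ∑ k, index α M (W k)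

namespace IsConstrainedMax

variable {α : ℝ} {M : Tens p} {W : Fin d → Fin p → ℝ}

lemma cov_comm (h : IsConstrainedMax α M W) (v w : Fin p → ℝ) :
    v ⬝ᵥ covOf M *ᵥ w = w ⬝ᵥ covOf M *ᵥ v := by
  rw [Matrix.dotProduct_mulVec, ← Matrix.mulVec_transpose, covOf_isSymm h.mem, dotProduct_comm]

/-- The derivative of the objective along a feasible curve of rotations vanishes. -/
lemma sum_deriv_eq_zero (h : IsConstrainedMax α M W) (D : ℝ → Fin d → Fin p → ℝ)
    (h0 : D 0 = W) (hD : ∀ t k l, D t k ⬝ᵥ covOf M *ᵥ D t l = if k = l then 1 else 0)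
    {D' : Fin d → ℝ} (hD' : ∀ k, HasDerivAt (fun t => index α M (D t k)) (D' k) 0) :
    ∑ k, D' k = 0 := by
  have hmax : IsLocalMax (fun t => ∑ k, index α M (D t k)) 0 :=
    Filter.Eventually.of_forall fun t => by
      simp only [h0]
      exact h.le _ (hD t)
  exact hmax.hasDerivAt_eq_zero (HasDerivAt.fun_sum fun k _ => hD' k)

/-- Turn row `k` towards `v` and keep the other rows: the rows stay orthonormal because `v` is a
unit vector orthogonal to all of them. -/
lemma grad_eq_zero_of_unit (h : IsConstrainedMax α M W) (k : Fin d) {v : Fin p → ℝ}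
    (hv : ∀ j, v ⬝ᵥ covOf M *ᵥ W j = 0) (hv1 : v ⬝ᵥ covOf M *ᵥ v = 1) :
    grad α M (W k) v = 0 := by
  have hv' : ∀ j, W j ⬝ᵥ covOf M *ᵥ v = 0 := fun j => by rw [h.cov_comm, hv]
  have := h.sum_deriv_eq_zero
    (fun t j => if j = k then Real.cos t • W k + Real.sin t • v else W j)
    (by ext j; by_cases hj : j = k <;> simp [hj])
    (by
      intro t i j
      have hk := h.orthonormal k k
      have hi := h.orthonormal i k
      have hj := h.orthonormal k j
      have hij := h.orthonormal i j
      by_cases h1 : i = k <;> by_cases h2 : j = k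
      · subst h1 h2
        simp only [if_true] at hk
        simp only [if_true, add_dotProduct, mulVec_add, dotProduct_add, smul_dotProduct,
          mulVec_smul, dotProduct_smul, hk, hv, hv', hv1, smul_eq_mul]
        linear_combination Real.sin_sq_add_cos_sq t
      · subst h1
        have : ¬ i = j := fun h => h2 h.symm
        simp only [this, if_false] at hj
        simp [h2, this, add_dotProduct, smul_dotProduct, hj, hv]
      · subst h2
        simp only [h1, if_false] at hi
        simp [h1, mulVec_add, mulVec_smul, hi, hv']
      · simp [h1, h2, hij])
    (D' := fun j => if j = k then 2 * grad α M (W k) v else 0)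
    (by
      intro j
      by_cases hj : j = k
      · simpa [hj] using hasDerivAt_index h.mem α (W k) v
      · simpa [hj] using hasDerivAt_const (0 : ℝ) (index α M (W j)))
  simpa using this

lemma grad_eq_zero (h : IsConstrainedMax α M W) (k : Fin d) {v : Fin p → ℝ}
    (hv : ∀ j, v ⬝ᵥ covOf M *ᵥ W j = 0) : grad α M (W k) v = 0 := by
  by_cases h0 : v = 0
  · rw [h0, ← gradLin_apply, map_zero]
  have hpos : 0 < v ⬝ᵥ covOf M *ᵥ v := by
    simpa using h.posDef.dotProduct_mulVec_pos h0
  set c := √(v ⬝ᵥ covOf M *ᵥ v) with hc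
  have hcpos : 0 < c := Real.sqrt_pos.2 hpos
  have hcc : c * c = v ⬝ᵥ covOf M *ᵥ v := Real.mul_self_sqrt hpos.le
  have := h.grad_eq_zero_of_unit k (v := c⁻¹ • v)
    (fun j => by rw [smul_dotProduct, hv, smul_zero])
    (by
      rw [mulVec_smul, smul_dotProduct, dotProduct_smul, ← hcc, smul_eq_mul, smul_eq_mul]
      field_simp)
  rw [← gradLin_apply, map_smul, smul_eq_mul, gradLin_apply] at this
  exact (mul_eq_zero.1 this).resolve_left (inv_ne_zero hcpos.ne')

/-- Subtracting from `v` its projection on the span of the rows leaves a direction in which the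
gradient vanishes. This is the Lagrange condition without multipliers. -/
lemma grad_eq_sum (h : IsConstrainedMax α M W) (k : Fin d) (v : Fin p → ℝ) :
    grad α M (W k) v = ∑ j, (W j ⬝ᵥ covOf M *ᵥ v) * grad α M (W k) (W j) := by
  have := h.grad_eq_zero k (v := v - ∑ j, (W j ⬝ᵥ covOf M *ᵥ v) • W j) (fun i => by
    rw [sub_dotProduct, sum_dotProduct]
    simp only [smul_dotProduct, h.orthonormal]
    simp [h.cov_comm v])
  rw [← gradLin_apply, map_sub, map_sum, sub_eq_zero] at this
  simpa [gradLin_apply] using this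

/-- Rotate rows `k` and `l` within their common plane: the derivative of the objective is twice the
difference of the two sides. -/
lemma grad_comm (h : IsConstrainedMax α M W) (k l : Fin d) :
    grad α M (W k) (W l) = grad α M (W l) (W k) := by
  by_cases hkl : k = l
  · rw [hkl]
  have hlk : ¬ l = k := fun h => hkl h.symm
  have := h.sum_deriv_eq_zero
    (fun t j => if j = k then Real.cos t • W k + Real.sin t • W l else
      if j = l then Real.cos t • W l + Real.sin t • (-W k) else W j)
    (by
      funext j
      by_cases hj : j = k
      · simp [hj]
      · by_cases hj' : j = l
        · subst hj'; simp [hj]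
        · simp [hj, hj'])
    (by
      intro t i j
      by_cases h1 : i = k <;> by_cases h2 : j = k <;> by_cases h3 : i = l <;>
        by_cases h4 : j = l <;>
        simp_all [h.orthonormal, add_dotProduct, mulVec_add, mulVec_neg, neg_dotProduct,
          dotProduct_add, smul_dotProduct, mulVec_smul, dotProduct_smul] <;>
        first
          | linear_combination Real.sin_sq_add_cos_sq t
          | (ring; done)
          | simp [Ne.symm h2, Ne.symm h4])
    (D' := fun j => (if j = k then 2 * grad α M (W k) (W l) else 0) +
      if j = l then 2 * grad α M (W l) (-W k) else 0)
    (by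
      intro j
      by_cases hj : j = k
      · simpa [hj, hkl] using hasDerivAt_index h.mem α (W k) (W l)
      · by_cases hj' : j = l
        · subst hj'
          simpa only [hj, if_false, if_true, zero_add] using
            hasDerivAt_index h.mem α (W j) (-W k)
        · simpa [hj, hj'] using hasDerivAt_const (0 : ℝ) (index α M (W j)))
  rw [← gradLin_apply α M (W l) (-W k), map_neg, gradLin_apply] at this
  simp only [Finset.sum_add_distrib, Finset.sum_ite_eq', Finset.mem_univ, if_true] at this
  linarith

end IsConstrainedMax

/-- Right multiplication by the invertible matrix `R` turns orthonormal frames into rows orthonormal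
for the covariance, and every such family arises in this way. -/
lemma isConstrainedMax_of_maximizer {α : ℝ} {M : Tens p} (hM : M ∈ momentSet p)
    (hS : (covOf M).PosDef) {U : Fin d → Fin p → ℝ} (hU : U ∈ frames d p)
    (hmax : ∀ V ∈ frames d p, objective α (param M) V ≤ objective α (param M) U) :
    IsConstrainedMax α M fun k => U k ᵥ* invSqrt (covOf M) where
  mem := hM
  posDef := hS
  orthonormal k l := by rw [mul_covMatrix_mul hS]; exact hU k l
  le V hV := by
    set R := invSqrt (covOf M) with hR
    have hRu : IsUnit R.det := (Matrix.isUnit_iff_isUnit_det _).1 (isUnit_invSqrt hS)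
    have hVR : ∀ k, (V k ᵥ* R⁻¹) ᵥ* R = V k := fun k => by
      rw [Matrix.vecMul_vecMul, Matrix.nonsing_inv_mul _ hRu, Matrix.vecMul_one]
    have hmem : (fun k => V k ᵥ* R⁻¹) ∈ frames d p := fun k l => by
      rw [← mul_covMatrix_mul hS, ← hR, hVR, hVR, hV]
    have := hmax _ hmem
    have e1 : objective α (param M) (fun k => V k ᵥ* R⁻¹) = ∑ k, index α M (V k) :=
      Finset.sum_congr rfl fun k _ => congrArg (index α M) (hVR k)
    rw [e1] at this
    exact this

end Stationarity

/-! ## Population moments and identifiability -/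

section Population

variable {d p : ℕ}

@[simp] lemma one_none : (one : Option (Fin p) → ℝ) none = 1 := by simp [one]
@[simp] lemma one_some (k : Fin p) : (one : Option (Fin p) → ℝ) (some k) = 0 := by simp [one]
@[simp] lemma hat_some (M : Tens p) (w : Fin p → ℝ) (k : Fin p) : hat M w (some k) = w k := rfl
lemma hat_none (M : Tens p) (w : Fin p → ℝ) :
    hat M w none = -∑ k, w k * M (some k) none none none := rfl
@[simp] lemma coord_none (k : Fin p) : coord k none = 0 := by simp [coord]
@[simp] lemma coord_some (k l : Fin p) : coord k (some l) = if l = k then 1 else 0 := by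
  simp [coord, Pi.single_apply]

/-- `M` is the moment tensor of a vector with independent standardized components whose third and
fourth moments are `γ` and `β`. -/
structure IsIndepMoments (γ β : Fin p → ℝ) (M : Tens p) : Prop where
  swap₁₂ : ∀ i j k l, M i j k l = M j i k l
  swap₂₃ : ∀ i j k l, M i j k l = M i k j l
  swap₃₄ : ∀ i j k l, M i j k l = M i j l k
  zero : M none none none none = 1
  first : ∀ a, M (some a) none none none = 0
  second : ∀ a b, M (some a) (some b) none none = if a = b then 1 else 0
  third : ∀ a b c, M (some a) (some b) (some c) none = if a = b ∧ b = c then γ a else 0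
  fourth : ∀ a b c e, M (some a) (some b) (some c) (some e) =
    (if a = b then 1 else 0) * (if c = e then 1 else 0)
      + (if a = c then 1 else 0) * (if b = e then 1 else 0)
      + (if a = e then 1 else 0) * (if b = c then 1 else 0)
      + if a = b ∧ b = c ∧ c = e then β a - 3 else 0

namespace IsIndepMoments

variable {γ β : Fin p → ℝ} {M : Tens p}

lemma hat_none (h : IsIndepMoments γ β M) (w : Fin p → ℝ) : hat M w none = 0 := by
  simp [ProjPursuit.hat_none, h.first]

lemma hat_single (h : IsIndepMoments γ β M) (k : Fin p) : hat M (Pi.single k 1) = coord k := by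
  ext o
  cases o with
  | none => simp [h.hat_none]
  | some l => simp [Pi.single_apply]

lemma third_eq (h : IsIndepMoments γ β M) (w : Fin p → ℝ) :
    ProjPursuit.third M w = ∑ a, w a ^ 3 * γ a := by
  simp only [ProjPursuit.third, br, Fintype.sum_option, h.hat_none, one_none, one_some, hat_some,
    h.third, zero_mul, mul_zero, Finset.sum_const_zero, add_zero, zero_add, mul_one]
  refine Finset.sum_congr rfl fun a _ => ?_
  rw [Finset.sum_eq_single a, Finset.sum_eq_single a]
  · simp only [and_self, if_true]; ring
  · intro c _ hc; simp [hc.symm]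
  · simp
  · intro b _ hb; simp [hb.symm]
  · simp

/-- The three pairings of the four indices each contribute `(w ⬝ᵥ w) ^ 2`; the excess kurtosis
remains on the diagonal. -/
lemma fourth_eq (h : IsIndepMoments γ β M) (w : Fin p → ℝ) :
    ProjPursuit.fourth M w = 3 * (w ⬝ᵥ w) ^ 2 + ∑ a, w a ^ 4 * (β a - 3) := by
  simp only [ProjPursuit.fourth, br, Fintype.sum_option, h.hat_none, hat_some,
    h.fourth, zero_mul, mul_zero, Finset.sum_const_zero, zero_add, mul_add,
    Finset.sum_add_distrib]
  have e1 : ∑ a, ∑ b, ∑ c, ∑ e, w a * w b * w c * w e *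
      ((if a = b then 1 else 0) * if c = e then 1 else 0) = (w ⬝ᵥ w) ^ 2 := by
    simp only [pow_two, dotProduct, Finset.sum_mul_sum]
    refine Finset.sum_congr rfl fun a _ => ?_
    rw [Finset.sum_eq_single a]
    · simp [mul_assoc]
    · intro b _ hb; simp [hb.symm]
    · simp
  have e2 : ∑ a, ∑ b, ∑ c, ∑ e, w a * w b * w c * w e *
      ((if a = c then 1 else 0) * if b = e then 1 else 0) = (w ⬝ᵥ w) ^ 2 := by
    simp only [pow_two, dotProduct, Finset.sum_mul_sum]
    refine Finset.sum_congr rfl fun a _ => Finset.sum_congr rfl fun b _ => ?_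
    rw [Finset.sum_eq_single a]
    · simp; ring
    · intro b _ hb; simp [hb.symm]
    · simp
  have e3 : ∑ a, ∑ b, ∑ c, ∑ e, w a * w b * w c * w e *
      ((if a = e then 1 else 0) * if b = c then 1 else 0) = (w ⬝ᵥ w) ^ 2 := by
    simp only [pow_two, dotProduct, Finset.sum_mul_sum]
    refine Finset.sum_congr rfl fun a _ => Finset.sum_congr rfl fun b _ => ?_
    rw [Finset.sum_eq_single b]
    · simp; ring
    · intro c _ hc; simp [hc.symm]
    · simp
  have e4 : ∑ a, ∑ b, ∑ c, ∑ e, w a * w b * w c * w e *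
      (if a = b ∧ b = c ∧ c = e then β a - 3 else 0) = ∑ a, w a ^ 4 * (β a - 3) := by
    refine Finset.sum_congr rfl fun a _ => ?_
    rw [Finset.sum_eq_single a, Finset.sum_eq_single a, Finset.sum_eq_single a]
    · simp only [and_self, if_true]; ring
    · intro c _ hc; simp [hc.symm]
    · simp
    · intro c _ hc; simp [hc.symm]
    · simp
    · intro b _ hb; simp [hb.symm]
    · simp
  rw [e1, e2, e3, e4]
  ring

lemma covOf_eq (h : IsIndepMoments γ β M) : covOf M = 1 := by
  ext k l
  simp [covOf, h.hat_single, br, Fintype.sum_option, h.second, Matrix.one_apply, eq_comm]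

/-- The contribution of a component to the population index. -/
def gval (α : ℝ) (γ β : Fin p → ℝ) (a : Fin p) : ℝ := α * γ a ^ 2 + (1 - α) * (β a - 3) ^ 2

/-- Cauchy-Schwarz after splitting off one factor `w a`, using `∑ w a ^ 2 = 1`. For the kurtosis
this gives `w a ^ 6`, which is at most `w a ^ 4`. -/
lemma index_le (h : IsIndepMoments γ β M) {α : ℝ} (hα : α ∈ Set.Icc (0 : ℝ) 1) {w : Fin p → ℝ}
    (hw : w ⬝ᵥ w = 1) : index α M w ≤ ∑ a, w a ^ 4 * gval α γ β a := by
  have hw2 : ∑ a, w a ^ 2 = 1 := by simpa [dotProduct, pow_two] using hw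
  have hle : ∀ a, w a ^ 2 ≤ 1 := fun a => hw2 ▸
    Finset.single_le_sum (f := fun i => w i ^ 2) (fun i _ => sq_nonneg _) (Finset.mem_univ a)
  have h3 : (∑ a, w a ^ 3 * γ a) ^ 2 ≤ ∑ a, w a ^ 4 * γ a ^ 2 := by
    have := Finset.sum_mul_sq_le_sq_mul_sq Finset.univ w (fun a => w a ^ 2 * γ a)
    rw [hw2, one_mul] at this
    calc _ = (∑ a, w a * (w a ^ 2 * γ a)) ^ 2 := by
          congr 1; exact Finset.sum_congr rfl fun a _ => by ring
      _ ≤ _ := this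
      _ = _ := Finset.sum_congr rfl fun a _ => by ring
  have h4 : (∑ a, w a ^ 4 * (β a - 3)) ^ 2 ≤ ∑ a, w a ^ 4 * (β a - 3) ^ 2 := by
    have := Finset.sum_mul_sq_le_sq_mul_sq Finset.univ w (fun a => w a ^ 3 * (β a - 3))
    rw [hw2, one_mul] at this
    calc _ = (∑ a, w a * (w a ^ 3 * (β a - 3))) ^ 2 := by
          congr 1; exact Finset.sum_congr rfl fun a _ => by ring
      _ ≤ _ := this
      _ ≤ _ := Finset.sum_le_sum fun a _ => by
          nlinarith [mul_nonneg (mul_nonneg (sq_nonneg (w a ^ 2)) (sq_nonneg (β a - 3)))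
            (sub_nonneg.2 (hle a))]
  rw [index, h.third_eq, h.fourth_eq, hw]
  have e : 3 * (1 : ℝ) ^ 2 + ∑ a, w a ^ 4 * (β a - 3) - 3 = ∑ a, w a ^ 4 * (β a - 3) := by ring
  rw [e]
  calc _ ≤ α * (∑ a, w a ^ 4 * γ a ^ 2) + (1 - α) * ∑ a, w a ^ 4 * (β a - 3) ^ 2 :=
        add_le_add (mul_le_mul_of_nonneg_left h3 hα.1)
          (mul_le_mul_of_nonneg_left h4 (sub_nonneg.2 hα.2))
    _ = _ := by
        rw [Finset.mul_sum, Finset.mul_sum, ← Finset.sum_add_distrib]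
        exact Finset.sum_congr rfl fun a _ => by rw [gval]; ring

lemma index_single (h : IsIndepMoments γ β M) (α : ℝ) (k : Fin p) :
    index α M (Pi.single k 1) = gval α γ β k := by
  rw [index, h.third_eq, h.fourth_eq, Finset.sum_eq_single k, Finset.sum_eq_single k]
  · simp [gval]
  · intro b _ hb; simp [hb]
  · simp
  · intro b _ hb; simp [hb]
  · simp

end IsIndepMoments

/-- The set of arrays whose trace is maximal among their signed row permutations. -/
def traceMaximal (hdp : d ≤ p) : Set (Fin d → Fin p → ℝ) :=
  {U | ∀ (ε : Fin d → ℝ) (σ : Equiv.Perm (Fin d)), (∀ k, ε k = 1 ∨ ε k = -1) →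
    ∑ k, ε k * U (σ k) (Fin.castLE hdp k) ≤ ∑ k, U k (Fin.castLE hdp k)}

lemma isClosed_traceMaximal (hdp : d ≤ p) : IsClosed (traceMaximal hdp) := by
  simp only [traceMaximal, Set.ofPred_forall]
  exact isClosed_iInter fun ε => isClosed_iInter fun σ => isClosed_iInter fun _ =>
    isClosed_le (by fun_prop) (by fun_prop)

lemma index_neg (α : ℝ) (M : Tens p) (w : Fin p → ℝ) : index α M (-w) = index α M w := by
  have hh : hat M (-w) = -hat M w := map_neg (hatLin M) w
  have h3 : third M (-w) = -third M w := by
    simp only [third, hh, br, Pi.neg_apply, neg_mul, mul_neg, neg_neg, Finset.sum_neg_distrib]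
  have h4 : fourth M (-w) = fourth M w := by
    simp only [fourth, hh, br, Pi.neg_apply, neg_mul, mul_neg, neg_neg]
  rw [index, index, h3, h4, neg_sq]

lemma objective_signed_perm (α : ℝ) (q : Tens p × (Fin p → Fin p → ℝ)) (U : Fin d → Fin p → ℝ)
    {ε : Fin d → ℝ} (hε : ∀ k, ε k = 1 ∨ ε k = -1) (σ : Equiv.Perm (Fin d)) :
    objective α q (fun k => ε k • U (σ k)) = objective α q U := by
  rw [objective, objective, ← Equiv.sum_comp σ fun k => index α q.1 (U k ᵥ* Matrix.of q.2)]
  refine Finset.sum_congr rfl fun k _ => ?_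
  rcases hε k with h | h
  · rw [h, one_smul]
  · rw [h, neg_one_smul, Matrix.neg_vecMul, index_neg]

lemma signed_perm_mem_frames {U : Fin d → Fin p → ℝ} (hU : U ∈ frames d p)
    {ε : Fin d → ℝ} (hε : ∀ k, ε k = 1 ∨ ε k = -1) (σ : Equiv.Perm (Fin d)) :
    (fun k => ε k • U (σ k)) ∈ frames d p := by
  intro k l
  rw [smul_dotProduct, dotProduct_smul, hU]
  by_cases h : k = l
  · subst h
    rcases hε k with h | h <;> simp [h]
  · simp [h]

/-- Bessel's inequality for the basis vector `a`: its projection `y` on the span of the rows has `y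
a = y ⬝ᵥ y`, so `s ^ 2 ≤ s` for the sum `s` in question. -/
lemma sum_sq_le_one_of_frames {U : Fin d → Fin p → ℝ} (hU : U ∈ frames d p) (a : Fin p) :
    ∑ k, U k a ^ 2 ≤ 1 := by
  set y : Fin p → ℝ := ∑ k, U k a • U k with hy
  have h1 : y ⬝ᵥ y = ∑ k, U k a ^ 2 := by
    rw [hy, sum_dotProduct]
    refine Finset.sum_congr rfl fun k _ => ?_
    rw [dotProduct_sum, Finset.sum_eq_single k]
    · rw [smul_dotProduct, dotProduct_smul, hU]; simp [pow_two]
    · intro l _ hl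
      rw [smul_dotProduct, dotProduct_smul, hU]; simp [hl.symm]
    · simp
  have h2 : y a = ∑ k, U k a ^ 2 := by
    simp [hy, pow_two]
  have h3 : y a ^ 2 ≤ y ⬝ᵥ y := by
    rw [pow_two]
    exact Finset.single_le_sum (f := fun i => y i * y i) (fun i _ => mul_self_nonneg _)
      (Finset.mem_univ a)
  rw [h1, h2] at h3
  by_contra! h
  nlinarith

/-- At the population, the only trace maximal maximizer is `(I_d, 0)`. -/
lemma IsIndepMoments.eq_idFrame {γ β : Fin p → ℝ} {M : Tens p} (h : IsIndepMoments γ β M)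
    (hdp : d ≤ p) {α : ℝ} (hα : α ∈ Set.Icc (0 : ℝ) 1)
    (hsig : ∀ a : Fin p, (a : ℕ) < d → 0 < gval α γ β a)
    (hnoise : ∀ a : Fin p, d ≤ (a : ℕ) → gval α γ β a = 0)
    {U : Fin d → Fin p → ℝ} (hU : U ∈ frames d p ∩ traceMaximal hdp)
    (hle : objective α (M, fun i j => (1 : Matrix (Fin p) (Fin p) ℝ) i j) (idFrame d p) ≤
      objective α (M, fun i j => (1 : Matrix (Fin p) (Fin p) ℝ) i j) U) :
    U = idFrame d p := by
  obtain ⟨hUf, hUt⟩ := hU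
  have hobj : ∀ V : Fin d → Fin p → ℝ,
      objective α (M, fun i j => (1 : Matrix (Fin p) (Fin p) ℝ) i j) V =
        ∑ k, index α M (V k) := fun V =>
    Finset.sum_congr rfl fun k _ => congrArg (index α M) (Matrix.vecMul_one (V k))
  have hrow : ∀ k, U k ⬝ᵥ U k = 1 := fun k => by simpa using hUf k k
  have hrow2 : ∀ k, ∑ a, U k a ^ 2 = 1 := fun k => by
    simpa [dotProduct, pow_two] using hrow k
  have hentry : ∀ k a, U k a ^ 2 ≤ 1 := fun k a => hrow2 k ▸
    Finset.single_le_sum (f := fun i => U k i ^ 2) (fun i _ => sq_nonneg _) (Finset.mem_univ a)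
  have hsum : ∀ f : Fin p → ℝ, (∀ a : Fin p, d ≤ (a : ℕ) → f a = 0) →
      ∑ a, f a = ∑ k : Fin d, f (Fin.castLE hdp k) := by
    intro f hf
    rw [← Finset.sum_image (s := Finset.univ) (g := Fin.castLE hdp) (f := f)
      (fun x _ y _ hxy => Fin.castLE_injective hdp hxy)]
    symm
    refine Finset.sum_subset (Finset.subset_univ _) fun a _ ha => hf a ?_
    by_contra! hlt
    exact ha (Finset.mem_image.2 ⟨⟨a, hlt⟩, Finset.mem_univ _, rfl⟩)
  have hcol4 : ∀ a, ∑ k, U k a ^ 4 ≤ 1 := fun a =>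
    (Finset.sum_le_sum fun k _ => by nlinarith [hentry k a, sq_nonneg (U k a)]).trans
      (sum_sq_le_one_of_frames hUf a)
  -- The noise columns carry no weight, so the optimal value `∑ g_k` is compared with a sum weighted
  -- by the fourth powers of the signal columns. Each weight is at most one, so all must equal one.
  have hkey : ∑ k : Fin d, gval α γ β (Fin.castLE hdp k) ≤
      ∑ k : Fin d, gval α γ β (Fin.castLE hdp k) * ∑ j, U j (Fin.castLE hdp k) ^ 4 := by
    rw [hobj, hobj] at hle
    calc _ = ∑ k, index α M (idFrame d p k) :=
          Finset.sum_congr rfl fun k _ => by rw [idFrame_apply hdp, h.index_single]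
      _ ≤ ∑ k, index α M (U k) := hle
      _ ≤ ∑ k, ∑ a, U k a ^ 4 * gval α γ β a :=
          Finset.sum_le_sum fun k _ => h.index_le hα (hrow k)
      _ = ∑ a, gval α γ β a * ∑ j, U j a ^ 4 := by
          rw [Finset.sum_comm]
          refine Finset.sum_congr rfl fun a _ => ?_
          rw [Finset.mul_sum]
          exact Finset.sum_congr rfl fun k _ => mul_comm _ _
      _ = _ := hsum _ fun a ha => by rw [hnoise a ha, zero_mul]
  have hone : ∀ k : Fin d, ∑ j, U j (Fin.castLE hdp k) ^ 4 = 1 := by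
    intro k
    by_contra hne
    refine absurd hkey (not_le.2 (Finset.sum_lt_sum (fun i _ => ?_) ⟨k, Finset.mem_univ k, ?_⟩))
    · exact mul_le_of_le_one_right (hsig _ i.2).le (hcol4 _)
    · exact mul_lt_of_lt_one_right (hsig _ k.2) (lt_of_le_of_ne (hcol4 _) hne)
  -- In column `k` the fourth powers sum to one and the squares to at most one, so every entry
  -- satisfies `u ^ 2 = u ^ 4`, and they cannot all vanish.
  have hex : ∀ k : Fin d, ∃ j, U j (Fin.castLE hdp k) = 1 ∨ U j (Fin.castLE hdp k) = -1 := by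
    intro k
    set a := Fin.castLE hdp k
    by_contra! hno
    have hz : ∀ j, U j a ^ 2 - U j a ^ 4 = 0 := by
      have hnn : ∀ j ∈ Finset.univ, 0 ≤ U j a ^ 2 - U j a ^ 4 := fun j _ => by
        nlinarith [hentry j a, sq_nonneg (U j a)]
      have hs : ∑ j, (U j a ^ 2 - U j a ^ 4) = 0 := by
        refine le_antisymm ?_ (Finset.sum_nonneg hnn)
        rw [Finset.sum_sub_distrib, hone k]
        linarith [sum_sq_le_one_of_frames hUf a]
      exact fun j => (Finset.sum_eq_zero_iff_of_nonneg hnn).1 hs j (Finset.mem_univ j)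
    have hzero : ∀ j, U j a = 0 := by
      intro j
      have h1 : U j a ^ 2 * ((1 - U j a) * (1 + U j a)) = 0 := by linear_combination hz j
      rcases mul_eq_zero.1 h1 with h2 | h2
      · exact pow_eq_zero_iff two_ne_zero |>.1 h2
      · rcases mul_eq_zero.1 h2 with h3 | h3
        · exact absurd (by linarith) (hno j).1
        · exact absurd (by linarith) (hno j).2
    have := hone k
    simp only [show Fin.castLE hdp k = a from rfl, hzero] at this
    simp at this
  choose σ hσ using hex
  have hinj : Function.Injective σ := by
    intro k l hkl
    by_contra hne
    have hne' : Fin.castLE hdp k ≠ Fin.castLE hdp l := fun h => hne (Fin.castLE_injective hdp h)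
    have h1 := Finset.add_le_sum (s := Finset.univ) (f := fun i => U (σ k) i ^ 2)
      (fun i _ => sq_nonneg _) (Finset.mem_univ (Fin.castLE hdp k))
      (Finset.mem_univ (Fin.castLE hdp l)) hne'
    rw [hrow2] at h1
    have hk : U (σ k) (Fin.castLE hdp k) ^ 2 = 1 := by
      rcases hσ k with h | h <;> rw [h] <;> norm_num
    have hl : U (σ k) (Fin.castLE hdp l) ^ 2 = 1 := by
      rw [hkl]; rcases hσ l with h | h <;> rw [h] <;> norm_num
    simp only [hk, hl] at h1
    norm_num at h1
  -- Undoing the signs and the permutation `σ` would give trace `d`, so trace maximality forces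
  -- every diagonal entry up to its bound `1`.
  have htr := hUt (fun k => U (σ k) (Fin.castLE hdp k))
    (Equiv.ofBijective σ (Finite.injective_iff_bijective.1 hinj)) hσ
  have hdiag_le : ∀ k : Fin d, U k (Fin.castLE hdp k) ≤ 1 := fun k =>
    (abs_le.1 ((sq_le_one_iff_abs_le_one _).1 (hentry k _))).2
  have hdiag : ∀ k : Fin d, U k (Fin.castLE hdp k) = 1 := by
    intro k
    by_contra hne
    refine absurd htr (not_le.2 ?_)
    have e : ∑ k : Fin d, U (σ k) (Fin.castLE hdp k) *
        U (Equiv.ofBijective σ (Finite.injective_iff_bijective.1 hinj) k) (Fin.castLE hdp k) =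
        ∑ k : Fin d, (1 : ℝ) := Finset.sum_congr rfl fun k _ => by
      rw [Equiv.ofBijective_apply]
      rcases hσ k with h | h <;> rw [h] <;> norm_num
    rw [e]
    exact Finset.sum_lt_sum (fun i _ => hdiag_le i)
      ⟨k, Finset.mem_univ k, lt_of_le_of_ne (hdiag_le k) hne⟩
  funext k
  rw [idFrame_apply hdp]
  funext l
  by_cases hl : l = Fin.castLE hdp k
  · rw [hl, hdiag]; simp
  · have h1 := Finset.add_le_sum (s := Finset.univ) (f := fun i => U k i ^ 2)
      (fun i _ => sq_nonneg _) (Finset.mem_univ l) (Finset.mem_univ (Fin.castLE hdp k)) hl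
    rw [hrow2] at h1
    simp only [hdiag] at h1
    rw [Pi.single_eq_of_ne hl]
    exact pow_eq_zero_iff two_ne_zero |>.1 (le_antisymm (by linarith) (sq_nonneg (U k l)))

/-- Near the population moments, the selected maximizers are close to `(I_d, 0)`. -/
lemma IsIndepMoments.tendsto_selection {γ β : Fin p → ℝ} {M₀ : Tens p}
    (h : IsIndepMoments γ β M₀) (hdp : d ≤ p) {α : ℝ} (hα : α ∈ Set.Icc (0 : ℝ) 1)
    (hsig : ∀ a : Fin p, (a : ℕ) < d → 0 < gval α γ β a)
    (hnoise : ∀ a : Fin p, d ≤ (a : ℕ) → gval α γ β a = 0)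
    {u : Tens p → Fin d → Fin p → ℝ} (hu : ∀ M, u M ∈ frames d p)
    (hmax : ∀ M, ∀ V ∈ frames d p, objective α (param M) V ≤ objective α (param M) (u M))
    (htr : ∀ M, ∀ V ∈ frames d p, objective α (param M) V = objective α (param M) (u M) →
        ∑ k, V k (Fin.castLE hdp k) ≤ ∑ k, u M k (Fin.castLE hdp k)) :
    Tendsto u (𝓝[momentSet p] M₀) (𝓝 (idFrame d p)) ∧
    Tendsto (fun M => invSqrt (covOf M)) (𝓝[momentSet p] M₀) (𝓝 1) := by
  have hR : Tendsto (fun M => invSqrt (covOf M)) (𝓝[momentSet p] M₀) (𝓝 1) := by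
    have h1 : Tendsto covOf (𝓝[momentSet p] M₀) (𝓝[{S | S.PosSemidef}] 1) := by
      refine tendsto_nhdsWithin_iff.2 ⟨?_, ?_⟩
      · rw [← h.covOf_eq]
        exact (continuous_covOf.tendsto M₀).mono_left nhdsWithin_le_nhds
      · filter_upwards [self_mem_nhdsWithin] with M hM using covOf_posSemidef hM
    have h2 := continuousWithinAt_invSqrt_one (p := p)
    rw [ContinuousWithinAt, invSqrt_one] at h2
    exact h2.comp h1
  have ht : Tendsto param (𝓝[momentSet p] M₀)
      (𝓝 (M₀, fun i j => (1 : Matrix (Fin p) (Fin p) ℝ) i j)) :=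
    (tendsto_id.mono_left nhdsWithin_le_nhds).prodMk_nhds hR
  refine ⟨tendsto_maximizer (continuous_objective α) isCompact_frames
    (isClosed_traceMaximal hdp) (idFrame_mem hdp)
    (fun U hU hle => h.eq_idFrame hdp hα hsig hnoise hU hle) ht (fun M => ⟨hu M, ?_⟩) hmax, hR⟩
  -- A signed row permutation of the selection is again a maximizer, so the tie-breaking rule yields
  -- trace maximality.
  intro ε σ hε
  exact htr M _ (signed_perm_mem_frames (hu M) hε σ) (objective_signed_perm α _ _ hε σ)

end Population

/-! ## Linearization of the stationarity conditions -/

section Linear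

variable {E : Type*} [NormedAddCommGroup E] [NormedSpace ℝ E] {x₀ : E}

/-- `f` is differentiable at `x₀` with derivative given by the function `f'`. -/
def HasLin (x₀ : E) (f f' : E → ℝ) : Prop := ∃ L : E →L[ℝ] ℝ, HasFDerivAt f L x₀ ∧ ∀ v, L v = f' v

namespace HasLin

variable {f g f' g' : E → ℝ}

lemma const (x₀ : E) (c : ℝ) : HasLin x₀ (fun _ => c) fun _ => 0 :=
  ⟨0, hasFDerivAt_const c x₀, fun _ => rfl⟩

lemma of_clm (L : E →L[ℝ] ℝ) : HasLin x₀ (fun x => L x) fun v => L v :=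
  ⟨L, L.hasFDerivAt, fun _ => rfl⟩

lemma congr_deriv (hf : HasLin x₀ f f') {f'' : E → ℝ} (h : ∀ v, f' v = f'' v) :
    HasLin x₀ f f'' := by
  obtain ⟨L, hL, h'⟩ := hf
  exact ⟨L, hL, fun v => (h' v).trans (h v)⟩

lemma add (hf : HasLin x₀ f f') (hg : HasLin x₀ g g') :
    HasLin x₀ (fun x => f x + g x) fun v => f' v + g' v := by
  obtain ⟨L, hL, h⟩ := hf
  obtain ⟨K, hK, h'⟩ := hg
  exact ⟨L + K, hL.fun_add hK, fun v => by simp [h, h']⟩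

lemma sub (hf : HasLin x₀ f f') (hg : HasLin x₀ g g') :
    HasLin x₀ (fun x => f x - g x) fun v => f' v - g' v := by
  obtain ⟨L, hL, h⟩ := hf
  obtain ⟨K, hK, h'⟩ := hg
  exact ⟨L - K, hL.fun_sub hK, fun v => by simp [h, h']⟩

lemma neg (hf : HasLin x₀ f f') : HasLin x₀ (fun x => -f x) fun v => -f' v := by
  obtain ⟨L, hL, h⟩ := hf
  exact ⟨-L, hL.fun_neg, fun v => by simp [h]⟩

lemma mul (hf : HasLin x₀ f f') (hg : HasLin x₀ g g') :
    HasLin x₀ (fun x => f x * g x) fun v => f x₀ * g' v + f' v * g x₀ := by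
  obtain ⟨L, hL, h⟩ := hf
  obtain ⟨K, hK, h'⟩ := hg
  exact ⟨f x₀ • K + g x₀ • L, hL.mul hK, fun v => by simp [h, h', mul_comm]⟩

lemma sum {ι : Type*} (s : Finset ι) {f f' : ι → E → ℝ} (hf : ∀ i, HasLin x₀ (f i) (f' i)) :
    HasLin x₀ (fun x => ∑ i ∈ s, f i x) fun v => ∑ i ∈ s, f' i v := by
  choose L hL h using hf
  exact ⟨∑ i ∈ s, L i, HasFDerivAt.fun_sum fun i _ => hL i, fun v => by simp [h]⟩

lemma br {p : ℕ} {M M' : E → Tens p} {a a' b b' c c' e e' : E → Option (Fin p) → ℝ}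
    (hM : ∀ i j k l, HasLin x₀ (fun x => M x i j k l) fun v => M' v i j k l)
    (ha : ∀ i, HasLin x₀ (fun x => a x i) fun v => a' v i)
    (hb : ∀ i, HasLin x₀ (fun x => b x i) fun v => b' v i)
    (hc : ∀ i, HasLin x₀ (fun x => c x i) fun v => c' v i)
    (he : ∀ i, HasLin x₀ (fun x => e x i) fun v => e' v i) :
    HasLin x₀ (fun x => br (M x) (a x) (b x) (c x) (e x)) fun v =>
      ProjPursuit.br (M' v) (a x₀) (b x₀) (c x₀) (e x₀)
        + ProjPursuit.br (M x₀) (a' v) (b x₀) (c x₀) (e x₀)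
        + ProjPursuit.br (M x₀) (a x₀) (b' v) (c x₀) (e x₀)
        + ProjPursuit.br (M x₀) (a x₀) (b x₀) (c' v) (e x₀)
        + ProjPursuit.br (M x₀) (a x₀) (b x₀) (c x₀) (e' v) := by
  refine (HasLin.sum Finset.univ fun i => HasLin.sum Finset.univ fun j =>
    HasLin.sum Finset.univ fun k => HasLin.sum Finset.univ fun l =>
      ((((ha i).mul (hb j)).mul (hc k)).mul (he l)).mul (hM i j k l)).congr_deriv fun v => ?_
  simp only [ProjPursuit.br, ← Finset.sum_add_distrib]
  refine Finset.sum_congr rfl fun i _ => Finset.sum_congr rfl fun j _ =>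
    Finset.sum_congr rfl fun k _ => Finset.sum_congr rfl fun l _ => by ring

/-- Along a level set of `f`, the derivative is of smaller order than the displacement. -/
lemma isLittleO (hf : HasLin x₀ f f') {ι : Type*} {l : Filter ι} {t : ι → E}
    (ht : Tendsto t l (𝓝 x₀)) (h : ∀ᶠ i in l, f (t i) = f x₀) :
    (fun i => f' (t i - x₀)) =o[l] fun i => t i - x₀ := by
  obtain ⟨L, hL, h'⟩ := hf
  have h1 := (hasFDerivAt_iff_isLittleO.1 hL).comp_tendsto ht
  have h2 := h1.neg_left
  refine h2.congr' ?_ EventuallyEq.rfl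
  filter_upwards [h] with i hi
  simp [hi, ← h']

end HasLin

/-- If `y - L x` is of smaller order than `(x, y)` with `L x = O(x)`, it is of smaller order
than `x`. -/
lemma isLittleO_of_isLittleO_prod {ι F G : Type*} [NormedAddCommGroup F] [NormedAddCommGroup G]
    {l : Filter ι} {x : ι → F} {y r : ι → G} (hr : r =o[l] fun i => (x i, y i))
    (hL : (fun i => y i - r i) =O[l] x) : r =o[l] x := by
  refine hr.trans_isBigO ?_
  refine Asymptotics.IsBigO.prod_left (Asymptotics.isBigO_refl x l) ?_
  obtain ⟨C, hC⟩ := hL.bound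
  -- From `‖y‖ ≤ C‖x‖ + ‖r‖` and `‖r‖ ≤ (‖x‖ + ‖y‖) / 2`, absorbing `‖y‖ / 2` on the left gives `‖y‖
  -- ≤ (2C + 1)‖x‖`.
  refine Asymptotics.IsBigO.of_bound (2 * C + 1) ?_
  filter_upwards [hC, hr.bound (c := 1 / 2) (by norm_num)] with i h1 h2
  have h3 : ‖y i‖ ≤ ‖y i - r i‖ + ‖r i‖ := by
    simpa using norm_add_le (y i - r i) (r i)
  have h4 : ‖(x i, y i)‖ ≤ ‖x i‖ + ‖y i‖ := by
    rw [Prod.norm_def]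
    exact max_le_add_of_nonneg (norm_nonneg _) (norm_nonneg _)
  linarith

end Linear

/-! ### Contractions of the population tensor and linearized moments -/

section Expansion

variable {d p : ℕ}

lemma br_basis (M : Tens p) (i j k l : Option (Fin p)) :
    br M (Pi.single i 1) (Pi.single j 1) (Pi.single k 1) (Pi.single l 1) = M i j k l := by
  simp [br, Pi.single_apply]

lemma br_sum₁ (M : Tens p) (a : Option (Fin p) → ℝ) (j k l : Option (Fin p)) :
    br M a (Pi.single j 1) (Pi.single k 1) (Pi.single l 1) = ∑ i, a i * M i j k l := by
  simp [br, Pi.single_apply]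

lemma br_sum₂ (M : Tens p) (a : Option (Fin p) → ℝ) (j k l : Option (Fin p)) :
    br M (Pi.single j 1) a (Pi.single k 1) (Pi.single l 1) = ∑ i, a i * M j i k l := by
  simp [br, Pi.single_apply]

lemma br_sum₃ (M : Tens p) (a : Option (Fin p) → ℝ) (j k l : Option (Fin p)) :
    br M (Pi.single j 1) (Pi.single k 1) a (Pi.single l 1) = ∑ i, a i * M j k i l := by
  simp [br, Pi.single_apply]

lemma br_sum₄ (M : Tens p) (a : Option (Fin p) → ℝ) (j k l : Option (Fin p)) :
    br M (Pi.single j 1) (Pi.single k 1) (Pi.single l 1) a = ∑ i, a i * M j k l i := by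
  simp [br, Pi.single_apply]

namespace IsIndepMoments

variable {γ β : Fin p → ℝ} {M : Tens p}

/-- This and the following contractions are expectations of an affine function of `z` times a
monomial; they evaluate the terms of `HasLin.br` in which one argument is perturbed. -/
lemma sum_cov (h : IsIndepMoments γ β M) (a : Option (Fin p) → ℝ) (l : Fin p) :
    ∑ i, a i * M i (some l) none none = a (some l) := by
  simp [Fintype.sum_option, h.second, h.swap₁₂ none, h.first]

lemma sum_mixed (h : IsIndepMoments γ β M) (a : Option (Fin p) → ℝ) {k l : Fin p} (hkl : k ≠ l) :
    ∑ i, a i * M i (some k) (some l) none = 0 := by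
  have : ∀ i, M (some i) (some k) (some l) none = 0 := fun i => by
    rw [h.third]; exact if_neg fun h => hkl h.2
  simp [Fintype.sum_option, this, h.swap₁₂ none, h.swap₂₃ _ none, h.second, hkl]

lemma sum_sq (h : IsIndepMoments γ β M) (a : Option (Fin p) → ℝ) (k : Fin p) :
    ∑ i, a i * M (some k) (some k) i none = a none + γ k * a (some k) := by
  simp [Fintype.sum_option, h.second, h.third, mul_comm]

lemma sum_cube (h : IsIndepMoments γ β M) (a : Option (Fin p) → ℝ) (k : Fin p) :
    ∑ i, a i * M (some k) (some k) (some k) i = γ k * a none + β k * a (some k) := by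
  have : ∀ i, M (some k) (some k) (some k) (some i) = if k = i then β k else 0 := fun i => by
    rw [h.fourth]
    by_cases hi : k = i <;> simp [hi]
    ring
  simp [Fintype.sum_option, this, h.third, mul_comm]

lemma sum_sq_mixed (h : IsIndepMoments γ β M) (a : Option (Fin p) → ℝ) {k l : Fin p}
    (hkl : k ≠ l) : ∑ i, a i * M i (some k) (some k) (some l) = a (some l) := by
  have h0 : M none (some k) (some k) (some l) = 0 := by
    rw [h.swap₁₂, h.swap₂₃, h.swap₃₄, h.third]; simp [hkl]
  have : ∀ i, M (some i) (some k) (some k) (some l) = if i = l then 1 else 0 := fun i => by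
    rw [h.fourth]
    by_cases hi : i = l <;> simp [hi, hkl]
  simp [Fintype.sum_option, this, h0]

end IsIndepMoments

/-- The base point of the linearization. -/
abbrev basePoint (d : ℕ) {p : ℕ} (M₀ : Tens p) : Tens p × (Fin d → Fin p → ℝ) :=
  (M₀, idFrame d p)

namespace IsIndepMoments

variable {γ β : Fin p → ℝ} {M₀ : Tens p}

lemma hasLin_tensor (i j k l : Option (Fin p)) :
    HasLin (basePoint d M₀) (fun q => q.1 i j k l) fun v => v.1 i j k l :=
  HasLin.of_clm ((ContinuousLinearMap.proj l).comp ((ContinuousLinearMap.proj k).comp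
    ((ContinuousLinearMap.proj j).comp ((ContinuousLinearMap.proj i).comp
      (ContinuousLinearMap.fst ℝ (Tens p) (Fin d → Fin p → ℝ))))))

lemma hasLin_entry (k : Fin d) (l : Fin p) :
    HasLin (basePoint d M₀) (fun q => q.2 k l) fun v => v.2 k l :=
  HasLin.of_clm ((ContinuousLinearMap.proj l).comp ((ContinuousLinearMap.proj k).comp
      (ContinuousLinearMap.snd ℝ (Tens p) (Fin d → Fin p → ℝ))))

/-- The derivative of the centered affine function given by row `k`. -/
def dRow (hdp : d ≤ p) (v : Tens p × (Fin d → Fin p → ℝ)) (k : Fin d) : Option (Fin p) → ℝ :=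
  fun o => o.elim (-v.1 (some (Fin.castLE hdp k)) none none none) (v.2 k)

/-- The derivative of the centered coordinate `l`. -/
def dCoord (v : Tens p × (Fin d → Fin p → ℝ)) (l : Fin p) : Option (Fin p) → ℝ :=
  fun o => o.elim (-v.1 (some l) none none none) 0

lemma hasLin_hat_row (h : IsIndepMoments γ β M₀) (hdp : d ≤ p) (k : Fin d) (o : Option (Fin p)) :
    HasLin (basePoint d M₀) (fun q => hat q.1 (q.2 k) o) fun v => dRow hdp v k o := by
  cases o with
  | some l => exact hasLin_entry k l
  | none =>
    refine (HasLin.neg (HasLin.sum Finset.univ fun a =>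
      (hasLin_entry k a).mul (hasLin_tensor (some a) none none none))).congr_deriv fun v => ?_
    simp [h.first, idFrame_apply hdp, dRow, Pi.single_apply]

lemma hasLin_hat_coord (l : Fin p) (o : Option (Fin p)) :
    HasLin (basePoint d M₀) (fun q => hat q.1 (Pi.single l 1) o) fun v => dCoord v l o := by
  cases o with
  | some k => exact HasLin.const _ _
  | none =>
    refine (HasLin.neg (HasLin.sum Finset.univ fun a =>
      (HasLin.const _ _).mul (hasLin_tensor (some a) none none none))).congr_deriv fun v => ?_
    simp [dCoord, Pi.single_apply]

lemma hat_row_base (h : IsIndepMoments γ β M₀) (hdp : d ≤ p) (k : Fin d) :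
    hat (basePoint d M₀).1 ((basePoint d M₀).2 k) = coord (Fin.castLE hdp k) := by
  simp only [idFrame_apply hdp, h.hat_single]

lemma hasLin_one (o : Option (Fin p)) :
    HasLin (basePoint d M₀) (fun _ => one o) fun _ => (0 : Option (Fin p) → ℝ) o :=
  HasLin.const _ _

lemma br_zero₃ (M : Tens p) (a b e : Option (Fin p) → ℝ) : br M a b 0 e = 0 := by simp [br]
lemma br_zero₄ (M : Tens p) (a b c : Option (Fin p) → ℝ) : br M a b c 0 = 0 := by simp [br]

/-- Linearization of a covariance of two affine functions. -/
lemma hasLin_cov (h : IsIndepMoments γ β M₀) {k l : Fin p}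
    {a b : Tens p × (Fin d → Fin p → ℝ) → Option (Fin p) → ℝ}
    {a' b' : Tens p × (Fin d → Fin p → ℝ) → Option (Fin p) → ℝ}
    (ha : ∀ o, HasLin (basePoint d M₀) (fun q => a q o) fun v => a' v o)
    (hb : ∀ o, HasLin (basePoint d M₀) (fun q => b q o) fun v => b' v o)
    (ha0 : a (basePoint d M₀) = coord k) (hb0 : b (basePoint d M₀) = coord l) :
    HasLin (basePoint d M₀) (fun q => br q.1 (a q) (b q) one one) fun v =>
      v.1 (some k) (some l) none none + a' v (some l) + b' v (some k) := by
  refine (HasLin.br hasLin_tensor ha hb hasLin_one hasLin_one).congr_deriv fun v => ?_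
  rw [ha0, hb0]
  simp only [br_zero₃, br_zero₄, add_zero, coord, one, br_basis]
  simp only [br_sum₁, br_sum₂]
  have e2 : ∑ i, b' v i * M₀ (some k) i none none = b' v (some k) := by
    rw [← h.sum_cov (b' v)]
    exact Finset.sum_congr rfl fun i _ => by rw [h.swap₁₂]
  rw [h.sum_cov, e2]

/-- Perturbing `a` has no first-order effect, because `z_k z_l` is uncorrelated with every affine
function when `k ≠ l`. -/
lemma hasLin_quad (h : IsIndepMoments γ β M₀) {k l : Fin p} (hkl : k ≠ l)
    {a b : Tens p × (Fin d → Fin p → ℝ) → Option (Fin p) → ℝ}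
    {a' b' : Tens p × (Fin d → Fin p → ℝ) → Option (Fin p) → ℝ}
    (ha : ∀ o, HasLin (basePoint d M₀) (fun q => a q o) fun v => a' v o)
    (hb : ∀ o, HasLin (basePoint d M₀) (fun q => b q o) fun v => b' v o)
    (ha0 : a (basePoint d M₀) = coord k) (hb0 : b (basePoint d M₀) = coord l) :
    HasLin (basePoint d M₀) (fun q => br q.1 (a q) (a q) (b q) one) fun v =>
      v.1 (some k) (some k) (some l) none + b' v none + γ k * b' v (some k) := by
  refine (HasLin.br hasLin_tensor ha ha hb hasLin_one).congr_deriv fun v => ?_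
  rw [ha0, hb0]
  simp only [br_zero₄, add_zero, coord, one, br_basis]
  simp only [br_sum₁, br_sum₂, br_sum₃]
  have e2 : ∑ i, a' v i * M₀ (some k) i (some l) none = 0 := by
    rw [← h.sum_mixed (a' v) hkl]
    exact Finset.sum_congr rfl fun i _ => by rw [h.swap₁₂]
  rw [h.sum_mixed _ hkl, e2, h.sum_sq]
  ring

/-- Each of the three arguments `a` contributes the coefficient of `z_l` in its perturbation,
because `E (z_k² z_l²) = 1`; hence the factor `3`. -/
lemma hasLin_cubic (h : IsIndepMoments γ β M₀) {k l : Fin p} (hkl : k ≠ l)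
    {a b : Tens p × (Fin d → Fin p → ℝ) → Option (Fin p) → ℝ}
    {a' b' : Tens p × (Fin d → Fin p → ℝ) → Option (Fin p) → ℝ}
    (ha : ∀ o, HasLin (basePoint d M₀) (fun q => a q o) fun v => a' v o)
    (hb : ∀ o, HasLin (basePoint d M₀) (fun q => b q o) fun v => b' v o)
    (ha0 : a (basePoint d M₀) = coord k) (hb0 : b (basePoint d M₀) = coord l) :
    HasLin (basePoint d M₀) (fun q => br q.1 (a q) (a q) (a q) (b q)) fun v =>
      v.1 (some k) (some k) (some k) (some l) + 3 * a' v (some l)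
        + γ k * b' v none + β k * b' v (some k) := by
  refine (HasLin.br hasLin_tensor ha ha ha hb).congr_deriv fun v => ?_
  rw [ha0, hb0]
  simp only [coord, br_basis]
  simp only [br_sum₁, br_sum₂, br_sum₃, br_sum₄]
  have e2 : ∑ i, a' v i * M₀ (some k) i (some k) (some l) = a' v (some l) := by
    rw [← h.sum_sq_mixed (a' v) hkl]
    exact Finset.sum_congr rfl fun i _ => by rw [h.swap₁₂]
  have e3 : ∑ i, a' v i * M₀ (some k) (some k) i (some l) = a' v (some l) := by
    rw [← e2]
    exact Finset.sum_congr rfl fun i _ => by rw [h.swap₂₃]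
  rw [h.sum_sq_mixed _ hkl, e2, e3, h.sum_cube]
  ring

end IsIndepMoments

end Expansion

/-! ### Linearized gradient and the candidate influence function -/

section Gradient

variable {d p : ℕ}

/-- The covariance of a component with its score. -/
def cval (α : ℝ) (γ β : Fin p → ℝ) (k : Fin p) : ℝ :=
  alpha1 α * γ k ^ 2 + alpha2 α * (β k - 3) * β k

/-- The curvature of the objective contributed by a component. -/
def curv (α : ℝ) (γ β : Fin p → ℝ) (k : Fin p) : ℝ :=
  alpha1 α * γ k ^ 2 + alpha2 α * (β k - 3) ^ 2

/-- The covariance of the centered score of component `k` with component `l`. -/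
def scoreCov (α : ℝ) (γ β : Fin p → ℝ) (T : Tens p) (k l : Fin p) : ℝ :=
  alpha1 α * γ k * T (some k) (some k) (some l) none
    + alpha2 α * (β k - 3) * T (some k) (some k) (some k) (some l)
    - (alpha1 α * γ k + alpha2 α * (β k - 3) * γ k) * T (some l) none none none

/-- The derivative of the functional at the population moments, in direction `T`. -/
noncomputable def infl (α : ℝ) (γ β : Fin p → ℝ) (T : Tens p) (k l : Fin p) : ℝ :=
  if k = l then -(1 / 2) * T (some k) (some k) none none
  else (scoreCov α γ β T k l - scoreCov α γ β T l k
    + (3 * alpha2 α * (β l - 3) - cval α γ β k) * T (some k) (some l) none none)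
      / (curv α γ β k + curv α γ β l)

namespace IsIndepMoments

variable {γ β : Fin p → ℝ} {M₀ : Tens p}

lemma exists_hasLin_br {M₀ : Tens p}
    {a a' b b' c c' e e' : Tens p × (Fin d → Fin p → ℝ) → Option (Fin p) → ℝ}
    (ha : ∀ o, HasLin (basePoint d M₀) (fun q => a q o) fun v => a' v o)
    (hb : ∀ o, HasLin (basePoint d M₀) (fun q => b q o) fun v => b' v o)
    (hc : ∀ o, HasLin (basePoint d M₀) (fun q => c q o) fun v => c' v o)
    (he : ∀ o, HasLin (basePoint d M₀) (fun q => e q o) fun v => e' v o) :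
    ∃ f', HasLin (basePoint d M₀) (fun q => br q.1 (a q) (b q) (c q) (e q)) f' :=
  ⟨_, HasLin.br hasLin_tensor ha hb hc he⟩

lemma third_base (h : IsIndepMoments γ β M₀) (hdp : d ≤ p) (k : Fin d) :
    ProjPursuit.third (basePoint d M₀).1 ((basePoint d M₀).2 k) = γ (Fin.castLE hdp k) := by
  rw [ProjPursuit.third, h.hat_row_base hdp, coord, one, br_basis]
  simp [h.third]

lemma fourth_base (h : IsIndepMoments γ β M₀) (hdp : d ≤ p) (k : Fin d) :
    ProjPursuit.fourth (basePoint d M₀).1 ((basePoint d M₀).2 k) = β (Fin.castLE hdp k) := by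
  rw [ProjPursuit.fourth, h.hat_row_base hdp, coord, br_basis]
  simp [h.fourth]
  ring

lemma quad_base (h : IsIndepMoments γ β M₀) {k l : Fin p} (hkl : k ≠ l) :
    br M₀ (coord k) (coord k) (coord l) one = 0 := by
  rw [coord, coord, one, br_basis, h.third]
  simp [hkl]

lemma cubic_base (h : IsIndepMoments γ β M₀) {k l : Fin p} (hkl : k ≠ l) :
    br M₀ (coord k) (coord k) (coord k) (coord l) = 0 := by
  rw [coord, coord, br_basis, h.fourth]
  simp [hkl]

lemma exists_hasLin_third (h : IsIndepMoments γ β M₀) (hdp : d ≤ p) (k : Fin d) :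
    ∃ f', HasLin (basePoint d M₀) (fun q => ProjPursuit.third q.1 (q.2 k)) f' :=
  exists_hasLin_br (h.hasLin_hat_row hdp k) (h.hasLin_hat_row hdp k) (h.hasLin_hat_row hdp k)
    hasLin_one

lemma exists_hasLin_fourth (h : IsIndepMoments γ β M₀) (hdp : d ≤ p) (k : Fin d) :
    ∃ f', HasLin (basePoint d M₀) (fun q => ProjPursuit.fourth q.1 (q.2 k)) f' :=
  exists_hasLin_br (h.hasLin_hat_row hdp k) (h.hasLin_hat_row hdp k) (h.hasLin_hat_row hdp k)
    (h.hasLin_hat_row hdp k)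

/-- Existence of the derivative suffices: in the noise equation it is multiplied by a covariance
that vanishes at the population. -/
lemma exists_hasLin_grad (h : IsIndepMoments γ β M₀) (hdp : d ≤ p) (α : ℝ) (k j : Fin d) :
    ∃ f', HasLin (basePoint d M₀) (fun q => grad α q.1 (q.2 k) (q.2 j)) f' := by
  obtain ⟨f3, h3⟩ := h.exists_hasLin_third hdp k
  obtain ⟨f4, h4⟩ := h.exists_hasLin_fourth hdp k
  obtain ⟨g3, k3⟩ := exists_hasLin_br (h.hasLin_hat_row hdp k) (h.hasLin_hat_row hdp k)
    (h.hasLin_hat_row hdp j) (hasLin_one (d := d) (M₀ := M₀))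
  obtain ⟨g4, k4⟩ := exists_hasLin_br (h.hasLin_hat_row hdp k) (h.hasLin_hat_row hdp k)
    (h.hasLin_hat_row hdp k) (h.hasLin_hat_row hdp j)
  exact ⟨_, (((HasLin.const _ _).mul h3).mul k3).add
    (((HasLin.const _ _).mul (h4.sub (HasLin.const _ _))).mul k4)⟩

/-- Linearization of the gradient of the index at row `k` in a direction close to the coordinate
`l ≠ k`. -/
lemma hasLin_grad (h : IsIndepMoments γ β M₀) (hdp : d ≤ p) (α : ℝ) (k : Fin d) {l : Fin p}
    (hkl : Fin.castLE hdp k ≠ l) {u : Tens p × (Fin d → Fin p → ℝ) → Fin p → ℝ}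
    {b' : Tens p × (Fin d → Fin p → ℝ) → Option (Fin p) → ℝ}
    (hb : ∀ o, HasLin (basePoint d M₀) (fun q => hat q.1 (u q) o) fun v => b' v o)
    (hb0 : hat (basePoint d M₀).1 (u (basePoint d M₀)) = coord l) :
    HasLin (basePoint d M₀) (fun q => grad α q.1 (q.2 k) (u q)) fun v =>
      alpha1 α * γ (Fin.castLE hdp k) *
        (v.1 (some (Fin.castLE hdp k)) (some (Fin.castLE hdp k)) (some l) none + b' v none
          + γ (Fin.castLE hdp k) * b' v (some (Fin.castLE hdp k)))
      + alpha2 α * (β (Fin.castLE hdp k) - 3) *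
        (v.1 (some (Fin.castLE hdp k)) (some (Fin.castLE hdp k)) (some (Fin.castLE hdp k)) (some l)
          + 3 * v.2 k l + γ (Fin.castLE hdp k) * b' v none
          + β (Fin.castLE hdp k) * b' v (some (Fin.castLE hdp k))) := by
  obtain ⟨f3, h3⟩ := h.exists_hasLin_third hdp k
  obtain ⟨f4, h4⟩ := h.exists_hasLin_fourth hdp k
  have k3 := h.hasLin_quad hkl (h.hasLin_hat_row hdp k) hb (h.hat_row_base hdp k) hb0
  have k4 := h.hasLin_cubic hkl (h.hasLin_hat_row hdp k) hb (h.hat_row_base hdp k) hb0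
  refine ((((HasLin.const _ _).mul h3).mul k3).add
    (((HasLin.const _ _).mul (h4.sub (HasLin.const _ _))).mul k4)).congr_deriv fun v => ?_
  rw [h.hat_row_base hdp, hb0, h.third_base hdp, h.fourth_base hdp]
  -- The derivatives of `third` and `fourth`, of which only existence is known, are multiplied by
  -- mixed moments equal to zero.
  rw [h.quad_base hkl, h.cubic_base hkl]
  simp [dRow]

lemma grad_base (h : IsIndepMoments γ β M₀) (hdp : d ≤ p) (α : ℝ) (k j : Fin d) :
    grad α (basePoint d M₀).1 ((basePoint d M₀).2 k) ((basePoint d M₀).2 j) =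
      if k = j then cval α γ β (Fin.castLE hdp k) else 0 := by
  rw [grad, h.third_base hdp, h.fourth_base hdp, h.hat_row_base hdp, h.hat_row_base hdp]
  by_cases hkj : k = j
  · subst hkj
    have e3 : br M₀ (coord (Fin.castLE hdp k)) (coord (Fin.castLE hdp k))
        (coord (Fin.castLE hdp k)) one = γ (Fin.castLE hdp k) := by
      rw [coord, one, br_basis, h.third]; simp
    have e4 : br M₀ (coord (Fin.castLE hdp k)) (coord (Fin.castLE hdp k))
        (coord (Fin.castLE hdp k)) (coord (Fin.castLE hdp k)) = β (Fin.castLE hdp k) := by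
      rw [coord, br_basis, h.fourth]; simp; ring
    rw [e3, e4, if_pos rfl, cval]
    ring
  · have hne : Fin.castLE hdp k ≠ Fin.castLE hdp j := fun h => hkj (Fin.castLE_injective hdp h)
    rw [h.quad_base hne, h.cubic_base hne, if_neg hkj]
    ring

lemma grad_base_coord (h : IsIndepMoments γ β M₀) (hdp : d ≤ p) (α : ℝ) (k : Fin d) {l : Fin p}
    (hkl : Fin.castLE hdp k ≠ l) :
    grad α (basePoint d M₀).1 ((basePoint d M₀).2 k) (Pi.single l 1) = 0 := by
  rw [grad, h.hat_row_base hdp, h.hat_single, h.quad_base hkl, h.cubic_base hkl]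
  ring

lemma cov_base (h : IsIndepMoments γ β M₀) (k l : Fin p) :
    br M₀ (coord k) (coord l) one one = if k = l then 1 else 0 := by
  rw [coord, coord, one, br_basis, h.second]

end IsIndepMoments

end Gradient

/-! ### Differentiability of the maximizer at the population -/

section Expansion

variable {d p : ℕ} {γ β : Fin p → ℝ} {M₀ : Tens p} {α : ℝ}

lemma isBigO_infl (α : ℝ) (γ β : Fin p → ℝ) (k l : Fin p) {ι : Type*} {f : Filter ι}
    {T : ι → Tens p} : (fun i => infl α γ β (T i) k l) =O[f] T := by
  have hT : ∀ a b c e, (fun i => T i a b c e) =O[f] T := fun a b c e =>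
    Asymptotics.IsBigO.of_bound 1 (Eventually.of_forall fun i => by
      rw [one_mul]
      exact (norm_le_pi_norm (T i a b c) e).trans ((norm_le_pi_norm (T i a b) c).trans
        ((norm_le_pi_norm (T i a) b).trans (norm_le_pi_norm (T i) a))))
  have hs : ∀ k l, (fun i => scoreCov α γ β (T i) k l) =O[f] T := fun k l =>
    (((hT _ _ _ _).const_mul_left _).add ((hT _ _ _ _).const_mul_left _)).sub
      ((hT _ _ _ _).const_mul_left _)
  by_cases hkl : k = l
  · simp only [infl, hkl, if_true]
    exact (hT _ _ _ _).const_mul_left _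
  · simp only [infl, hkl, if_false, div_eq_inv_mul]
    exact ((((hs _ _).sub (hs _ _)).add ((hT _ _ _ _).const_mul_left _))).const_mul_left _

/-- Constrained maximizers close to `(I_d, 0)` are differentiable functions of the moments at the
population moments. -/
theorem IsIndepMoments.isLittleO_sub_infl (h : IsIndepMoments γ β M₀) (hdp : d ≤ p)
    (hcurv : ∀ a : Fin p, (a : ℕ) < d → 0 < curv α γ β a)
    (hγ : ∀ a : Fin p, d ≤ (a : ℕ) → γ a = 0) (hβ : ∀ a : Fin p, d ≤ (a : ℕ) → β a = 3)
    {l : Filter (Tens p)} (hl : l ≤ 𝓝 M₀) {W : Tens p → Fin d → Fin p → ℝ}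
    (hW : Tendsto W l (𝓝 (idFrame d p))) (hmax : ∀ᶠ M in l, IsConstrainedMax α M (W M)) :
    (fun M k a => W M k a - idFrame d p k a - infl α γ β (M - M₀) (Fin.castLE hdp k) a)
      =o[l] fun M => M - M₀ := by
  set t : Tens p → Tens p × (Fin d → Fin p → ℝ) := fun M => (M, W M) with ht
  have htend : Tendsto t l (𝓝 (basePoint d M₀)) :=
    (tendsto_id.mono_left hl).prodMk_nhds hW
  -- The linearized orthonormality constraint determines the symmetric part of the signal block.
  have hcov : ∀ k j : Fin d,
      (fun M => (M - M₀) (some (Fin.castLE hdp k)) (some (Fin.castLE hdp j)) none none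
        + (W M - idFrame d p) k (Fin.castLE hdp j) + (W M - idFrame d p) j (Fin.castLE hdp k))
        =o[l] fun M => t M - basePoint d M₀ := by
    intro k j
    refine (h.hasLin_cov (h.hasLin_hat_row hdp k) (h.hasLin_hat_row hdp j)
      (h.hat_row_base hdp k) (h.hat_row_base hdp j)).isLittleO htend ?_
    filter_upwards [hmax] with M hM
    rw [h.hat_row_base hdp, h.hat_row_base hdp, h.cov_base, ← dotProduct_covOf, hM.orthonormal]
    simp [Fin.castLE_inj]
  -- The error terms are first controlled by the joint displacement of `M` and `W`; boundedness of
  -- `infl` then removes `W` from the bound.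
  suffices hs : ∀ (k : Fin d) (a : Fin p),
      (fun M => W M k a - idFrame d p k a - infl α γ β (M - M₀) (Fin.castLE hdp k) a)
        =o[l] fun M => t M - basePoint d M₀ by
    refine isLittleO_of_isLittleO_prod (y := fun M => W M - idFrame d p)
      (Asymptotics.isLittleO_pi.2 fun k => Asymptotics.isLittleO_pi.2 fun a => hs k a) ?_
    refine Asymptotics.isBigO_pi.2 fun k => Asymptotics.isBigO_pi.2 fun a => ?_
    simpa using isBigO_infl α γ β (Fin.castLE hdp k) a (T := fun M => M - M₀) (f := l)
  intro k a
  by_cases hka : Fin.castLE hdp k = a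
  · subst hka
    refine ((hcov k k).const_mul_left (1 / 2)).congr_left fun M => ?_
    simp only [infl, if_true, Pi.sub_apply]
    ring
  have hk := hcurv (Fin.castLE hdp k) k.2
  by_cases ha : (a : ℕ) < d
  · obtain ⟨j, rfl⟩ : ∃ j : Fin d, Fin.castLE hdp j = a := ⟨⟨a, ha⟩, rfl⟩
    have hj := hcurv (Fin.castLE hdp j) j.2
    have h1 := ((h.hasLin_grad hdp α k hka (h.hasLin_hat_row hdp j) (h.hat_row_base hdp j)).sub
      (h.hasLin_grad hdp α j (Ne.symm hka) (h.hasLin_hat_row hdp k)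
        (h.hat_row_base hdp k))).isLittleO htend (by
          filter_upwards [hmax] with M hM
          rw [h.grad_base hdp, h.grad_base hdp]
          have hne : k ≠ j := fun h => hka (congrArg _ h)
          simp only [hne, hne.symm, if_false, sub_self, sub_eq_zero]
          exact hM.grad_comm k j)
    -- The factor is the coefficient of `w_jk` in the linearized symmetry condition. Subtracting
    -- that condition eliminates `w_jk` and leaves `w_kj` with coefficient `curv_k + curv_j`,
    -- because `curv = cval - 3 α₂ κ`.
    refine (((hcov k j).const_mul_left (cval α γ β (Fin.castLE hdp k)
      - 3 * alpha2 α * (β (Fin.castLE hdp j) - 3))).sub h1 |>.const_mul_left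
        (curv α γ β (Fin.castLE hdp k) + curv α γ β (Fin.castLE hdp j))⁻¹).congr_left fun M => ?_
    have hne : curv α γ β (Fin.castLE hdp k) + curv α γ β (Fin.castLE hdp j) ≠ 0 := by positivity
    simp only [infl, hka, if_false, IsIndepMoments.dRow, Option.elim, Prod.fst_sub,
      Prod.snd_sub, Pi.sub_apply, ht, scoreCov]
    rw [eq_sub_iff_add_eq, ← mul_right_inj' hne]
    field_simp
    simp only [cval, curv]
    ring
  · have ha' : d ≤ (a : ℕ) := not_lt.1 ha
    have h2 : ∀ j : Fin d, Fin.castLE hdp j ≠ a := fun j hj => ha (hj ▸ j.2)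
    choose f' hf' using h.exists_hasLin_grad hdp α k
    have hb0 : hat (basePoint d M₀).1 (Pi.single a 1) = coord a := h.hat_single a
    have h1 := ((h.hasLin_grad hdp α k hka (hasLin_hat_coord a) hb0).sub
      (HasLin.sum Finset.univ fun j =>
        (h.hasLin_cov (h.hasLin_hat_row hdp j) (hasLin_hat_coord a) (h.hat_row_base hdp j)
          hb0).mul (hf' j))).isLittleO htend (by
          filter_upwards [hmax] with M hM
          rw [h.grad_base_coord hdp α k hka]
          simp only [hb0, h.hat_row_base hdp, h.cov_base, h2, if_false, zero_mul,
            Finset.sum_const_zero, sub_zero]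
          rw [sub_eq_zero]
          simpa only [dotProduct_covOf] using hM.grad_eq_sum k (Pi.single a 1))
    refine (h1.const_mul_left (-(curv α γ β (Fin.castLE hdp k))⁻¹)).congr_left fun M => ?_
    have hid : idFrame d p k a = 0 := by
      rw [idFrame_apply hdp, Pi.single_eq_of_ne (Ne.symm hka)]
    -- At the population, row `j` is uncorrelated with the noise coordinate `a` and the gradient
    -- matrix is diagonal, so only the term `j = k` survives.
    have hsum : ∀ F : Fin d → ℝ, ∀ G : Fin d → ℝ, ∑ j, (br (basePoint d M₀).1
        (hat (basePoint d M₀).1 ((basePoint d M₀).2 j)) (hat (basePoint d M₀).1 (Pi.single a 1))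
        one one * F j + G j * grad α (basePoint d M₀).1 ((basePoint d M₀).2 k)
          ((basePoint d M₀).2 j)) = G k * cval α γ β (Fin.castLE hdp k) := by
      intro F G
      simp only [hb0, h.hat_row_base hdp, h.cov_base, h2, if_false, zero_mul, zero_add,
        h.grad_base hdp]
      simp
    rw [hsum]
    have hka' : curv α γ β (Fin.castLE hdp k) ≠ 0 := hk.ne'
    have hc0 : curv α γ β a = 0 := by simp [curv, hγ a ha', hβ a ha']
    have hs0 : scoreCov α γ β (M - M₀) a (Fin.castLE hdp k) = 0 := by
      simp [scoreCov, hγ a ha', hβ a ha']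
    simp only [infl, hka, if_false, hc0, hs0, hβ a ha', hid, add_zero, sub_zero, sub_self,
      mul_zero, zero_sub]
    rw [eq_sub_iff_add_eq, ← mul_right_inj' hka']
    field_simp
    simp only [scoreCov, cval, curv, IsIndepMoments.dRow, IsIndepMoments.dCoord, Option.elim,
      Prod.fst_sub, Prod.snd_sub, Pi.sub_apply, Pi.zero_apply, ht, hid]
    ring

end Expansion

/-! ## Probabilistic limit theorems -/

section Limit

variable {Ω : Type*} [MeasurableSpace Ω] {P : Measure Ω}

/-- Chebyshev's inequality for averages of independent identically distributed variables. -/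
lemma measureReal_average_le [IsProbabilityMeasure P] {X : ℕ → Ω → ℝ}
    (hX : MemLp (X 0) 2 P) (hindep : iIndepFun X P)
    (hident : ∀ i, IdentDistrib (X i) (X 0) P P) {n : ℕ} (hn : n ≠ 0) {ρ : ℝ} (hρ : 0 < ρ) :
    P.real {ω | ρ ≤ |(n : ℝ)⁻¹ * ∑ i : Fin n, X i ω - ∫ ω, X 0 ω ∂P|} ≤
      variance (X 0) P / (n * ρ ^ 2) := by
  have hn' : (n : ℝ) ≠ 0 := by exact_mod_cast hn
  have hL : ∀ i, MemLp (X i) 2 P := fun i => (hident i).memLp_iff.2 hX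
  set A : Ω → ℝ := fun ω => (n : ℝ)⁻¹ * ∑ i : Fin n, X i ω with hA
  have hsumL : MemLp (fun ω => ∑ i ∈ Finset.range n, X i ω) 2 P :=
    memLp_finsetSum _ fun i _ => hL i
  have hA' : A = fun ω => (n : ℝ)⁻¹ * ∑ i ∈ Finset.range n, X i ω := by
    funext ω
    rw [hA, Finset.sum_range]
  have hAL : MemLp A 2 P := by rw [hA']; exact hsumL.const_mul _
  have hmean : ∫ ω, A ω ∂P = ∫ ω, X 0 ω ∂P := by
    rw [hA', integral_const_mul, integral_finsetSum _ fun i _ => (hL i).integrable (by norm_num)]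
    simp only [fun i => (hident i).integral_eq, Finset.sum_const, Finset.card_range, nsmul_eq_mul]
    field_simp
  have hvar : variance A P = variance (X 0) P / n := by
    rw [hA', variance_const_mul]
    have : variance (fun ω => ∑ i ∈ Finset.range n, X i ω) P = n * variance (X 0) P := by
      have h := IndepFun.variance_sum (μ := P) (X := X) (s := Finset.range n) (fun i _ => hL i)
        (fun i _ j _ hij => hindep.indepFun hij)
      rw [show (fun ω => ∑ i ∈ Finset.range n, X i ω) = ∑ i ∈ Finset.range n, X i by
        ext ω; simp, h]
      simp [fun i => (hident i).variance_eq]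
    rw [this]
    field_simp
  have := meas_ge_le_variance_div_sq hAL hρ
  rw [hmean, hvar, div_div] at this
  rw [measureReal_def]
  exact ENNReal.toReal_le_of_le_ofReal (div_nonneg (variance_nonneg _ _) (by positivity)) this

/-- A continuous mapping argument in which `f` has a limit only within the set `S` where the
variables take values. -/
lemma tendstoInMeasure_comp [IsProbabilityMeasure P]
    {F G : Type*} [NormedAddCommGroup F] [NormedAddCommGroup G]
    {X : ℕ → Ω → F} {S : Set F} {x₀ : F} {C : ℝ}
    (hS : ∀ n, n ≠ 0 → ∀ ω, X n ω ∈ S)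
    (hC : ∀ n, n ≠ 0 → ∀ ρ > 0, P.real {ω | ρ ≤ ‖X n ω - x₀‖} ≤ C / (n * ρ ^ 2))
    {f : F → G} {y₀ : G} (hf : Tendsto f (𝓝[S] x₀) (𝓝 y₀)) :
    TendstoInMeasure P (fun n ω => f (X n ω)) atTop fun _ => y₀ := by
  rw [tendstoInMeasure_iff_measureReal_norm]
  intro ε hε
  obtain ⟨ρ, hρ, hball⟩ := Metric.mem_nhdsWithin_iff.1 (hf (Metric.ball_mem_nhds y₀ hε))
  have hlim : Tendsto (fun n : ℕ => C / ρ ^ 2 / (n : ℝ)) atTop (𝓝 0) :=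
    tendsto_const_div_atTop_nhds_zero_nat _
  refine squeeze_zero' (Eventually.of_forall fun n => measureReal_nonneg) ?_ hlim
  filter_upwards [eventually_ne_atTop 0] with n hn
  refine (measureReal_mono fun ω hω => ?_).trans ((hC n hn ρ hρ).trans_eq ?_)
  · simp only [Set.mem_ofPred_eq] at hω ⊢
    by_contra! hlt
    have : f (X n ω) ∈ Metric.ball y₀ ε :=
      hball ⟨by rwa [Metric.mem_ball, dist_eq_norm], hS n hn ω⟩
    rw [Metric.mem_ball, dist_eq_norm] at this
    exact absurd hω (not_le.2 this)
  · rw [div_div, mul_comm]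

/-- The remainder term of the delta method is negligible. -/
lemma tendstoInMeasure_sqrt_smul [IsProbabilityMeasure P]
    {F G : Type*} [NormedAddCommGroup F] [NormedAddCommGroup G]
    [NormedSpace ℝ G] {X : ℕ → Ω → F} {S : Set F} {x₀ : F} {C : ℝ}
    (hS : ∀ n, n ≠ 0 → ∀ ω, X n ω ∈ S)
    (hC : ∀ n, n ≠ 0 → ∀ ρ > 0, P.real {ω | ρ ≤ ‖X n ω - x₀‖} ≤ C / (n * ρ ^ 2))
    {R : F → G} (hR : R =o[𝓝[S] x₀] fun x => x - x₀) :
    TendstoInMeasure P (fun (n : ℕ) ω => √(n : ℝ) • R (X n ω)) atTop 0 := by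
  rw [tendstoInMeasure_iff_measureReal_norm]
  intro ε hε
  have hC0 : 0 ≤ C := by
    have := measureReal_nonneg.trans (hC 1 one_ne_zero 1 one_pos)
    simpa using this
  rw [Metric.tendsto_atTop]
  intro δ hδ
  -- Where `‖R‖ ≤ η‖x - x₀‖`, a large scaled remainder forces `‖x - x₀‖ ≥ ε / (√n η)`. The Chebyshev
  -- bound of that event is `C η² / ε²`, free of `n`.
  obtain ⟨η, hη, hηδ⟩ : ∃ η : ℝ, 0 < η ∧ C * η ^ 2 / ε ^ 2 < δ / 2 := by
    have ht : Tendsto (fun η : ℝ => C * η ^ 2 / ε ^ 2) (𝓝[>] 0) (𝓝 0) := by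
      have : Continuous fun η : ℝ => C * η ^ 2 / ε ^ 2 := by fun_prop
      simpa using (this.tendsto 0).mono_left nhdsWithin_le_nhds
    obtain ⟨η, h1, h2⟩ :=
      ((ht.eventually_lt_const (half_pos hδ)).and self_mem_nhdsWithin).exists
    exact ⟨η, h2, h1⟩
  obtain ⟨ρ, hρ, hball⟩ := Metric.mem_nhdsWithin_iff.1 (hR.bound hη)
  have hlim : Tendsto (fun n : ℕ => C / ρ ^ 2 / (n : ℝ)) atTop (𝓝 0) :=
    tendsto_const_div_atTop_nhds_zero_nat _
  obtain ⟨N, hN⟩ := eventually_atTop.1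
    ((hlim.eventually_lt_const (half_pos hδ)).and (eventually_ne_atTop 0))
  refine ⟨N, fun n hn => ?_⟩
  obtain ⟨h1, hn0⟩ := hN n hn
  have hnpos : (0 : ℝ) < n := by exact_mod_cast Nat.pos_of_ne_zero hn0
  have hsq : 0 < √(n : ℝ) := Real.sqrt_pos.2 hnpos
  rw [Real.dist_eq, sub_zero, abs_of_nonneg measureReal_nonneg]
  have hsub : {ω | ε ≤ ‖√(n : ℝ) • R (X n ω) - (0 : Ω → G) ω‖} ⊆
      {ω | ρ ≤ ‖X n ω - x₀‖} ∪ {ω | ε / (√(n : ℝ) * η) ≤ ‖X n ω - x₀‖} := by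
    intro ω hω
    by_contra hno
    simp only [Set.mem_union, Set.mem_ofPred_eq, not_or, not_le] at hno
    have hb := hball (show X n ω ∈ Metric.ball x₀ ρ ∩ S from
      ⟨by rw [Metric.mem_ball, dist_eq_norm]; exact hno.1, hS n hn0 ω⟩)
    simp only [Set.mem_ofPred_eq, Pi.zero_apply, sub_zero, norm_smul, Real.norm_eq_abs,
      abs_of_pos hsq] at hω hb
    have h3 := (lt_div_iff₀ (mul_pos hsq hη)).1 hno.2
    nlinarith [mul_le_mul_of_nonneg_left hb hsq.le]
  refine (measureReal_mono hsub).trans_lt ((measureReal_union_le _ _).trans_lt ?_)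
  have b1 := hC n hn0 ρ hρ
  have b2 := hC n hn0 (ε / (√(n : ℝ) * η)) (by positivity)
  have e1 : C / (n * ρ ^ 2) = C / ρ ^ 2 / (n : ℝ) := by rw [div_div, mul_comm]
  have e2 : C / (n * (ε / (√(n : ℝ) * η)) ^ 2) = C * η ^ 2 / ε ^ 2 := by
    rw [div_pow, mul_pow, Real.sq_sqrt hnpos.le]
    field_simp
  rw [e1] at b1
  rw [e2] at b2
  linarith

/-- The second moment matrix of a random vector. -/
noncomputable def secondMoment {ι : Type*} (Y : Ω → EuclideanSpace ℝ ι) (P : Measure Ω) :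
    Matrix ι ι ℝ := Matrix.of fun q r => ∫ ω, Y ω q * Y ω r ∂P

variable {ι : Type*} [Fintype ι]

lemma dotProduct_secondMoment {Y : Ω → EuclideanSpace ℝ ι} (hY : ∀ q, MemLp (fun ω => Y ω q) 2 P)
    (t : ι → ℝ) : t ⬝ᵥ secondMoment Y P *ᵥ t = ∫ ω, (∑ q, t q * Y ω q) ^ 2 ∂P := by
  have hint : ∀ q r, Integrable (fun ω => Y ω q * Y ω r) P := fun q r =>
    (hY q).integrable_mul (hY r)
  have h1 : ∀ ω, (∑ q, t q * Y ω q) ^ 2 = ∑ q, ∑ r, t q * t r * (Y ω q * Y ω r) := by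
    intro ω
    rw [pow_two, Finset.sum_mul_sum]
    exact Finset.sum_congr rfl fun q _ => Finset.sum_congr rfl fun r _ => by ring
  simp only [h1]
  rw [integral_finsetSum _ fun q _ => integrable_finsetSum _ fun r _ => (hint q r).const_mul _]
  simp only [dotProduct, mulVec, Finset.mul_sum, secondMoment, Matrix.of_apply]
  refine Finset.sum_congr rfl fun q _ => ?_
  rw [integral_finsetSum _ fun r _ => (hint q r).const_mul _]
  refine Finset.sum_congr rfl fun r _ => ?_
  rw [integral_const_mul]
  ring

lemma secondMoment_posSemidef {Y : Ω → EuclideanSpace ℝ ι}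
    (hY : ∀ q, MemLp (fun ω => Y ω q) 2 P) : (secondMoment Y P).PosSemidef := by
  refine Matrix.PosSemidef.of_dotProduct_mulVec_nonneg ?_ fun t => ?_
  · ext q r
    simp [secondMoment, mul_comm]
  · rw [star_trivial, dotProduct_secondMoment hY]
    exact integral_nonneg fun ω => sq_nonneg _

/-- The multivariate central limit theorem. -/
theorem tendstoInDistribution_multivariate [IsProbabilityMeasure P] [DecidableEq ι]
    {Y : ℕ → Ω → EuclideanSpace ℝ ι}
    (hY : ∀ q, MemLp (fun ω => Y 0 ω q) 2 P) (hmean : ∀ q, ∫ ω, Y 0 ω q ∂P = 0)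
    (hindep : iIndepFun Y P) (hident : ∀ i, IdentDistrib (Y i) (Y 0) P P) :
    TendstoInDistribution (fun (n : ℕ) ω => (√(n : ℝ))⁻¹ • ∑ i ∈ Finset.range n, Y i ω) atTop id
      (fun _ => P) (multivariateGaussian 0 (secondMoment (Y 0) P)) where
  forall_aemeasurable n :=
    (Finset.aemeasurable_fun_sum _ fun i _ => (hident i).aemeasurable_fst).fun_const_smul _
  tendsto := by
    refine ProbabilityMeasure.tendsto_iff_tendsto_charFun.2 fun t => ?_
    set V := secondMoment (Y 0) P with hV
    have hps := secondMoment_posSemidef hY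
    -- Cramér-Wold: the characteristic function at `t` is that of the projection on `t` at `1`, so
    -- the scalar central limit theorem applies.
    set X : ℕ → Ω → ℝ := fun i ω => ∑ q, t q * Y i ω q with hX
    have hm : Measurable fun y : EuclideanSpace ℝ ι => ∑ q, t q * y q := by fun_prop
    have hX2 : MemLp (X 0) 2 P := memLp_finsetSum _ fun q _ => (hY q).const_mul _
    have hXm : ∫ ω, X 0 ω ∂P = 0 := by
      simp only [hX]
      rw [integral_finsetSum _ fun q _ => ((hY q).integrable (by norm_num)).const_mul _]
      simp [integral_const_mul, hmean]
    have hvar : variance (X 0) P = t.ofLp ⬝ᵥ V *ᵥ t.ofLp := by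
      rw [variance_eq_integral hX2.aemeasurable, hXm, hV, dotProduct_secondMoment hY]
      simp [hX]
    have hclt := tendstoInDistribution_inv_sqrt_mul_sum_sub (P := P) (X := X)
      (P' := gaussianReal 0 (variance (X 0) P).toNNReal) (Y := id) HasLaw.id hX2
      (hindep.comp (fun _ y => ∑ q, t q * y q) fun _ => hm)
      (fun i => (hident i).comp hm)
    have hc := ProbabilityMeasure.tendsto_iff_tendsto_charFun.1 hclt.tendsto 1
    have hg : charFun (multivariateGaussian 0 V) t =
        charFun (gaussianReal 0 (variance (X 0) P).toNNReal) 1 := by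
      rw [charFun_multivariateGaussian hps, charFun_gaussianReal, hvar,
        Real.coe_toNNReal _ (by simpa using hps.dotProduct_mulVec_nonneg t.ofLp)]
      simp [hV]
    simp only [ProbabilityMeasure.coe_mk, Measure.map_id] at hc ⊢
    rw [hg]
    refine hc.congr fun n => ?_
    rw [charFun_apply, charFun_apply, integral_map, integral_map]
    · refine integral_congr_ae (ae_of_all _ fun ω => ?_)
      have key : (√(n : ℝ))⁻¹ * (∑ i ∈ Finset.range n, X i ω - n * ∫ ω, X 0 ω ∂P) =
          ∑ q, t q * ((√(n : ℝ))⁻¹ * ∑ i ∈ Finset.range n, Y i ω q) := by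
        rw [hXm, mul_zero, sub_zero, Finset.sum_comm, Finset.mul_sum]
        refine Finset.sum_congr rfl fun q _ => ?_
        rw [← Finset.mul_sum]
        ring
      simp only [key]
      simp [PiLp.inner_apply, mul_comm]
    · exact (Finset.aemeasurable_fun_sum _ fun i _ => (hident i).aemeasurable_fst).fun_const_smul _
    · fun_prop
    · exact hclt.forall_aemeasurable n
    · fun_prop

end Limit

/-! ## Moments of the source vector -/

section Gaussian

/-- The moments are derivatives at zero of `exp (t ^ 2 / 2)`; each differentiation replaces the
polynomial prefactor `q` by `q' + q t`. -/
lemma integral_pow_gaussianReal :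
    ∫ x, x ^ 3 ∂(gaussianReal 0 1) = 0 ∧ ∫ x, x ^ 4 ∂(gaussianReal 0 1) = 3 := by
  have h0 : (0 : ℝ) ∈ interior (integrableExpSet id (gaussianReal 0 1)) := by simp
  have hm : mgf id (gaussianReal 0 1) = fun t : ℝ => 1 * Real.exp (t ^ 2 / 2) := by
    rw [mgf_id_gaussianReal]; simp
  have hd : ∀ q q' : ℝ → ℝ, (∀ t, HasDerivAt q (q' t) t) →
      deriv (fun t : ℝ => q t * Real.exp (t ^ 2 / 2)) =
        fun t => (q' t + q t * t) * Real.exp (t ^ 2 / 2) := by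
    intro q q' hq
    funext t
    have h1 : HasDerivAt (fun t : ℝ => t ^ 2 / 2) t t := by
      have := (hasDerivAt_pow 2 t).div_const 2
      simpa using this
    refine ((hq t).fun_mul h1.exp).deriv.trans ?_
    ring
  have d1 := hd (fun _ => 1) (fun _ => 0) fun t => hasDerivAt_const t 1
  have d2 := hd (fun t => 0 + 1 * t) (fun _ => 1) fun t => by
    simpa using hasDerivAt_id' t
  have d3 := hd (fun t => 1 + (0 + 1 * t) * t) (fun t => 2 * t) fun t => by
    have := (hasDerivAt_pow 2 t).const_add 1
    simpa [pow_two] using this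
  have d4 := hd (fun t => 2 * t + (1 + (0 + 1 * t) * t) * t) (fun t => 3 + 3 * t ^ 2) fun t => by
    have := ((hasDerivAt_id' t).const_mul 3).fun_add (hasDerivAt_pow 3 t)
    refine (this.congr_deriv (by norm_num)).congr_of_eventuallyEq
      (Eventually.of_forall fun s => by ring)
  constructor
  · have := iteratedDeriv_mgf_zero h0 3
    rw [hm, iteratedDeriv_succ, iteratedDeriv_succ, iteratedDeriv_one, d1, d2, d3] at this
    simpa using this.symm
  · have := iteratedDeriv_mgf_zero h0 4
    rw [hm, iteratedDeriv_succ, iteratedDeriv_succ, iteratedDeriv_succ, iteratedDeriv_one,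
      d1, d2, d3, d4] at this
    simpa using this.symm

variable {Ω : Type*} [MeasurableSpace Ω] {P : Measure Ω}

lemma HasGaussianLaw_moments {X : Ω → ℝ} (h : HasGaussianLaw X P) (h1 : ∫ ω, X ω ∂P = 0)
    (h2 : ∫ ω, X ω ^ 2 ∂P = 1) : gam X P = 0 ∧ bet X P = 3 := by
  have hvar : variance X P = 1 := by
    rw [variance_eq_integral h.aemeasurable, h1]
    simpa using h2
  have hmap : P.map X = gaussianReal 0 1 := by
    rw [h.map_eq_gaussianReal, hvar, h1]
    simp
  have hpow : ∀ k : ℕ, ∫ ω, X ω ^ k ∂P = ∫ x, x ^ k ∂(gaussianReal 0 1) := fun k => by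
    rw [← hmap, integral_map h.aemeasurable (by fun_prop)]
  exact ⟨(hpow 3).trans integral_pow_gaussianReal.1, (hpow 4).trans integral_pow_gaussianReal.2⟩

end Gaussian

section Source

variable {Ω : Type*} [MeasurableSpace Ω] {P : Measure Ω} {d p : ℕ}
  {z : Ω → EuclideanSpace ℝ (Fin p)}

/-- The moments of a random vector up to order four. -/
noncomputable def popMoments (z : Ω → EuclideanSpace ℝ (Fin p)) (P : Measure Ω) : Tens p :=
  fun i j k l => ∫ ω, tens4 (z ω) i j k l ∂P

lemma memLp_mul_of_double {f g : Ω → ℝ} {q r : ENNReal} [ENNReal.HolderTriple q q r]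
    (hf : MemLp f q P) (hg : MemLp g q P) : MemLp (fun ω => f ω * g ω) r P :=
  hg.mul' hf

lemma holderTriple_eight : ENNReal.HolderTriple 8 8 4 := ⟨by
  rw [← ENNReal.toReal_eq_toReal_iff' (by simp) (by simp), ENNReal.toReal_add (by simp) (by simp)]
  norm_num [ENNReal.toReal_inv]⟩

lemma holderTriple_four : ENNReal.HolderTriple 4 4 2 := ⟨by
  rw [← ENNReal.toReal_eq_toReal_iff' (by simp) (by simp), ENNReal.toReal_add (by simp) (by simp)]
  norm_num [ENNReal.toReal_inv]⟩

lemma memLp_aug [IsProbabilityMeasure P] (hm : ∀ k, MemLp (fun ω => z ω k) 8 P)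
    (o : Option (Fin p)) :
    MemLp (fun ω => aug (z ω) o) 8 P := by
  cases o with
  | none => exact memLp_const 1
  | some k => exact hm k

/-- Hölder twice, from `L⁸` to `L⁴` to `L²`. The central limit theorem for fourth-order monomials is
where eighth moments are needed. -/
lemma memLp_tens4 [IsProbabilityMeasure P] (hm : ∀ k, MemLp (fun ω => z ω k) 8 P)
    (i j k l : Option (Fin p)) :
    MemLp (fun ω => tens4 (z ω) i j k l) 2 P := by
  have := holderTriple_eight
  have := holderTriple_four
  have h1 : MemLp (fun ω => aug (z ω) i * aug (z ω) j) 4 P :=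
    memLp_mul_of_double (memLp_aug hm i) (memLp_aug hm j)
  have h2 : MemLp (fun ω => aug (z ω) k * aug (z ω) l) 4 P :=
    memLp_mul_of_double (memLp_aug hm k) (memLp_aug hm l)
  have h3 : MemLp (fun ω => (aug (z ω) i * aug (z ω) j) * (aug (z ω) k * aug (z ω) l)) 2 P :=
    memLp_mul_of_double h1 h2
  simpa only [tens4, mul_assoc] using h3

lemma popMoments_swap₁₂ (i j k l : Option (Fin p)) :
    popMoments z P i j k l = popMoments z P j i k l := by
  simp only [popMoments, tens4, mul_comm (aug _ i)]

lemma popMoments_swap₂₃ (i j k l : Option (Fin p)) :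
    popMoments z P i j k l = popMoments z P i k j l := by
  simp only [popMoments, tens4, mul_right_comm _ (aug _ j) (aug _ k)]

lemma popMoments_swap₃₄ (i j k l : Option (Fin p)) :
    popMoments z P i j k l = popMoments z P i j l k := by
  simp only [popMoments, tens4, mul_right_comm _ (aug _ k) (aug _ l)]

/-- A component that occurs exactly once is independent of the other factors and has mean zero. -/
lemma popMoments_eq_zero (h : IsSourceVector d z P) {a : Fin p} {j k l : Option (Fin p)}
    (hj : some a ≠ j) (hk : some a ≠ k) (hl : some a ≠ l) :
    popMoments z P (some a) j k l = 0 := by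
  have hmeas : ∀ k : Fin p, Measurable fun ω => z ω k := fun k => by
    have := h.measurable
    fun_prop
  have hind := h.indep.indepFun_finset {a} {a}ᶜ disjoint_compl_right hmeas
  -- This rebuilds `(1, z)` from the components other than `a`; the value `0` at `a` itself is
  -- arbitrary.
  let ext : (({a}ᶜ : Finset (Fin p)) → ℝ) → Option (Fin p) → ℝ := fun v o =>
    o.elim 1 fun b => if hb : b ∈ ({a}ᶜ : Finset (Fin p)) then v ⟨b, hb⟩ else 0
  have hext : ∀ o, Measurable fun v => ext v o := by
    intro o
    cases o with
    | none => exact measurable_const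
    | some b =>
      by_cases hb : b ∈ ({a}ᶜ : Finset (Fin p))
      · simp only [ext, Option.elim, hb, dif_pos]
        fun_prop
      · simp only [ext, Option.elim, hb, dif_neg, not_false_eq_true]
        exact measurable_const
  have hval : ∀ o, some a ≠ o → ∀ ω, ext (fun i => z ω i) o = aug (z ω) o := by
    intro o ho ω
    cases o with
    | none => rfl
    | some b =>
      have hb : b ∈ ({a}ᶜ : Finset (Fin p)) := by
        simpa using fun hab : b = a => ho (congrArg some hab.symm)
      simp only [ext, Option.elim, hb, dif_pos, aug]
  have hφ : Measurable fun v : ({a} : Finset (Fin p)) → ℝ =>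
      v ⟨a, Finset.mem_singleton_self a⟩ := measurable_pi_apply _
  have h2 := hind.comp (ψ := fun v => ext v j * ext v k * ext v l) hφ
    (((hext j).mul (hext k)).mul (hext l))
  have h3 := h2.integral_fun_mul_eq_mul_integral (by
      exact (hmeas a).aestronglyMeasurable) (by
      refine (Measurable.comp (((hext j).mul (hext k)).mul (hext l)) ?_).aestronglyMeasurable
      exact measurable_pi_lambda _ fun i => hmeas i)
  simp only [Function.comp_apply, hval j hj, hval k hk, hval l hl, h.mean_zero, zero_mul] at h3
  simp only [popMoments, tens4, mul_assoc] at h3 ⊢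
  exact h3

lemma indepFun_comp (h : IsSourceVector d z P) {k l : Fin p} (hkl : k ≠ l) {f g : ℝ → ℝ}
    (hf : Measurable f) (hg : Measurable g) :
    ∫ ω, f (z ω k) * g (z ω l) ∂P = (∫ ω, f (z ω k) ∂P) * ∫ ω, g (z ω l) ∂P := by
  have hmeas : ∀ k : Fin p, Measurable fun ω => z ω k := fun k => by
    have := h.measurable
    fun_prop
  exact ((h.indep.indepFun hkl).comp hf hg).integral_fun_mul_eq_mul_integral
    (hf.comp (hmeas k)).aestronglyMeasurable (hg.comp (hmeas l)).aestronglyMeasurable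

lemma popMoments_pairs (h : IsSourceVector d z P) {k l : Fin p} (hkl : k ≠ l) :
    popMoments z P (some k) (some k) (some l) (some l) = 1 := by
  have := indepFun_comp h hkl (f := fun x => x ^ 2) (g := fun x => x ^ 2) (by fun_prop)
    (by fun_prop)
  rw [h.second_moment_one, h.second_moment_one, one_mul] at this
  rw [← this]
  simp only [popMoments, tens4, aug, Option.elim]
  congr 1
  funext ω
  ring

lemma isIndepMoments_popMoments [IsProbabilityMeasure P] (h : IsSourceVector d z P) :
    IsIndepMoments (fun k => gam (fun ω => z ω k) P) (fun k => bet (fun ω => z ω k) P)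
      (popMoments z P) where
  swap₁₂ := popMoments_swap₁₂
  swap₂₃ := popMoments_swap₂₃
  swap₃₄ := popMoments_swap₃₄
  zero := by simp [popMoments, tens4, aug]
  first a := popMoments_eq_zero h (by simp) (by simp) (by simp)
  second a b := by
    by_cases hab : a = b
    · subst hab
      simpa [popMoments, tens4, aug, ← pow_two] using h.second_moment_one a
    · rw [if_neg hab]
      exact popMoments_eq_zero h (by simpa using hab) (by simp) (by simp)
  third a b c := by
    by_cases hab : a = b
    · subst hab
      by_cases hac : a = c
      · subst hac
        simp [popMoments, tens4, aug, gam, pow_succ]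
      · rw [if_neg (by simp [hac]), popMoments_swap₂₃, popMoments_swap₁₂]
        exact popMoments_eq_zero h (by simpa using Ne.symm hac) (by simpa using Ne.symm hac)
          (by simp)
    · rw [if_neg (by simp [hab])]
      by_cases hac : a = c
      · subst hac
        rw [popMoments_swap₁₂]
        exact popMoments_eq_zero h (by simpa using Ne.symm hab) (by simpa using Ne.symm hab)
          (by simp)
      · exact popMoments_eq_zero h (by simpa using hab) (by simpa using hac) (by simp)
  fourth a b c e := by
    by_cases hab : a = b
    · subst hab
      by_cases hce : c = e
      · subst hce
        by_cases hac : a = c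
        · subst hac
          simp only [and_self, if_true]
          simp only [popMoments, tens4, aug, bet, pow_succ, Option.elim, pow_zero, one_mul]
          ring
        · rw [popMoments_pairs h hac]
          simp [hac]
      · by_cases hac : a = c
        · subst hac
          rw [popMoments_swap₃₄, popMoments_swap₂₃, popMoments_swap₁₂,
            popMoments_eq_zero h (by simpa using Ne.symm hce) (by simpa using Ne.symm hce)
              (by simpa using Ne.symm hce)]
          simp [hce]
        · rw [popMoments_swap₂₃, popMoments_swap₁₂,
            popMoments_eq_zero h (by simpa using Ne.symm hac) (by simpa using Ne.symm hac)
              (by simpa using hce)]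
          simp [hce, hac]
    · by_cases hac : a = c
      · subst hac
        by_cases hbe : b = e
        · subst hbe
          rw [popMoments_swap₂₃, popMoments_pairs h hab]
          simp [hab]
        · rw [popMoments_swap₁₂,
            popMoments_eq_zero h (by simpa using Ne.symm hab) (by simpa using Ne.symm hab)
              (by simpa using hbe)]
          simp [hab, hbe, Ne.symm hab]
      · by_cases hae : a = e
        · subst hae
          by_cases hbc : b = c
          · subst hbc
            rw [popMoments_swap₃₄, popMoments_swap₂₃, popMoments_pairs h hab]
            simp [hab]
          · rw [popMoments_swap₁₂,
              popMoments_eq_zero h (by simpa using Ne.symm hab) (by simpa using hbc)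
                (by simpa using Ne.symm hab)]
            simp [hab, hbc, hac]
        · rw [popMoments_eq_zero h (by simpa using hab) (by simpa using hac)
              (by simpa using hae)]
          simp [hab, hac, hae]

end Source

/-! ## The influence function and its variance -/

section Influence

variable {Ω : Type*} [MeasurableSpace Ω] {P : Measure Ω}

lemma integrable_pow_of_memLp [IsProbabilityMeasure P] {Z : Ω → ℝ} (hZ : MemLp Z 8 P) {j : ℕ}
    (hj : j ≤ 8) : Integrable (fun ω => Z ω ^ j) P := by
  have h1 : MemLp Z j P := hZ.mono_exponent (by exact_mod_cast hj)
  have h2 := h1.integrable_norm_pow'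
  refine (integrable_norm_iff (f := fun ω => Z ω ^ j) (hZ.aestronglyMeasurable.pow j)).1 ?_
  simpa only [norm_pow] using h2

/-- Degree six is enough, since the largest integrands are squares of cubics. -/
lemma integral_polynomial [IsProbabilityMeasure P] {Z : Ω → ℝ} (hZ : MemLp Z 8 P) (c : ℕ → ℝ) :
    Integrable (fun ω => ∑ j ∈ Finset.range 7, c j * Z ω ^ j) P ∧
    ∫ ω, ∑ j ∈ Finset.range 7, c j * Z ω ^ j ∂P =
      ∑ j ∈ Finset.range 7, c j * ∫ ω, Z ω ^ j ∂P := by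
  have hi : ∀ j ∈ Finset.range 7, Integrable (fun ω => c j * Z ω ^ j) P := fun j hj =>
    (integrable_pow_of_memLp hZ (by have := Finset.mem_range.1 hj; omega)).const_mul _
  refine ⟨integrable_finsetSum _ hi, ?_⟩
  rw [integral_finsetSum _ hi]
  simp only [integral_const_mul]

/-- A cubic polynomial. -/
def cubicPoly (A B C K : ℝ) (y : ℝ) : ℝ := A * y ^ 2 + B * y ^ 3 + C * y + K

lemma measurable_cubicPoly (A B C K : ℝ) : Measurable (cubicPoly A B C K) := by
  unfold cubicPoly; fun_prop

variable {Z : Ω → ℝ} (A B C K : ℝ)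

lemma integral_cubicPoly [IsProbabilityMeasure P] (hZ : MemLp Z 8 P) (h1 : ∫ ω, Z ω ∂P = 0)
    (h2 : ∫ ω, Z ω ^ 2 ∂P = 1) :
    Integrable (fun ω => cubicPoly A B C K (Z ω)) P ∧
    ∫ ω, cubicPoly A B C K (Z ω) ∂P = A + B * gam Z P + K := by
  let c : ℕ → ℝ := fun j => match j with
    | 0 => K | 1 => C | 2 => A | 3 => B | _ => 0
  have e : (fun ω => cubicPoly A B C K (Z ω)) = fun ω => ∑ j ∈ Finset.range 7, c j * Z ω ^ j := by
    funext ω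
    simp only [Finset.sum_range_succ, Finset.sum_range_zero, c, cubicPoly]
    ring
  have := integral_polynomial hZ c
  rw [← e] at this
  refine ⟨this.1, (congrArg (fun f => ∫ ω, f ω ∂P) e).trans
    ((integral_polynomial hZ c).2.trans ?_)⟩
  simp only [Finset.sum_range_succ, Finset.sum_range_zero, c, gam, pow_zero, pow_one, h1, h2]
  simp
  ring

lemma integral_cubicPoly_mul [IsProbabilityMeasure P] (hZ : MemLp Z 8 P)
    (h1 : ∫ ω, Z ω ∂P = 0) (h2 : ∫ ω, Z ω ^ 2 ∂P = 1) :
    Integrable (fun ω => cubicPoly A B C K (Z ω) * Z ω) P ∧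
    ∫ ω, cubicPoly A B C K (Z ω) * Z ω ∂P = A * gam Z P + B * bet Z P + C := by
  let c : ℕ → ℝ := fun j => match j with
    | 1 => K | 2 => C | 3 => A | 4 => B | _ => 0
  have e : (fun ω => cubicPoly A B C K (Z ω) * Z ω) =
      fun ω => ∑ j ∈ Finset.range 7, c j * Z ω ^ j := by
    funext ω
    simp only [Finset.sum_range_succ, Finset.sum_range_zero, c, cubicPoly]
    ring
  have := integral_polynomial hZ c
  rw [← e] at this
  refine ⟨this.1, (congrArg (fun f => ∫ ω, f ω ∂P) e).trans
    ((integral_polynomial hZ c).2.trans ?_)⟩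
  simp only [Finset.sum_range_succ, Finset.sum_range_zero, c, gam, bet, pow_zero, pow_one, h1, h2]
  ring

lemma integral_cubicPoly_sq [IsProbabilityMeasure P] (hZ : MemLp Z 8 P)
    (h1 : ∫ ω, Z ω ∂P = 0) (h2 : ∫ ω, Z ω ^ 2 ∂P = 1) :
    Integrable (fun ω => cubicPoly A B C K (Z ω) ^ 2) P ∧
    ∫ ω, cubicPoly A B C K (Z ω) ^ 2 ∂P =
      B ^ 2 * ∫ ω, Z ω ^ 6 ∂P + 2 * A * B * ∫ ω, Z ω ^ 5 ∂P + (A ^ 2 + 2 * B * C) * bet Z P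
        + 2 * (A * C + B * K) * gam Z P + C ^ 2 + 2 * A * K + K ^ 2 := by
  let c : ℕ → ℝ := fun j => match j with
    | 0 => K ^ 2 | 1 => 2 * C * K | 2 => C ^ 2 + 2 * A * K | 3 => 2 * (A * C + B * K)
    | 4 => A ^ 2 + 2 * B * C | 5 => 2 * A * B | 6 => B ^ 2 | _ => 0
  have e : (fun ω => cubicPoly A B C K (Z ω) ^ 2) =
      fun ω => ∑ j ∈ Finset.range 7, c j * Z ω ^ j := by
    funext ω
    simp only [Finset.sum_range_succ, Finset.sum_range_zero, c, cubicPoly]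
    ring
  have := integral_polynomial hZ c
  rw [← e] at this
  refine ⟨this.1, (congrArg (fun f => ∫ ω, f ω ∂P) e).trans
    ((integral_polynomial hZ c).2.trans ?_)⟩
  simp only [Finset.sum_range_succ, Finset.sum_range_zero, c, gam, bet, pow_zero, pow_one, h1, h2]
  simp
  ring

end Influence

/-! ### Mean and variance of the influence function -/

section Source

variable {Ω : Type*} [MeasurableSpace Ω] {P : Measure Ω} {d p : ℕ}
  {z : Ω → EuclideanSpace ℝ (Fin p)}

lemma IsSourceVector.integrable_comp_mul_comp (h : IsSourceVector d z P) {k l : Fin p}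
    (hkl : k ≠ l) {f g : ℝ → ℝ} (hf : Measurable f) (hg : Measurable g)
    (hfi : Integrable (fun ω => f (z ω k)) P) (hgi : Integrable (fun ω => g (z ω l)) P) :
    Integrable (fun ω => f (z ω k) * g (z ω l)) P :=
  ((h.indep.indepFun hkl).comp hf hg).integrable_mul hfi hgi

/-- Mean and variance of `a(z_k) z_l - b(z_l) z_k` for cubic polynomials `a` and `b`, where `a` is
centered and uncorrelated with the identity. -/
lemma IsSourceVector.integral_antisymm [IsProbabilityMeasure P] (h : IsSourceVector d z P)
    (hm : ∀ k, MemLp (fun ω => z ω k) 8 P) {k l : Fin p} (hkl : k ≠ l)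
    (A B C K A' B' C' K' : ℝ)
    (ha : A * gam (fun ω => z ω k) P + B * bet (fun ω => z ω k) P + C = 0) :
    ∫ ω, (cubicPoly A B C K (z ω k) * z ω l - cubicPoly A' B' C' K' (z ω l) * z ω k) ∂P = 0 ∧
    ∫ ω, (cubicPoly A B C K (z ω k) * z ω l - cubicPoly A' B' C' K' (z ω l) * z ω k) ^ 2 ∂P =
      ∫ ω, cubicPoly A B C K (z ω k) ^ 2 ∂P + ∫ ω, cubicPoly A' B' C' K' (z ω l) ^ 2 ∂P := by
  set a := cubicPoly A B C K with hadef
  set b := cubicPoly A' B' C' K' with hbdef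
  have hma : Measurable a := measurable_cubicPoly _ _ _ _
  have hmb : Measurable b := measurable_cubicPoly _ _ _ _
  have h1 := h.mean_zero
  have h2 := h.second_moment_one
  have ia := integral_cubicPoly A B C K (hm k) (h1 k) (h2 k)
  have ib := integral_cubicPoly A' B' C' K' (hm l) (h1 l) (h2 l)
  have ia1 := integral_cubicPoly_mul A B C K (hm k) (h1 k) (h2 k)
  have ib1 := integral_cubicPoly_mul A' B' C' K' (hm l) (h1 l) (h2 l)
  have ia2 := integral_cubicPoly_sq A B C K (hm k) (h1 k) (h2 k)
  have ib2 := integral_cubicPoly_sq A' B' C' K' (hm l) (h1 l) (h2 l)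
  have hid : ∀ i, Integrable (fun ω => z ω i) P := fun i => (hm i).integrable (by norm_num)
  have hsq : ∀ i, Integrable (fun ω => z ω i ^ 2) P := fun i =>
    integrable_pow_of_memLp (hm i) (by norm_num)
  have m1 : Measurable (id : ℝ → ℝ) := measurable_id
  have m2 : Measurable fun x : ℝ => x ^ 2 := by fun_prop
  have j1 := h.integrable_comp_mul_comp hkl hma m1 ia.1 (hid l)
  have j2 := h.integrable_comp_mul_comp hkl.symm hmb m1 ib.1 (hid k)
  have e1 := indepFun_comp h hkl hma m1
  have e2 := indepFun_comp h hkl.symm hmb m1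
  have j3 := h.integrable_comp_mul_comp hkl (hma.pow_const 2) m2 ia2.1 (hsq l)
  have j4 := h.integrable_comp_mul_comp hkl.symm (hmb.pow_const 2) m2 ib2.1 (hsq k)
  have e3 := indepFun_comp h hkl (hma.pow_const 2) m2
  have e4 := indepFun_comp h hkl.symm (hmb.pow_const 2) m2
  have j5 := h.integrable_comp_mul_comp hkl (hma.mul m1) (hmb.mul m1) ia1.1 ib1.1
  have e5 := indepFun_comp h hkl (hma.mul m1) (hmb.mul m1)
  simp only [id, Pi.mul_apply] at j1 j2 e1 e2 j5 e5
  -- The cross term is `E (a(z_k) z_k) E (b(z_l) z_l)`, whose first factor vanishes by `ha`.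
  rw [ia1.2, ha, zero_mul] at e5
  rw [h1, mul_zero] at e1 e2
  rw [h2, mul_one] at e3 e4
  constructor
  · rw [integral_sub j1 j2, e1, e2, sub_zero]
  · have e : ∀ ω, (a (z ω k) * z ω l - b (z ω l) * z ω k) ^ 2 =
        a (z ω k) ^ 2 * z ω l ^ 2 + b (z ω l) ^ 2 * z ω k ^ 2
          - 2 * (a (z ω k) * z ω k * (b (z ω l) * z ω l)) := fun ω => by ring
    simp only [e]
    refine (integral_sub (j3.add j4) (j5.const_mul 2)).trans ?_
    rw [integral_add' j3 j4, integral_const_mul, e3, e4, e5]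
    ring

variable {α : ℝ}

/-- Abbreviations for the third and fourth moments of the components. -/
noncomputable abbrev gams (z : Ω → EuclideanSpace ℝ (Fin p)) (P : Measure Ω) (k : Fin p) : ℝ :=
  gam (fun ω => z ω k) P

/-- The fourth moments of the components. -/
noncomputable abbrev bets (z : Ω → EuclideanSpace ℝ (Fin p)) (P : Measure Ω) (k : Fin p) : ℝ :=
  bet (fun ω => z ω k) P

/-- The term in `x k * x l` is split between the two cubics as their linear parts. The share `-cval`
of component `k` makes its cubic uncorrelated with `z_k`. -/
lemma infl_tens4_of_ne {γ β : Fin p → ℝ} {M₀ : Tens p} (h : IsIndepMoments γ β M₀)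
    (α : ℝ) {k l : Fin p} (hkl : k ≠ l) (x : EuclideanSpace ℝ (Fin p)) :
    infl α γ β (tens4 x - M₀) k l =
      (cubicPoly (alpha1 α * γ k) (alpha2 α * (β k - 3)) (-cval α γ β k)
          (-(alpha1 α * γ k + alpha2 α * (β k - 3) * γ k)) (x k) * x l
        - cubicPoly (alpha1 α * γ l) (alpha2 α * (β l - 3)) (-(3 * alpha2 α * (β l - 3)))
          (-(alpha1 α * γ l + alpha2 α * (β l - 3) * γ l)) (x l) * x k)
        / (curv α γ β k + curv α γ β l) := by
  have e1 : ∀ {k l : Fin p}, k ≠ l → M₀ (some k) (some k) (some l) none = 0 := fun hkl => by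
    rw [h.third]; simp [hkl]
  have e2 : ∀ {k l : Fin p}, k ≠ l → M₀ (some k) (some k) (some k) (some l) = 0 := fun hkl => by
    rw [h.fourth]; simp [hkl]
  have e3 : M₀ (some k) (some l) none none = 0 := by rw [h.second, if_neg hkl]
  simp only [infl, hkl, if_false, scoreCov, Pi.sub_apply, e1 hkl, e1 hkl.symm, e2 hkl, e2 hkl.symm,
    e3, h.first, tens4, aug, Option.elim, cubicPoly]
  congr 1
  ring

lemma infl_tens4_self {γ β : Fin p → ℝ} {M₀ : Tens p} (h : IsIndepMoments γ β M₀)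
    (α : ℝ) (k : Fin p) (x : EuclideanSpace ℝ (Fin p)) :
    infl α γ β (tens4 x - M₀) k k = -(1 / 2) * (x k ^ 2 - 1) := by
  simp only [infl, if_true, Pi.sub_apply, h.second, tens4, aug, Option.elim]
  ring

/-- Mean and variance of the influence function at an off-diagonal entry. -/
lemma IsSourceVector.infl_moments_of_ne [IsProbabilityMeasure P] (h : IsSourceVector d z P)
    (hm : ∀ k, MemLp (fun ω => z ω k) 8 P) (α : ℝ) {k l : Fin p} (hkl : k ≠ l) :
    ∫ ω, infl α (gams z P) (bets z P) (tens4 (z ω) - popMoments z P) k l ∂P = 0 ∧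
    ∫ ω, infl α (gams z P) (bets z P) (tens4 (z ω) - popMoments z P) k l ^ 2 ∂P =
      asvB α (fun ω => z ω k) (fun ω => z ω l) P := by
  have hM := isIndepMoments_popMoments h
  have hint := h.integral_antisymm hm hkl (alpha1 α * gams z P k) (alpha2 α * (bets z P k - 3))
    (-cval α (gams z P) (bets z P) k)
    (-(alpha1 α * gams z P k + alpha2 α * (bets z P k - 3) * gams z P k))
    (alpha1 α * gams z P l) (alpha2 α * (bets z P l - 3)) (-(3 * alpha2 α * (bets z P l - 3)))
    (-(alpha1 α * gams z P l + alpha2 α * (bets z P l - 3) * gams z P l))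
    (by simp only [cval, gams, bets]; ring)
  simp only [infl_tens4_of_ne hM α hkl, div_pow]
  rw [integral_div, integral_div, hint.1, hint.2, zero_div,
    (integral_cubicPoly_sq _ _ _ _ (hm k) (h.mean_zero k) (h.second_moment_one k)).2,
    (integral_cubicPoly_sq _ _ _ _ (hm l) (h.mean_zero l) (h.second_moment_one l)).2]
  refine ⟨rfl, ?_⟩
  -- The cubic of `z_l` has covariance `curv_l` with `z_l`, and `curv_l ^ 2` accounts for the terms
  -- `γ_l⁴`, `γ_l² κ_l²` and `κ_l⁴` that make `B_kl` asymmetric.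
  simp only [asvB, zeta3, zeta4, zeta34, nuc, omg, eta, curv, cval, gams, bets, kap, gam, bet]
  congr 1
  · ring
  · ring

/-- Mean and variance of the influence function at a diagonal entry. -/
lemma IsSourceVector.infl_moments_self [IsProbabilityMeasure P] (h : IsSourceVector d z P)
    (hm : ∀ k, MemLp (fun ω => z ω k) 8 P) (α : ℝ) (k : Fin p) :
    ∫ ω, infl α (gams z P) (bets z P) (tens4 (z ω) - popMoments z P) k k ∂P = 0 ∧
    ∫ ω, infl α (gams z P) (bets z P) (tens4 (z ω) - popMoments z P) k k ^ 2 ∂P =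
      asvD (fun ω => z ω k) P := by
  have hM := isIndepMoments_popMoments h
  have e : ∀ ω, -(1 / 2) * (z ω k ^ 2 - 1) = cubicPoly (-(1 / 2)) 0 0 (1 / 2) (z ω k) :=
    fun ω => by simp only [cubicPoly]; ring
  simp only [infl_tens4_self hM α, e]
  rw [(integral_cubicPoly _ _ _ _ (hm k) (h.mean_zero k) (h.second_moment_one k)).2,
    (integral_cubicPoly_sq _ _ _ _ (hm k) (h.mean_zero k) (h.second_moment_one k)).2]
  simp only [asvD, kap, bet]
  constructor <;> ring

lemma memLp_infl [IsProbabilityMeasure P] (hm : ∀ k, MemLp (fun ω => z ω k) 8 P) (α : ℝ)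
    (γ β : Fin p → ℝ) (M₀ : Tens p) (k l : Fin p) :
    MemLp (fun ω => infl α γ β (tens4 (z ω) - M₀) k l) 2 P := by
  have hT : ∀ i j a b, MemLp (fun ω => (tens4 (z ω) - M₀) i j a b) 2 P := fun i j a b =>
    (memLp_tens4 hm i j a b).sub (memLp_const _)
  have hs : ∀ k l, MemLp (fun ω => scoreCov α γ β (tens4 (z ω) - M₀) k l) 2 P := fun k l =>
    (((hT _ _ _ _).const_mul _).add ((hT _ _ _ _).const_mul _)).sub ((hT _ _ _ _).const_mul _)
  by_cases hkl : k = l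
  · simp only [infl, hkl, if_true]
    exact (hT _ _ _ _).const_mul _
  · simp only [infl, hkl, if_false, div_eq_inv_mul]
    exact (((hs _ _).sub (hs _ _)).add ((hT _ _ _ _).const_mul _)).const_mul _

/-- A noise component contributes neither score nor curvature, so signal and noise columns share one
formula. -/
lemma asvB_eq_asvA {Z Y : Ω → ℝ} (α : ℝ) (hγ : gam Y P = 0) (hβ : bet Y P = 3) :
    asvB α Z Y P = asvA α Z P := by
  have hk : kap Y P = 0 := by
    have : kap Y P = bet Y P - 3 := rfl
    rw [this, hβ, sub_self]
  simp [asvB, asvA, zeta3, zeta4, zeta34, hγ, hk]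

end Source

/-! ## The estimator -/

section Estimator

variable {d p : ℕ}

lemma measurable_tens4 : Measurable (tens4 (p := p)) := by
  have h : ∀ o : Option (Fin p), Measurable fun x => aug x o := fun o => by
    cases o with
    | none => exact measurable_const
    | some k => simp only [aug, Option.elim]; fun_prop
  exact measurable_pi_lambda _ fun i => measurable_pi_lambda _ fun j =>
    measurable_pi_lambda _ fun k => measurable_pi_lambda _ fun l =>
      (((h i).mul (h j)).mul (h k)).mul (h l)

lemma measurable_sampleMoments_sub (n : ℕ) (μ : EuclideanSpace ℝ (Fin p)) :
    Measurable fun s : Fin n → EuclideanSpace ℝ (Fin p) => sampleMoments fun i => s i - μ := by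
  have h : ∀ i : Fin n, Measurable fun s : Fin n → EuclideanSpace ℝ (Fin p) => tens4 (s i - μ) :=
    fun i => measurable_tens4.comp (Measurable.sub_const
      (f := fun s : Fin n → EuclideanSpace ℝ (Fin p) => s i) (measurable_pi_apply i) μ)
  refine measurable_pi_lambda _ fun a => measurable_pi_lambda _ fun b =>
    measurable_pi_lambda _ fun c => measurable_pi_lambda _ fun e => ?_
  simp only [sampleMoments, Pi.smul_apply, Finset.sum_apply, smul_eq_mul]
  refine (Finset.measurable_fun_sum _ fun i _ => ?_).const_mul _
  exact (measurable_pi_apply e).comp ((measurable_pi_apply c).comp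
    ((measurable_pi_apply b).comp ((measurable_pi_apply a).comp (h i))))

/-- The estimate obtained from a choice of maximizers. -/
noncomputable def estimate (u : Tens p → Fin d → Fin p → ℝ) (M : Tens p) :
    Matrix (Fin d) (Fin p) ℝ := Matrix.of (u M) * invSqrt (covOf M)

lemma measurable_estimate {u : Tens p → Fin d → Fin p → ℝ} (hu : Measurable u) (k : Fin d)
    (l : Fin p) : Measurable fun M => estimate u M k l := by
  simp only [estimate, Matrix.mul_apply, Matrix.of_apply]
  refine Finset.measurable_fun_sum _ fun a _ => ?_
  have h1 : Measurable fun M => u M k a := by fun_prop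
  have h2 : Measurable fun M : Tens p => invSqrt (covOf M) a l :=
    (measurable_pi_apply l).comp ((measurable_pi_apply a).comp measurable_param.snd)
  exact h1.mul h2

/-- `vec` of an array, as a continuous linear map. -/
noncomputable def vecCLM (d p : ℕ) :
    (Fin d → Fin p → ℝ) →L[ℝ] EuclideanSpace ℝ (Fin p × Fin d) :=
  LinearMap.toContinuousLinearMap
    { toFun := fun r => WithLp.toLp 2 fun q => r q.2 q.1
      map_add' := fun _ _ => rfl
      map_smul' := fun _ _ => rfl }

lemma vecE_smul (r : ℝ) (W : Matrix (Fin d) (Fin p) ℝ) : vecE (r • W) = r • vecE W := rfl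

/-- The influence function, in vectorized form, as a linear map. -/
noncomputable def inflVec (hdp : d ≤ p) (α : ℝ) (γ β : Fin p → ℝ) :
    Tens p →ₗ[ℝ] EuclideanSpace ℝ (Fin p × Fin d) where
  toFun T := vecCLM d p fun k l => infl α γ β T (Fin.castLE hdp k) l
  map_add' T T' := by
    rw [← map_add]
    congr 1
    ext k l
    simp only [infl, scoreCov, Pi.add_apply]
    split_ifs <;> ring
  map_smul' r T := by
    rw [RingHom.id_apply, ← map_smul]
    congr 1
    ext k l
    simp only [infl, scoreCov, Pi.smul_apply, smul_eq_mul]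
    split_ifs <;> ring

lemma inflVec_apply (hdp : d ≤ p) (α : ℝ) (γ β : Fin p → ℝ) (T : Tens p) (q : Fin p × Fin d) :
    inflVec hdp α γ β T q = infl α γ β T (Fin.castLE hdp q.2) q.1 := rfl

/-- The linear term of the estimate is a normalized sum. -/
lemma sqrt_smul_map_sampleMoments {E : Type*} [AddCommGroup E] [Module ℝ E] (L : Tens p →ₗ[ℝ] E)
    (M₀ : Tens p) (n : ℕ) (s : ℕ → EuclideanSpace ℝ (Fin p)) :
    √(n : ℝ) • L (sampleMoments (fun i : Fin n => s i) - M₀) =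
      (√(n : ℝ))⁻¹ • ∑ i ∈ Finset.range n, L (tens4 (s i) - M₀) := by
  rcases eq_or_ne n 0 with rfl | hn
  · simp
  · have hn' : (n : ℝ) ≠ 0 := by exact_mod_cast hn
    have hpos : (0 : ℝ) < n := by positivity
    have h1 : sampleMoments (fun i : Fin n => s i) - M₀ =
        (n : ℝ)⁻¹ • ∑ i ∈ Finset.range n, (tens4 (s i) - M₀) := by
      rw [Finset.sum_sub_distrib, Finset.sum_const, Finset.card_range, smul_sub, sampleMoments,
        Finset.sum_range, ← Nat.cast_smul_eq_nsmul ℝ, smul_smul, inv_mul_cancel₀ hn', one_smul]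
    rw [h1, map_smul, map_sum, smul_smul]
    congr 1
    rw [← Real.sqrt_div_self, div_eq_mul_inv]

variable {γ β : Fin p → ℝ} {M₀ : Tens p} {α : ℝ} {u : Tens p → Fin d → Fin p → ℝ}

lemma tendsto_estimate {l : Filter (Tens p)} (hu : Tendsto u l (𝓝 (idFrame d p)))
    (hR : Tendsto (fun M => invSqrt (covOf M)) l (𝓝 1)) :
    Tendsto (fun M k a => estimate u M k a) l (𝓝 (idFrame d p)) := by
  have hc : Continuous fun q : Matrix (Fin d) (Fin p) ℝ × Matrix (Fin p) (Fin p) ℝ => q.1 * q.2 :=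
    continuous_fst.matrix_mul continuous_snd
  have h := (hc.tendsto (Matrix.of (idFrame d p), 1)).comp (hu.prodMk_nhds hR)
  rw [Matrix.mul_one] at h
  exact h

/-- Asymptotic linearity of the estimate. -/
lemma IsIndepMoments.isLittleO_estimate (h : IsIndepMoments γ β M₀) (hdp : d ≤ p)
    (hcurv : ∀ a : Fin p, (a : ℕ) < d → 0 < curv α γ β a)
    (hγ : ∀ a : Fin p, d ≤ (a : ℕ) → γ a = 0) (hβ : ∀ a : Fin p, d ≤ (a : ℕ) → β a = 3)
    (hu : ∀ M, u M ∈ frames d p)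
    (hmax : ∀ M, ∀ V ∈ frames d p, objective α (param M) V ≤ objective α (param M) (u M))
    (hW : Tendsto (fun M k a => estimate u M k a) (𝓝[momentSet p] M₀) (𝓝 (idFrame d p))) :
    (fun M => vecE (estimate u M - idZero d p) - inflVec hdp α γ β (M - M₀))
      =o[𝓝[momentSet p] M₀] fun M => M - M₀ := by
  -- A semidefinite matrix with nonzero determinant is definite, and the determinant is close to one
  -- near the population.
  have hpd : ∀ᶠ M in 𝓝[momentSet p] M₀, (covOf M).PosDef := by
    have hdet : Continuous fun M : Tens p => (covOf M).det := continuous_covOf.matrix_det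
    have h0 : (covOf M₀).det ≠ 0 := by rw [h.covOf_eq, Matrix.det_one]; exact one_ne_zero
    filter_upwards [(hdet.tendsto M₀).mono_left nhdsWithin_le_nhds |>.eventually_ne h0,
      self_mem_nhdsWithin] with M hM hmem
    exact (covOf_posSemidef hmem).posDef_iff_isUnit.2
      ((Matrix.isUnit_iff_isUnit_det _).2 (isUnit_iff_ne_zero.2 hM))
  have hcm : ∀ᶠ M in 𝓝[momentSet p] M₀, IsConstrainedMax α M fun k a => estimate u M k a := by
    filter_upwards [hpd, self_mem_nhdsWithin] with M hM hmem
    exact isConstrainedMax_of_maximizer hmem hM (hu M) (hmax M)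
  have h1 := h.isLittleO_sub_infl hdp hcurv hγ hβ nhdsWithin_le_nhds hW hcm
  exact ((vecCLM d p).isBigO_comp _ _).trans_isLittleO h1

end Estimator

/-! ### Concentration of the sample moments -/

section Sample

variable {Ω : Type*} [MeasurableSpace Ω] {P : Measure Ω} {p : ℕ}
  {z : ℕ → Ω → EuclideanSpace ℝ (Fin p)}

/-- The norm is a maximum over finitely many entries, so a union bound over Chebyshev's inequality
suffices. -/
lemma exists_forall_measureReal_sampleMoments_le [IsProbabilityMeasure P]
    (hm : ∀ k, MemLp (fun ω => z 0 ω k) 8 P) (hindep : iIndepFun z P)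
    (hident : ∀ i, IdentDistrib (z i) (z 0) P P) :
    ∃ C : ℝ, ∀ n, n ≠ 0 → ∀ ρ > 0,
      P.real {ω | ρ ≤ ‖sampleMoments (fun i : Fin n => z i ω) - popMoments (z 0) P‖} ≤
        C / (n * ρ ^ 2) := by
  let I := Option (Fin p) × Option (Fin p) × Option (Fin p) × Option (Fin p)
  let T : I → EuclideanSpace ℝ (Fin p) → ℝ := fun q x => tens4 x q.1 q.2.1 q.2.2.1 q.2.2.2
  have hT : ∀ q, Measurable (T q) := fun q =>
    (measurable_pi_apply _).comp ((measurable_pi_apply _).comp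
      ((measurable_pi_apply _).comp ((measurable_pi_apply _).comp measurable_tens4)))
  refine ⟨∑ q : I, variance (fun ω => T q (z 0 ω)) P, fun n hn ρ hρ => ?_⟩
  have hsub : {ω | ρ ≤ ‖sampleMoments (fun i : Fin n => z i ω) - popMoments (z 0) P‖} ⊆
      ⋃ q : I, {ω | ρ ≤ |(n : ℝ)⁻¹ * ∑ i : Fin n, T q (z i ω) - ∫ ω, T q (z 0 ω) ∂P|} := by
    intro ω hω
    by_contra hno
    simp only [Set.mem_iUnion, Set.mem_ofPred_eq, not_exists, not_le] at hno hω
    refine absurd hω (not_le.2 ?_)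
    refine (pi_norm_lt_iff hρ).2 fun a => (pi_norm_lt_iff hρ).2 fun b =>
      (pi_norm_lt_iff hρ).2 fun c => (pi_norm_lt_iff hρ).2 fun e => ?_
    have := hno (a, b, c, e)
    simpa [sampleMoments, popMoments, T] using this
  refine (measureReal_mono hsub).trans ((measureReal_iUnion_fintype_le _).trans ?_)
  rw [Finset.sum_div]
  refine Finset.sum_le_sum fun q _ => ?_
  exact measureReal_average_le (X := fun i ω => T q (z i ω)) (memLp_tens4 hm _ _ _ _)
    (hindep.comp (fun _ => T q) fun _ => hT q) (fun i => (hident i).comp (hT q)) hn hρ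

end Sample

end ProjPursuit

theorem theorem5 {Ω : Type*} [MeasurableSpace Ω] (P : Measure Ω) [IsProbabilityMeasure P]
    (d p : ℕ) (hdp : d ≤ p) (α : ℝ) (hα : α ∈ Set.Icc (0 : ℝ) 1)
    (μ : EuclideanSpace ℝ (Fin p)) (z x : ℕ → Ω → EuclideanSpace ℝ (Fin p))
    (hmodel : IsModelSample d μ 1 z x P)
    (hmoments : ∀ k : Fin p, MemLp (fun ω => z 0 ω k) 8 P)
    (hindex : ∀ j : Fin p, (j : ℕ) < d →
      0 < α * gam (fun ω => z 0 ω j) P ^ 2 + (1 - α) * kap (fun ω => z 0 ω j) P ^ 2) :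
    ∃ West : (n : ℕ) → (Fin n → EuclideanSpace ℝ (Fin p)) → Matrix (Fin d) (Fin p) ℝ,
      -- the estimates are measurable functions of the sample
      (∀ n k l, Measurable fun s => West n s k l) ∧
      -- they solve the sample optimization problem whenever the sample covariance is invertible
      (∀ n s, (covMatrix (empirical s)).PosDef →
        IsSymmetricSolution α (empirical s) (West n s)) ∧
      -- consistency
      TendstoInMeasure P (fun n ω => vecE (West n fun i => x i ω)) atTop
        (fun _ => vecE (idZero d p)) ∧
      -- joint asymptotic normality with the stated variances
      ∃ V : Matrix (Fin p × Fin d) (Fin p × Fin d) ℝ, V.PosSemidef ∧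
        TendstoInDistribution
          (fun (n : ℕ) ω => vecE (√(n : ℝ) • (West n (fun i => x i ω) - idZero d p)))
          atTop id (fun _ => P) (multivariateGaussian 0 V) ∧
        ∀ (k : Fin d) (l : Fin p),
          ((l : ℕ) < d → (l : ℕ) ≠ k → V (l, k) (l, k) =
            asvB α (fun ω => z 0 ω (Fin.castLE hdp k)) (fun ω => z 0 ω l) P) ∧
          ((l : ℕ) = k → V (l, k) (l, k) = asvD (fun ω => z 0 ω l) P) ∧
          (d ≤ (l : ℕ) → V (l, k) (l, k) =
            asvA α (fun ω => z 0 ω (Fin.castLE hdp k)) P) := by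
  obtain ⟨u, hum, hu, hmax, htr⟩ := exists_selection (d := d) (p := p) hdp α
  have hs := hmodel.source 0
  have hM := isIndepMoments_popMoments hs
  have hnoise : ∀ a : Fin p, d ≤ (a : ℕ) → gams (z 0) P a = 0 ∧ bets (z 0) P a = 3 := fun a ha =>
    HasGaussianLaw_moments (hs.noise a ha) (hs.mean_zero a) (hs.second_moment_one a)
  have hcurv : ∀ a : Fin p, (a : ℕ) < d → 0 < curv α (gams (z 0) P) (bets (z 0) P) a := by
    intro a ha
    have h1 : 0 < α * gams (z 0) P a ^ 2 + (1 - α) * (bets (z 0) P a - 3) ^ 2 := hindex a ha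
    -- The curvature `3αγ² + 4(1 - α)κ²` is three times the population index plus this term.
    have h2 : 0 ≤ (1 - α) * (bets (z 0) P a - 3) ^ 2 :=
      mul_nonneg (sub_nonneg.2 hα.2) (sq_nonneg _)
    simp only [curv, alpha1, alpha2]
    linarith
  obtain ⟨hut, hRt⟩ := hM.tendsto_selection hdp hα hindex (fun a ha => by
    obtain ⟨h3, h4⟩ := hnoise a ha
    simp only [IsIndepMoments.gval, h3, h4]
    ring) hu hmax htr
  have hWt := tendsto_estimate hut hRt
  have hR := hM.isLittleO_estimate hdp hcurv (fun a ha => (hnoise a ha).1)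
    (fun a ha => (hnoise a ha).2) hu hmax hWt
  obtain ⟨C, hC⟩ := exists_forall_measureReal_sampleMoments_le hmoments hmodel.indep
    hmodel.identDistrib
  have hS : ∀ n, n ≠ 0 → ∀ ω, sampleMoments (fun i : Fin n => z i ω) ∈ momentSet p :=
    fun n hn ω => ⟨n, _, hn, rfl⟩
  have hxz : ∀ i ω, x i ω - μ = z i ω := fun i ω => by
    rw [hmodel.observed, Matrix.one_mulVec]
    exact add_sub_cancel_left _ _
  have hest : ∀ n : ℕ, Measurable fun s : Fin n → EuclideanSpace ℝ (Fin p) =>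
      sampleMoments fun i => s i - μ := fun n => measurable_sampleMoments_sub n μ
  set L := inflVec hdp α (gams (z 0) P) (bets (z 0) P) with hL
  set M₀ := popMoments (z 0) P with hM₀
  set Y : ℕ → Ω → EuclideanSpace ℝ (Fin p × Fin d) := fun i ω => L (tens4 (z i ω) - M₀) with hY
  have hLm : Measurable fun y : EuclideanSpace ℝ (Fin p) => L (tens4 y - M₀) :=
    L.continuous_of_finiteDimensional.measurable.comp (measurable_tens4.sub_const M₀)
  have hY2 : ∀ q, MemLp (fun ω => Y 0 ω q) 2 P := fun q => memLp_infl hmoments α _ _ _ _ _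
  have hY0 : ∀ q, ∫ ω, Y 0 ω q ∂P = 0 := by
    intro q
    simp only [hY, hL, inflVec_apply]
    by_cases hq : Fin.castLE hdp q.2 = q.1
    · rw [hq]
      exact (hs.infl_moments_self hmoments α _).1
    · exact (hs.infl_moments_of_ne hmoments α hq).1
  have hV : ∀ (k : Fin d) (l : Fin p), secondMoment (Y 0) P (l, k) (l, k) =
      ∫ ω, infl α (gams (z 0) P) (bets (z 0) P) (tens4 (z 0 ω) - M₀) (Fin.castLE hdp k) l ^ 2 ∂P :=
    fun k l => by
      simp only [secondMoment, Matrix.of_apply, hY, hL, inflVec_apply, pow_two]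
  have hne : ∀ (k : Fin d) (l : Fin p), (l : ℕ) ≠ k → Fin.castLE hdp k ≠ l := fun k l hkl h =>
    hkl (by rw [← h]; rfl)
  -- Centering at the fixed `μ` makes the moments concentrate at those of `z`; the result solves the
  -- sample problem for any shift.
  refine ⟨fun n s => estimate u (sampleMoments fun i => s i - μ), fun n k l =>
    (measurable_estimate hum k l).comp (hest n), fun n s hpd => ?_, ?_,
    secondMoment (Y 0) P, secondMoment_posSemidef hY2, ?_, fun k l => ⟨fun hl hkl => ?_,
      fun hkl => ?_, fun hl => ?_⟩⟩
  · rcases eq_or_ne n 0 with rfl | hn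
    · exact isSymmetricSolution_of_isEmpty α _
        (Nat.le_zero.1 (hdp.trans_eq (eq_zero_of_posDef_covMatrix_empirical s hpd))) _
    · exact isSymmetricSolution_of_maximizer α hn s μ hpd (hu _) (hmax _)
  · simp only [hxz]
    exact tendstoInMeasure_comp hS hC (((vecCLM d p).continuous.tendsto _).comp hWt)
  · have hclt := tendstoInDistribution_multivariate hY2 hY0
      (hmodel.indep.comp (fun _ y => L (tens4 y - M₀)) fun _ => hLm)
      (fun i => (hmodel.identDistrib i).comp hLm)
    have hrem := tendstoInMeasure_sqrt_smul hS hC hR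
    have hzm : ∀ i, Measurable (z i) := fun i => (hmodel.source i).measurable
    have hestm : ∀ n : ℕ, Measurable fun ω =>
        vecE (√(n : ℝ) • (estimate u (sampleMoments fun i : Fin n => z i ω) - idZero d p)) := by
      intro n
      have h1 : Measurable fun ω => (fun i : Fin n => z i ω + μ) :=
        measurable_pi_lambda _ fun i => (hzm i).add_const μ
      have h2 : Measurable fun ω => sampleMoments fun i : Fin n => z i ω := by
        simpa [Function.comp_def] using (hest n).comp h1
      have h3 : Measurable fun ω k l =>
          (√(n : ℝ) • (estimate u (sampleMoments fun i : Fin n => z i ω) - idZero d p)) k l :=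
        measurable_pi_lambda _ fun k => measurable_pi_lambda _ fun l =>
          (((measurable_estimate hum k l).comp h2).sub_const _).const_smul (√(n : ℝ))
      exact (vecCLM d p).continuous.measurable.comp h3
    simp only [hxz]
    refine tendstoInDistribution_of_tendstoInMeasure_sub _ _ hclt ?_
      fun n => (hestm n).aemeasurable
    -- Slutsky: the scaled error differs from the normalized sum of the `Y i` by exactly `√n` times
    -- the remainder of the expansion.
    refine hrem.congr' (Eventually.of_forall fun n => ae_of_all _ fun ω => ?_) EventuallyEq.rfl
    simp only [Pi.sub_apply]
    rw [← sqrt_smul_map_sampleMoments L M₀ n fun i => z i ω, smul_sub, vecE_smul]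
  · rw [hV]
    exact (hs.infl_moments_of_ne hmoments α (hne k l hkl)).2
  · have e : Fin.castLE hdp k = l := Fin.ext hkl.symm
    rw [hV, e]
    exact (hs.infl_moments_self hmoments α l).2
  · rw [hV, ← asvB_eq_asvA α (hnoise l hl).1 (hnoise l hl).2]
    exact (hs.infl_moments_of_ne hmoments α (hne k l (by omega))).2
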